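/- Let $d\ge 1$, let $\Omega\subset\mathbb{R}^d$ be a bounded domain (a nonempty connected open set; no regularity of the boundary is needed), and let $a\in L^\infty(\Omega;\mathbb{R})$ satisfy $a\ge 0$ almost everywhere and $\int_\Omega a(x)\,dx>0$. Let $H^1_0(\Omega)$ be the closure of $C_c^\infty(\Omega;\mathbb{C})$ in $H^1(\Omega;\mathbb{C})$, with norm $(\|u\|_{L^2}^2+\|\nabla u\|_{L^2}^2)^{1/2}$, and let $\mathcal{H}=H^1_0(\Omega)\times L^2(\Omega;\mathbb{C})$ with the norm $\|(u_0,u_1)\|_{\mathcal H}^2=\|u_0\|_{H^1}^2+\|u_1\|_{L^2}^2$. Let $\mathcal{A}$ be the generator of the Kelvin--Voigt damped wave equation with Dirichlet boundary condition, i.e. the unbounded operator on $\mathcal{H}$ $$\mathcal{A}(u_0,u_1)=\bigl(u_1,\ \Delta u_0+\operatorname{div}(a\nabla u_1)\bigr),\qquad D(\mathcal{A})=\bigl\{(u_0,u_1)\in H^1_0\times L^2:\ u_1\in H^1_0,\ \Delta u_0+\operatorname{div}(a\nabla u_1)\in L^2\bigr\},$$ where $\Delta$ and $\operatorname{div}$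 are taken in the sense of distributions on $\Omega$. Then for every $M>0$ there exists $C>0$ such that for every $\lambda\in\mathbb{R}$ with $|\lambda|\le M$ the operator $\mathcal{A}-i\lambda$ is invertible from $D(\mathcal{A})$ onto $\mathcal{H}$, its inverse is a bounded operator on $\mathcal{H}$, and $$\|(\mathcal{A}-i\lambda)^{-1}\|_{\mathcal{L}(\mathcal{H})}\le C .$$ -/

import Mathlib

open MeasureTheory TopologicalSpace
open scoped ENNReal Distributions

noncomputable section

namespace KelvinVoigt

variable {d : ℕ} (Ω : Opens (EuclideanSpace ℝ (Fin d)))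

/-- Lebesgue measure on the open set `Ω`. -/
abbrev vol : Measure (EuclideanSpace ℝ (Fin d)) :=
  volume.restrict (Ω : Set (EuclideanSpace ℝ (Fin d)))

/-- The complex Hilbert space `L²(Ω)`. -/
abbrev L2 : Type := Lp ℂ 2 (vol Ω)

/-- The complex Hilbert space `L²(Ω)^d` of square integrable vector fields. -/
abbrev L2Vec : Type := Lp (EuclideanSpace ℂ (Fin d)) 2 (vol Ω)

/-- `L²(Ω) × L²(Ω)^d` with the norm `(‖u‖² + ‖G‖²)^{1/2}`. -/
abbrev L2Pair : Type := WithLp 2 (L2 Ω × L2Vec Ω)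

/-- The partial derivative `∂ᵢ φ` of a function on `ℝ^d`. -/
def partialDeriv {V : Type*} [NormedAddCommGroup V] [NormedSpace ℝ V]
    (φ : EuclideanSpace ℝ (Fin d) → V) (i : Fin d) (x : EuclideanSpace ℝ (Fin d)) : V :=
  fderiv ℝ φ x (EuclideanSpace.single i 1)

/-- The (classical) gradient of a complex valued function. -/
def gradient (φ : EuclideanSpace ℝ (Fin d) → ℂ) (x : EuclideanSpace ℝ (Fin d)) :
    EuclideanSpace ℂ (Fin d) :=
  WithLp.toLp 2 fun i => partialDeriv φ i x

/-- `∇u = G` in the sense of distributions on `Ω`. -/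
def HasWeakGradient (u : EuclideanSpace ℝ (Fin d) → ℂ)
    (G : EuclideanSpace ℝ (Fin d) → EuclideanSpace ℂ (Fin d)) : Prop :=
  ∀ (φ : 𝓓(Ω, ℝ)) (i : Fin d),
    ∫ x, partialDeriv φ i x • u x ∂(vol Ω) = -∫ x, φ x • G x i ∂(vol Ω)

/-- `div F = g` in the sense of distributions on `Ω`. -/
def HasWeakDivergence (F : EuclideanSpace ℝ (Fin d) → EuclideanSpace ℂ (Fin d))
    (g : EuclideanSpace ℝ (Fin d) → ℂ) : Prop :=
  ∀ φ : 𝓓(Ω, ℝ),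
    ∫ x, ∑ i, partialDeriv φ i x • F x i ∂(vol Ω) = -∫ x, φ x • g x ∂(vol Ω)

section Aux

variable {Ω}

lemma continuous_partialDeriv {V : Type*} [NormedAddCommGroup V] [NormedSpace ℝ V]
    (φ : 𝓓(Ω, V)) (i : Fin d) : Continuous (partialDeriv φ i) :=
  (φ.contDiff.continuous_fderiv (by simp)).clm_apply continuous_const

lemma hasCompactSupport_partialDeriv {V : Type*} [NormedAddCommGroup V] [NormedSpace ℝ V]
    (φ : 𝓓(Ω, V)) (i : Fin d) : HasCompactSupport (partialDeriv φ i) :=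
  φ.hasCompactSupport.fderiv_apply ℝ _

lemma memLp_testFunction {V : Type*} [NormedAddCommGroup V] [NormedSpace ℝ V]
    (φ : 𝓓(Ω, V)) : MemLp φ 2 (vol Ω) :=
  (φ.continuous.memLp_of_hasCompactSupport φ.hasCompactSupport)

lemma memLp_partialDeriv {V : Type*} [NormedAddCommGroup V] [NormedSpace ℝ V]
    (φ : 𝓓(Ω, V)) (i : Fin d) : MemLp (partialDeriv φ i) 2 (vol Ω) :=
  (continuous_partialDeriv φ i).memLp_of_hasCompactSupport (hasCompactSupport_partialDeriv φ i)

lemma memLp_gradient (φ : 𝓓(Ω, ℂ)) : MemLp (gradient φ) 2 (vol Ω) := by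
  refine Continuous.memLp_of_hasCompactSupport ?_ ?_
  · exact (PiLp.continuous_toLp 2 _).comp
      (continuous_pi fun i => continuous_partialDeriv φ i)
  · refine (φ.hasCompactSupport.fderiv ℝ).mono fun x hx => ?_
    contrapose! hx
    simp only [Function.mem_support, not_not] at hx ⊢
    ext i
    simp [gradient, partialDeriv, hx]

lemma integrable_smul {ψ : EuclideanSpace ℝ (Fin d) → ℝ} (hψ : MemLp ψ 2 (vol Ω))
    {u : EuclideanSpace ℝ (Fin d) → ℂ} (hu : MemLp u 2 (vol Ω)) :
    Integrable (fun x => ψ x • u x) (vol Ω) :=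
  memLp_one_iff_integrable.1 (MemLp.smul (p := 2) (q := 2) (r := 1) hu hψ)

lemma memLp_apply {G : EuclideanSpace ℝ (Fin d) → EuclideanSpace ℂ (Fin d)}
    (hG : MemLp G 2 (vol Ω)) (i : Fin d) : MemLp (fun x => G x i) 2 (vol Ω) :=
  (EuclideanSpace.proj (𝕜 := ℂ) i).comp_memLp' hG

/-- Integration against a fixed square integrable function. -/
lemma continuous_integral_smul {ψ : EuclideanSpace ℝ (Fin d) → ℝ} (hψ : MemLp ψ 2 (vol Ω)) :
    Continuous fun u : L2 Ω => ∫ x, ψ x • u x ∂(vol Ω) := by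
  have hψ' : MemLp (fun x => (ψ x : ℂ)) 2 (vol Ω) := hψ.ofReal
  have : (fun u : L2 Ω => ∫ x, ψ x • u x ∂(vol Ω)) = fun u => inner ℂ (hψ'.toLp _) u := by
    funext u
    rw [L2.inner_def]
    refine integral_congr_ae ?_
    filter_upwards [hψ'.coeFn_toLp] with x hx
    rw [hx]
    simp [mul_comm]
  rw [this]
  fun_prop

/-- The fundamental lemma of the calculus of variations. -/
lemma ae_eq_of_integral_test {u v : EuclideanSpace ℝ (Fin d) → ℂ}
    (hu : MemLp u 2 (vol Ω)) (hv : MemLp v 2 (vol Ω))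
    (h : ∀ φ : 𝓓(Ω, ℝ), ∫ x, φ x • u x ∂(vol Ω) = ∫ x, φ x • v x ∂(vol Ω)) :
    u =ᵐ[vol Ω] v := by
  have key : ∀ᵐ x ∂volume, x ∈ (Ω : Set (EuclideanSpace ℝ (Fin d))) → (u - v) x = 0 := by
    refine Ω.isOpen.ae_eq_zero_of_integral_contDiff_smul_eq_zero ?_ ?_
    · exact locallyIntegrableOn_of_locallyIntegrable_restrict
        ((hu.sub hv).locallyIntegrable (by norm_num))
    · intro g hg hc hs
      let φ : 𝓓(Ω, ℝ) := ⟨g, hg, hc, hs⟩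
      have e : ∫ x, g x • (u - v) x ∂(vol Ω) = 0 := by
        have h1 := integrable_smul (memLp_testFunction φ) hu
        have h2 := integrable_smul (memLp_testFunction φ) hv
        have h3 := integral_sub h1 h2
        rw [h φ, sub_self] at h3
        rw [← h3]
        exact integral_congr_ae (.of_forall fun x => by simp [φ, mul_sub])
      rw [← e]
      refine (setIntegral_eq_integral_of_forall_compl_eq_zero fun x hx => ?_).symm
      have : g x = 0 := image_eq_zero_of_notMem_tsupport fun hh => hx (hs hh)
      simp [this]
  refine (ae_restrict_iff' Ω.isOpen.measurableSet).2 ?_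
  filter_upwards [key] with x hx hxΩ
  exact sub_eq_zero.1 (hx hxΩ)

end Aux

/-- The Sobolev space `H¹(Ω)`, realised as the space of pairs `(u, ∇u)` with `u` and its
distributional gradient in `L²`; the norm is `(‖u‖² + ‖∇u‖²)^{1/2}`. -/
def H1 : Submodule ℂ (L2Pair Ω) where
  carrier := {U | HasWeakGradient Ω U.fst U.snd}
  zero_mem' := by
    intro φ i
    have h1 : ∫ x, partialDeriv φ i x • ((0 : L2Pair Ω).fst : _ → ℂ) x ∂(vol Ω) = 0 := by
      refine integral_eq_zero_of_ae ?_
      filter_upwards [Lp.coeFn_zero ℂ 2 (vol Ω)] with x hx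
      have hx' : ((0 : L2Pair Ω).fst : _ → ℂ) x = 0 := hx
      simp only [hx', smul_zero, Pi.zero_apply]
    have h2 : ∫ x, φ x • ((0 : L2Pair Ω).snd : _ → EuclideanSpace ℂ (Fin d)) x i ∂(vol Ω) = 0 := by
      refine integral_eq_zero_of_ae ?_
      filter_upwards [Lp.coeFn_zero (EuclideanSpace ℂ (Fin d)) 2 (vol Ω)] with x hx
      have hx' : ((0 : L2Pair Ω).snd : _ → EuclideanSpace ℂ (Fin d)) x = 0 := hx
      simp only [hx', PiLp.zero_apply, smul_zero, Pi.zero_apply]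
    rw [h1, h2, neg_zero]
  add_mem' := by
    intro U V hU hV φ i
    have h1 : ∫ x, partialDeriv φ i x • ((U + V).fst : _ → ℂ) x ∂(vol Ω)
        = (∫ x, partialDeriv φ i x • U.fst x ∂(vol Ω))
          + ∫ x, partialDeriv φ i x • V.fst x ∂(vol Ω) := by
      rw [← integral_add (integrable_smul (memLp_partialDeriv φ i) (Lp.memLp _))
        (integrable_smul (memLp_partialDeriv φ i) (Lp.memLp _))]
      refine integral_congr_ae ?_
      filter_upwards [Lp.coeFn_add U.fst V.fst] with x hx
      have hx' : (U + V).fst x = U.fst x + V.fst x := hx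
      simp only [hx', smul_add]
    have h2 : ∫ x, φ x • ((U + V).snd : _ → EuclideanSpace ℂ (Fin d)) x i ∂(vol Ω)
        = (∫ x, φ x • U.snd x i ∂(vol Ω)) + ∫ x, φ x • V.snd x i ∂(vol Ω) := by
      rw [← integral_add (integrable_smul (memLp_testFunction φ) (memLp_apply (Lp.memLp _) i))
        (integrable_smul (memLp_testFunction φ) (memLp_apply (Lp.memLp _) i))]
      refine integral_congr_ae ?_
      filter_upwards [Lp.coeFn_add U.snd V.snd] with x hx
      have hx' : (U + V).snd x = U.snd x + V.snd x := hx
      simp only [hx', PiLp.add_apply, smul_add]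
    rw [h1, h2, hU φ i, hV φ i]
    ring
  smul_mem' := by
    intro c U hU φ i
    have h1 : ∫ x, partialDeriv φ i x • ((c • U).fst : _ → ℂ) x ∂(vol Ω)
        = c * ∫ x, partialDeriv φ i x • U.fst x ∂(vol Ω) := by
      rw [← integral_const_mul]
      refine integral_congr_ae ?_
      filter_upwards [Lp.coeFn_smul c U.fst] with x hx
      simp [hx]
      ring
    have h2 : ∫ x, φ x • ((c • U).snd : _ → EuclideanSpace ℂ (Fin d)) x i ∂(vol Ω)
        = c * ∫ x, φ x • U.snd x i ∂(vol Ω) := by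
      rw [← integral_const_mul]
      refine integral_congr_ae ?_
      filter_upwards [Lp.coeFn_smul c U.snd] with x hx
      simp [hx]
      ring
    rw [h1, h2, hU φ i]
    ring

/-- The test functions `C_c^∞(Ω)`, as pairs `(φ, ∇φ)` in `L²(Ω) × L²(Ω)^d`. -/
def testPairs : Submodule ℂ (L2Pair Ω) where
  carrier := {U | ∃ φ : 𝓓(Ω, ℂ), U.fst =ᵐ[vol Ω] φ ∧ U.snd =ᵐ[vol Ω] gradient φ}
  zero_mem' := by
    refine ⟨0, ?_, ?_⟩
    · exact Lp.coeFn_zero ℂ 2 (vol Ω)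
    · filter_upwards [Lp.coeFn_zero (EuclideanSpace ℂ (Fin d)) 2 (vol Ω)] with x hx
      have : ((0 : 𝓓(Ω, ℂ)) : _ → ℂ) = 0 := rfl
      have hx' : ((0 : L2Pair Ω).snd : _ → EuclideanSpace ℂ (Fin d)) x = 0 := hx
      rw [hx']
      ext i
      simp [gradient, partialDeriv, this]
  add_mem' := by
    rintro U V ⟨φ, h1, h2⟩ ⟨ψ, h3, h4⟩
    refine ⟨φ + ψ, ?_, ?_⟩
    · filter_upwards [Lp.coeFn_add U.fst V.fst, h1, h3] with x hx e1 e3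
      have hx' : (U + V).fst x = U.fst x + V.fst x := hx
      rw [hx', e1, e3]
      rfl
    · filter_upwards [Lp.coeFn_add U.snd V.snd, h2, h4] with x hx e2 e4
      have e : ((φ + ψ : 𝓓(Ω, ℂ)) : _ → ℂ) = φ + ψ := rfl
      have hφ : DifferentiableAt ℝ φ x := φ.contDiff.differentiable (by simp) x
      have hψ : DifferentiableAt ℝ ψ x := ψ.contDiff.differentiable (by simp) x
      ext i
      have hx' : (U + V).snd x = U.snd x + V.snd x := hx
      rw [hx', e2, e4]
      simp [gradient, partialDeriv, e, fderiv_add hφ hψ]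
  smul_mem' := by
    rintro c U ⟨φ, h1, h2⟩
    refine ⟨c • φ, ?_, ?_⟩
    · filter_upwards [Lp.coeFn_smul c U.fst, h1] with x hx e1
      simp [hx, e1]
    · filter_upwards [Lp.coeFn_smul c U.snd, h2] with x hx e2
      have e : ((c • φ : 𝓓(Ω, ℂ)) : _ → ℂ) = c • φ := rfl
      have hφ : DifferentiableAt ℝ φ x := φ.contDiff.differentiable (by simp) x
      ext i
      simp [hx, e2, gradient, partialDeriv, e, fderiv_const_smul hφ]

/-- The Sobolev space `H¹₀(Ω)`: the closure of `C_c^∞(Ω)` for the `H¹` norm. An element is the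
pair `(u, ∇u)`; it lies in `H¹(Ω)` by `H10_le_H1`. -/
def H10 : Submodule ℂ (L2Pair Ω) := (testPairs Ω).topologicalClosure

section Aux

variable {Ω}

/-- Every test function has its pair `(φ, ∇φ)` in `testPairs`. -/
lemma mk_mem_testPairs (φ : 𝓓(Ω, ℂ)) :
    (WithLp.toLp 2 ((memLp_testFunction φ).toLp _, (memLp_gradient φ).toLp _) : L2Pair Ω)
      ∈ testPairs Ω :=
  ⟨φ, (memLp_testFunction φ).coeFn_toLp, (memLp_gradient φ).coeFn_toLp⟩

lemma continuous_coordinate (i : Fin d) :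
    Continuous fun G : L2Vec Ω => (EuclideanSpace.proj (𝕜 := ℂ) i).compLp G :=
  ((EuclideanSpace.proj (𝕜 := ℂ) i).compLpL 2 (vol Ω)).continuous

lemma isClosed_H1 : IsClosed (H1 Ω : Set (L2Pair Ω)) := by
  have : (H1 Ω : Set (L2Pair Ω)) = ⋂ φ : 𝓓(Ω, ℝ), ⋂ i : Fin d,
      {U | ∫ x, partialDeriv φ i x • U.fst x ∂(vol Ω)
        = -∫ x, φ x • (EuclideanSpace.proj (𝕜 := ℂ) i).compLp U.snd x ∂(vol Ω)} := by
    ext U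
    simp only [Set.mem_iInter, Set.mem_ofPred_eq]
    refine forall_congr' fun φ => forall_congr' fun i => ?_
    have : ∫ x, φ x • (EuclideanSpace.proj (𝕜 := ℂ) i).compLp U.snd x ∂(vol Ω)
        = ∫ x, φ x • U.snd x i ∂(vol Ω) := by
      refine integral_congr_ae ?_
      filter_upwards [(EuclideanSpace.proj (𝕜 := ℂ) i).coeFn_compLp U.snd] with x hx
      simp [hx]
    rw [this]
  rw [this]
  refine isClosed_iInter fun φ => isClosed_iInter fun i => isClosed_eq ?_ ?_
  · exact (continuous_integral_smul (memLp_partialDeriv φ i)).comp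
      (WithLp.prod_continuous_ofLp 2 _ _).fst
  · exact ((continuous_integral_smul (memLp_testFunction φ)).comp ((continuous_coordinate i).comp
      (WithLp.prod_continuous_ofLp 2 _ _).snd)).neg

lemma hasWeakGradient_test (ψ : 𝓓(Ω, ℂ)) : HasWeakGradient Ω ψ (gradient ψ) := by
  intro φ i
  have hφ : Differentiable ℝ φ := φ.contDiff.differentiable (by simp)
  have hψ : Differentiable ℝ ψ := ψ.contDiff.differentiable (by simp)
  have c1 : Integrable (fun x => partialDeriv φ i x • ψ x) volume :=
    ((continuous_partialDeriv φ i).smul ψ.continuous).integrable_of_hasCompactSupport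
      (hasCompactSupport_partialDeriv φ i).smul_right
  have c2 : Integrable (fun x => φ x • partialDeriv ψ i x) volume :=
    (φ.continuous.smul (continuous_partialDeriv ψ i)).integrable_of_hasCompactSupport
      φ.hasCompactSupport.smul_right
  have c3 : Integrable (fun x => φ x • ψ x) volume :=
    (φ.continuous.smul ψ.continuous).integrable_of_hasCompactSupport
      φ.hasCompactSupport.smul_right
  have key := integral_smul_fderiv_eq_neg_fderiv_smul_of_integrable
    (v := EuclideanSpace.single i (1 : ℝ)) c1 c2 c3 (fun x _ => hφ x) (fun x _ => hψ x)
  rw [setIntegral_eq_integral_of_forall_compl_eq_zero,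
    setIntegral_eq_integral_of_forall_compl_eq_zero]
  · simp only [partialDeriv, gradient] at key ⊢
    rw [key, neg_neg]
  · intro x hx
    have : φ x = 0 := image_eq_zero_of_notMem_tsupport fun hh => hx (φ.tsupport_subset hh)
    simp [this]
  · intro x hx
    have : ψ x = 0 := image_eq_zero_of_notMem_tsupport fun hh => hx (ψ.tsupport_subset hh)
    simp [this]

lemma H10_le_H1 : H10 Ω ≤ H1 Ω := by
  refine Submodule.topologicalClosure_minimal _ ?_ isClosed_H1
  rintro U ⟨ψ, h1, h2⟩ φ i
  have e1 : ∫ x, partialDeriv φ i x • U.fst x ∂(vol Ω)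
      = ∫ x, partialDeriv φ i x • ψ x ∂(vol Ω) :=
    integral_congr_ae (by filter_upwards [h1] with x hx; rw [hx])
  have e2 : ∫ x, φ x • U.snd x i ∂(vol Ω) = ∫ x, φ x • gradient ψ x i ∂(vol Ω) :=
    integral_congr_ae (by filter_upwards [h2] with x hx; rw [hx])
  rw [e1, e2]
  exact hasWeakGradient_test ψ φ i

/-- An element of `H¹` is determined by its underlying `L²` function. -/
lemma H1_ext {U V : L2Pair Ω} (hU : U ∈ H1 Ω) (hV : V ∈ H1 Ω) (h : U.fst = V.fst) : U = V := by
  have hs : U.snd = V.snd := by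
    refine Lp.ext ?_
    have : ∀ i, (fun x => U.snd x i) =ᵐ[vol Ω] fun x => V.snd x i := fun i => by
      refine ae_eq_of_integral_test (memLp_apply (Lp.memLp _) i) (memLp_apply (Lp.memLp _) i)
        fun φ => neg_injective ?_
      rw [← hU φ i, ← hV φ i, h]
    filter_upwards [ae_all_iff.2 this] with x hx
    ext i
    exact hx i
  exact (WithLp.equiv 2 _).injective (Prod.ext h hs)

end Aux

/-- The underlying function `u ∈ L²(Ω)` of `u ∈ H¹₀(Ω)`. -/
def H10.fn {Ω : Opens (EuclideanSpace ℝ (Fin d))} (u : H10 Ω) : L2 Ω := (u : L2Pair Ω).fst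

/-- The gradient `∇u ∈ L²(Ω)^d` of `u ∈ H¹₀(Ω)`. -/
def H10.grad {Ω : Opens (EuclideanSpace ℝ (Fin d))} (u : H10 Ω) : L2Vec Ω := (u : L2Pair Ω).snd

/-- The energy space `ℋ = H¹₀(Ω) × L²(Ω)`, with its Hilbert norm. -/
abbrev EnergySpace : Type := WithLp 2 (H10 Ω × L2 Ω)

variable {Ω}

lemma integrable_partialDeriv_damping (a : Lp ℝ ∞ (vol Ω)) (G : L2Vec Ω) (φ : 𝓓(Ω, ℝ)) (i : Fin d) :
    Integrable (fun x => partialDeriv φ i x • (a x • G x i)) (vol Ω) := by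
  have h : MemLp (fun x => a x • G x i) 2 (vol Ω) :=
    MemLp.smul (p := ∞) (q := 2) (r := 2) (memLp_apply (Lp.memLp G) i) (Lp.memLp a)
  exact integrable_smul (memLp_partialDeriv φ i) h

/-- The field `∇u + a ∇v`. Its divergence is `Δu + div (a ∇v)`. -/
def flux (a : Lp ℝ ∞ (vol Ω)) (u v : H10 Ω) (x : EuclideanSpace ℝ (Fin d)) :
    EuclideanSpace ℂ (Fin d) :=
  H10.grad u x + a x • H10.grad v x

lemma integrable_flux (a : Lp ℝ ∞ (vol Ω)) (u v : H10 Ω) (φ : 𝓓(Ω, ℝ)) :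
    Integrable (fun x => ∑ i, partialDeriv φ i x • flux a u v x i) (vol Ω) := by
  refine integrable_finsetSum _ fun i _ => ?_
  have := (integrable_smul (memLp_partialDeriv φ i) (memLp_apply (Lp.memLp (H10.grad u)) i)).add
    (integrable_partialDeriv_damping a (H10.grad v) φ i)
  refine this.congr (.of_forall fun x => ?_)
  simp [flux]

/-- The graph of the generator `𝒜 (u₀, u₁) = (u₁, Δ u₀ + div (a ∇ u₁))`: the pairs
`((u₀, u₁), (f, g)) ∈ ℋ × ℋ` such that `f = u₁` (in particular `u₁ ∈ H¹₀`) and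
`Δ u₀ + div (a ∇ u₁) = g` in the sense of distributions (so that this distribution is in `L²`). -/
def generatorGraph (a : Lp ℝ ∞ (vol Ω)) : Submodule ℂ (EnergySpace Ω × EnergySpace Ω) where
  carrier := {p | H10.fn p.2.fst = p.1.snd ∧
    HasWeakDivergence Ω (flux a p.1.fst p.2.fst) p.2.snd}
  zero_mem' := by
    refine ⟨rfl, fun φ => ?_⟩
    have h1 : ∫ x, ∑ i, partialDeriv φ i x • flux a (0 : H10 Ω) (0 : H10 Ω) x i ∂(vol Ω) = 0 := by
      refine integral_eq_zero_of_ae ?_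
      filter_upwards [Lp.coeFn_zero (EuclideanSpace ℂ (Fin d)) 2 (vol Ω)] with x hx
      have hx' : H10.grad (0 : H10 Ω) x = 0 := hx
      simp only [flux, hx', smul_zero, add_zero, PiLp.zero_apply, Finset.sum_const_zero,
        Pi.zero_apply]
    have h2 : ∫ x, φ x • (0 : L2 Ω) x ∂(vol Ω) = 0 := by
      refine integral_eq_zero_of_ae ?_
      filter_upwards [Lp.coeFn_zero ℂ 2 (vol Ω)] with x hx
      have hx' : (0 : L2 Ω) x = 0 := hx
      simp only [hx', smul_zero, Pi.zero_apply]
    have h3 := h1.trans (neg_eq_zero.2 h2).symm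
    exact h3
  add_mem' := by
    rintro ⟨U, F⟩ ⟨V, K⟩ ⟨h1, h2⟩ ⟨h3, h4⟩
    refine ⟨congrArg₂ (· + ·) h1 h3, fun φ => ?_⟩
    have e1 : ∫ x, ∑ i, partialDeriv φ i x • flux a (U + V).fst (F + K).fst x i ∂(vol Ω)
        = (∫ x, ∑ i, partialDeriv φ i x • flux a U.fst F.fst x i ∂(vol Ω))
          + ∫ x, ∑ i, partialDeriv φ i x • flux a V.fst K.fst x i ∂(vol Ω) := by
      rw [← integral_add (integrable_flux a _ _ φ) (integrable_flux a _ _ φ)]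
      refine integral_congr_ae ?_
      filter_upwards [Lp.coeFn_add (H10.grad U.fst) (H10.grad V.fst),
          Lp.coeFn_add (H10.grad F.fst) (H10.grad K.fst)]
        with x hx hy
      have hx' : H10.grad (U + V).fst x = H10.grad U.fst x + H10.grad V.fst x := hx
      have hy' : H10.grad (F + K).fst x = H10.grad F.fst x + H10.grad K.fst x := hy
      simp only [flux, hx', hy', PiLp.add_apply, PiLp.smul_apply, ← Finset.sum_add_distrib,
        smul_add]
      exact Finset.sum_congr rfl fun i _ => by abel
    have e2 : ∫ x, φ x • (F + K).snd x ∂(vol Ω)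
        = (∫ x, φ x • F.snd x ∂(vol Ω)) + ∫ x, φ x • K.snd x ∂(vol Ω) := by
      rw [← integral_add (integrable_smul (memLp_testFunction φ) (Lp.memLp _))
        (integrable_smul (memLp_testFunction φ) (Lp.memLp _))]
      refine integral_congr_ae ?_
      filter_upwards [Lp.coeFn_add F.snd K.snd] with x hx
      have hx' : (F + K).snd x = F.snd x + K.snd x := hx
      simp only [hx', smul_add]
    have h2' := h2 φ
    have h4' := h4 φ
    refine e1.trans ?_
    change _ = -∫ x, φ x • (F + K).snd x ∂(vol Ω)
    rw [e2, neg_add]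
    exact congrArg₂ (· + ·) h2' h4'
  smul_mem' := by
    rintro c ⟨U, F⟩ ⟨h1, h2⟩
    refine ⟨congrArg (c • ·) h1, fun φ => ?_⟩
    have e1 : ∫ x, ∑ i, partialDeriv φ i x • flux a (c • U).fst (c • F).fst x i ∂(vol Ω)
        = c * ∫ x, ∑ i, partialDeriv φ i x • flux a U.fst F.fst x i ∂(vol Ω) := by
      rw [← integral_const_mul]
      refine integral_congr_ae ?_
      filter_upwards [Lp.coeFn_smul c (H10.grad U.fst),
          Lp.coeFn_smul c (H10.grad F.fst)] with x hx hy
      have hx' : H10.grad (c • U).fst x = c • H10.grad U.fst x := hx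
      have hy' : H10.grad (c • F).fst x = c • H10.grad F.fst x := hy
      simp only [flux, hx', hy', PiLp.add_apply, PiLp.smul_apply, Finset.mul_sum,
        Complex.real_smul, smul_eq_mul]
      exact Finset.sum_congr rfl fun i _ => by ring
    have e2 : ∫ x, φ x • (c • F).snd x ∂(vol Ω) = c * ∫ x, φ x • F.snd x ∂(vol Ω) := by
      rw [← integral_const_mul]
      refine integral_congr_ae ?_
      filter_upwards [Lp.coeFn_smul c F.snd] with x hx
      simp [hx]
      ring
    have h2' := h2 φ
    refine e1.trans ?_
    change _ = -∫ x, φ x • (c • F).snd x ∂(vol Ω)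
    rw [e2, ← mul_neg]
    exact congrArg (c * ·) h2'

lemma generatorGraph_functional (a : Lp ℝ ∞ (vol Ω)) {U F K : EnergySpace Ω}
    (hF : (U, F) ∈ generatorGraph a) (hK : (U, K) ∈ generatorGraph a) : F = K := by
  obtain ⟨h1, h2⟩ := hF
  obtain ⟨h3, h4⟩ := hK
  have e1 : F.fst = K.fst :=
    Subtype.ext (H1_ext (H10_le_H1 F.fst.2) (H10_le_H1 K.fst.2) (h1.trans h3.symm))
  have e2 : F.snd = K.snd := by
    refine Lp.ext (ae_eq_of_integral_test (Lp.memLp _) (Lp.memLp _) fun φ => neg_injective ?_)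
    have h2' := h2 φ
    have h4' := h4 φ
    simp only [e1] at h2' h4'
    exact h2'.symm.trans h4'
  exact (WithLp.equiv 2 _).injective (Prod.ext e1 e2)

/-- The Kelvin-Voigt generator `𝒜`, an unbounded operator on `ℋ` with domain
`D(𝒜) = {(u₀, u₁) ∈ H¹₀ × L² : u₁ ∈ H¹₀, Δ u₀ + div (a ∇ u₁) ∈ L²}`
(see `mem_generator_domain_iff` and `generator_graph`). -/
def generator (Ω : Opens (EuclideanSpace ℝ (Fin d))) (a : Lp ℝ ∞ (vol Ω)) : EnergySpace Ω →ₗ.[ℂ] EnergySpace Ω :=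
  (generatorGraph a).toLinearPMap

lemma generator_graph (a : Lp ℝ ∞ (vol Ω)) : (generator Ω a).graph = generatorGraph a := by
  refine Submodule.toLinearPMap_graph_eq _ ?_
  rintro ⟨U, F⟩ h rfl
  exact generatorGraph_functional a h (generatorGraph a).zero_mem

lemma mem_generator_domain_iff (a : Lp ℝ ∞ (vol Ω)) (U : EnergySpace Ω) :
    U ∈ (generator Ω a).domain ↔ ∃ w : H10 Ω, H10.fn w = U.snd ∧
      ∃ g : L2 Ω, HasWeakDivergence Ω (flux a U.fst w) g := by
  rw [LinearPMap.mem_domain_iff, generator_graph]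
  constructor
  · rintro ⟨F, h1, h2⟩
    exact ⟨F.fst, h1, F.snd, h2⟩
  · rintro ⟨w, h1, g, h2⟩
    exact ⟨WithLp.toLp 2 (w, g), h1, h2⟩

/-- `R` is the (bounded, everywhere defined) inverse of `A - z : D(A) → V`. -/
structure IsResolvent {V : Type*} [NormedAddCommGroup V] [NormedSpace ℂ V]
    (A : V →ₗ.[ℂ] V) (z : ℂ) (R : V →L[ℂ] V) : Prop where
  mem_domain : ∀ F : V, R F ∈ A.domain
  right_inv : ∀ F : V, A ⟨R F, mem_domain F⟩ - z • R F = F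
  left_inv : ∀ U : A.domain, R (A U - z • (U : V)) = U

end KelvinVoigt

end

noncomputable section

namespace KelvinVoigt

open Set Filter Topology Metric
open scoped ContDiff Convolution InnerProductSpace

/-! Write `J` for the inclusion of `H¹₀` in `L²`, `K = J*J` and `D = ∇* a ∇`. Since `u₁ = f + iλu`,
the resolvent equation reduces to one equation on `H¹₀` with the operator `1 + iλD - (1 + λ²)K`
(`stationaryOp`). Here `D` is self-adjoint, so `1 + iλD` is invertible, and `K` is compact by
Rellich (`isCompactOperator_fnL`). By the Fredholm alternative (`isUnit_one_add_I_smul_sub_smul`)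
injectivity is enough. The resolvent is then explicit in the inverse, hence norm continuous in `λ`
and bounded on `[-M, M]`.

Injectivity (`eq_zero_of_stationaryOp_eq_zero`): for `u` in the kernel and `λ ≠ 0`, the imaginary
part of `⟪u, P u⟫` gives `a|∇u|² = 0`. So `-Δu = λ²u`, and `∇u = 0` on `{a > 0}`, which has positive
measure. Each `∂ᵢu` solves the same equation, so unique continuation from sets of positive measure
(`ae_eq_zero_of_isWeakEigenfunction`) gives `∇u = 0`, and Poincaré gives `u = 0`. For `λ = 0` the
real part gives `∇u = 0` at once.

Unique continuation rests on a mean value formula. If `Δf = -l²f`, then `f(x)e^{ls}` is harmonic in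
`d + 1` variables; averaging it against a smooth radial kernel and integrating out `s` gives
`mvKernel`. The formula (`integral_mvKernel_smul`) makes weak solutions smooth and bounds `k`-th
derivatives by `(Ck/ρ)^k`, so a zero of infinite order forces vanishing on a ball of controlled
radius. Almost every point of a zero set of positive measure is such a zero, because the derivative
of a function vanishes almost everywhere on its zero set.

Rellich and Poincaré both come from the translation estimate `lintegral_translate_sub_sq_le`. Test
functions extend by zero to the whole space, so the boundary of `Ω` plays no role. -/

/-- Differentiation under the integral sign for integrands with compact support. -/
lemma hasDerivAt_integral_of_compact {G V : Type*} [TopologicalSpace G] [T2Space G]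
    [MeasurableSpace G] [OpensMeasurableSpace G] [NormedAddCommGroup V] [NormedSpace ℝ V]
    [SecondCountableTopologyEither G V]
    {μ : Measure G} [IsFiniteMeasureOnCompacts μ] {F F' : ℝ → G → V} {K : Set G} {r₀ δ : ℝ}
    (hδ : 0 < δ) (hK : IsCompact K) (hF : ∀ r, Continuous (F r))
    (hF' : Continuous fun p : ℝ × G => F' p.1 p.2)
    (hd : ∀ r y, HasDerivAt (fun r => F r y) (F' r y) r)
    (hsupp : ∀ r ∈ Metric.ball r₀ δ, ∀ y ∉ K, F r y = 0) :
    HasDerivAt (fun r => ∫ y, F r y ∂μ) (∫ y, F' r₀ y ∂μ) r₀ := by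
  have hsupp' : ∀ r ∈ Metric.ball r₀ δ, ∀ y ∉ K, F' r y = 0 := by
    intro r hr y hy
    refine (hd r y).unique ((hasDerivAt_const r (0 : V)).congr_of_eventuallyEq ?_)
    filter_upwards [Metric.isOpen_ball.mem_nhds hr] with s hs using hsupp s hs y hy
  have hball : Metric.ball r₀ δ ∈ 𝓝 r₀ := Metric.ball_mem_nhds _ hδ
  have hr₀ : r₀ ∈ Metric.ball r₀ δ := Metric.mem_ball_self hδ
  obtain ⟨B, hB⟩ := (((isCompact_closedBall r₀ δ).prod hK).image hF').isBounded.exists_norm_le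
  refine (hasDerivAt_integral_of_dominated_loc_of_deriv_le (bound := K.indicator fun _ => B)
    hball (.of_forall fun r => (hF r).aestronglyMeasurable) ?_
    (hF'.comp (Continuous.prodMk_right r₀)).aestronglyMeasurable ?_ ?_ ?_).2
  · exact (hF r₀).integrable_of_hasCompactSupport
      (HasCompactSupport.intro hK fun y hy => hsupp r₀ hr₀ y hy)
  · refine .of_forall fun y r hr => ?_
    by_cases hy : y ∈ K
    · rw [indicator_of_mem hy]
      exact hB _ ⟨(r, y), ⟨Metric.ball_subset_closedBall hr, hy⟩, rfl⟩
    · rw [hsupp' r hr y hy, indicator_of_notMem hy, norm_zero]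
  · rw [integrable_indicator_iff hK.measurableSet]
    exact integrableOn_const hK.measure_lt_top.ne
  · exact .of_forall fun y r _ => hd r y

/-! ### The kernels of the mean value formula -/

/-- A smooth function, positive on `(-∞, 1)` and zero on `[1, ∞)`. -/
def profile (t : ℝ) : ℝ := Real.smoothTransition (1 - t)

/-- The primitive of `profile` that vanishes on `[1, ∞)`. -/
def profileInt (t : ℝ) : ℝ := -∫ s in t..1, profile s

lemma contDiff_profile : ContDiff ℝ ∞ profile :=
  Real.smoothTransition.contDiff.comp (contDiff_const.sub contDiff_id)

lemma profile_eq_zero {t : ℝ} (ht : 1 ≤ t) : profile t = 0 :=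
  Real.smoothTransition.zero_of_nonpos (by linarith)

lemma hasDerivAt_profileInt (t : ℝ) : HasDerivAt profileInt (profile t) t := by
  have hc : Continuous profile := contDiff_profile.continuous
  have := (intervalIntegral.integral_hasDerivAt_left (hc.intervalIntegrable t 1)
    hc.stronglyMeasurable.stronglyMeasurableAtFilter hc.continuousAt).neg
  rw [neg_neg] at this
  exact this

lemma contDiff_profileInt : ContDiff ℝ ∞ profileInt := by
  refine contDiff_infty_iff_deriv.2 ⟨fun t => (hasDerivAt_profileInt t).differentiableAt, ?_⟩
  rw [show deriv profileInt = profile from funext fun t => (hasDerivAt_profileInt t).deriv]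
  exact contDiff_profile

lemma profileInt_eq_zero {t : ℝ} (ht : 1 ≤ t) : profileInt t = 0 := by
  have : ∫ s in t..1, profile s = ∫ s in t..1, (0 : ℝ) := by
    refine intervalIntegral.integral_congr fun s hs => ?_
    rw [uIcc_of_ge ht] at hs
    exact profile_eq_zero hs.1
  rw [profileInt, this]
  simp

/-- The integral `∫ e^{-κ s} g (t + s²) ds`. -/
def expIntegral (g : ℝ → ℝ) (κ t : ℝ) : ℝ := ∫ s : ℝ, Real.exp (-(κ * s)) * g (t + s ^ 2)

/-- From `|s| > B ≥ 1` one gets `s² ≥ B`, so the argument is at least `1`. This confines the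
integrands of `expIntegral` to a compact set of `s`, uniformly for `t ≥ 1 - B`. -/
lemma comp_add_sq_eq_zero {g : ℝ → ℝ} (hg : ∀ t, 1 ≤ t → g t = 0) {t s B : ℝ}
    (hB : 1 ≤ B) (ht : 1 - B ≤ t) (hs : s ∉ Icc (-B) B) : g (t + s ^ 2) = 0 := by
  refine hg _ ?_
  rw [mem_Icc, ← abs_le, not_le] at hs
  nlinarith [sq_abs s]

lemma expIntegral_eq_zero {g : ℝ → ℝ} (hg : ∀ t, 1 ≤ t → g t = 0) {κ t : ℝ} (ht : 1 ≤ t) :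
    expIntegral g κ t = 0 := by
  refine integral_eq_zero_of_ae (.of_forall fun s => ?_)
  simp [hg (t + s ^ 2) (by nlinarith [sq_nonneg s])]

/-- The integral is the convolution of the constant `1` with a function of `s` depending on
parameters, evaluated at `0`; evaluation at `0 - s` explains the reversed sign in the exponential.
The condition `t > -1` keeps the supports in the fixed compact set `[-2, 2]`. -/
lemma contDiffOn_expIntegral {g : ℝ → ℝ} (hg : ContDiff ℝ ∞ g) (hg0 : ∀ t, 1 ≤ t → g t = 0) :
    ContDiffOn ℝ ∞ (fun p : ℝ × ℝ => expIntegral g p.1 p.2) {p | -1 < p.2} := by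
  have := contDiffOn_convolution_right_with_param_comp (μ := (volume : Measure ℝ)) (n := ⊤)
    (ContinuousLinearMap.mul ℝ ℝ) (s := {p : ℝ × ℝ | -1 < p.2}) (v := fun _ => (0 : ℝ))
    contDiffOn_const (f := fun _ => (1 : ℝ))
    (g := fun p s => Real.exp (p.1 * s) * g (p.2 + s ^ 2)) (k := Icc (-2) 2)
    (isOpen_lt continuous_const continuous_snd) isCompact_Icc ?_
    (locallyIntegrable_const _) ?_
  · refine this.congr fun p _ => ?_
    simp [expIntegral, convolution]
  · intro p s hp hs
    have hp' : -1 < p.2 := hp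
    rw [comp_add_sq_eq_zero hg0 (by norm_num) (by linarith) hs, mul_zero]
  · refine ContDiff.contDiffOn ?_
    change ContDiff ℝ ∞ fun q : (ℝ × ℝ) × ℝ => Real.exp (q.1.1 * q.2) * g (q.1.2 + q.2 ^ 2)
    fun_prop

lemma hasDerivAt_expIntegral_right {g g' : ℝ → ℝ} (hg : ∀ t, HasDerivAt g (g' t) t)
    (hg' : Continuous g') (hg0 : ∀ t, 1 ≤ t → g t = 0) (κ t : ℝ) :
    HasDerivAt (fun t => expIntegral g κ t) (expIntegral g' κ t) t := by
  have hgc : Continuous g := continuous_iff_continuousAt.2 fun t => (hg t).continuousAt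
  refine hasDerivAt_integral_of_compact (K := Icc (-(2 + |t|)) (2 + |t|)) one_pos isCompact_Icc
    (F := fun t s => Real.exp (-(κ * s)) * g (t + s ^ 2))
    (F' := fun t s => Real.exp (-(κ * s)) * g' (t + s ^ 2)) (fun r => by fun_prop) (by fun_prop)
    (fun r s => ?_) (fun r hr s hs => ?_)
  · simpa using ((hg (r + s ^ 2)).comp r ((hasDerivAt_id r).add_const (s ^ 2))).const_mul
      (Real.exp (-(κ * s)))
  · rw [Real.ball_eq_Ioo, mem_Ioo] at hr
    rw [comp_add_sq_eq_zero hg0 (by linarith [abs_nonneg t]) (by linarith [neg_abs_le t]) hs,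
      mul_zero]

/-- Differentiating the exponential produces `-s`, and `s g'(t + s²)` is half the `s`-derivative of
`g(t + s²)`. Integration by parts in `s` then puts the derivative back on the exponential. -/
lemma hasDerivAt_expIntegral_left {g g' : ℝ → ℝ} (hg : ∀ t, HasDerivAt g (g' t) t)
    (hg' : Continuous g') (hg0 : ∀ t, 1 ≤ t → g t = 0) (κ t : ℝ) :
    HasDerivAt (fun κ => expIntegral g' κ t) (-(κ / 2) * expIntegral g κ t) κ := by
  have hgc : Continuous g := continuous_iff_continuousAt.2 fun t => (hg t).continuousAt
  have hg'0 : ∀ t, 1 ≤ t → g' t = 0 := by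
    have h1 : ∀ t, 1 < t → g' t = 0 := fun t ht =>
      (hg t).unique ((hasDerivAt_const t (0 : ℝ)).congr_of_eventuallyEq (by
        filter_upwards [isOpen_Ioi.mem_nhds (show t ∈ Ioi 1 from ht)] with s hs
          using hg0 s (le_of_lt hs)))
    intro t ht
    have hcl : IsClosed {t | g' t = 0} := isClosed_eq hg' continuous_const
    have : t ∈ closure (Ioi (1 : ℝ)) := by rw [closure_Ioi]; exact ht
    exact hcl.closure_subset_iff.2 h1 this
  have hB : (1 : ℝ) ≤ 2 + |t| := by linarith [abs_nonneg t]
  have hB' : 1 - (2 + |t|) ≤ t := by linarith [neg_abs_le t]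
  have key := hasDerivAt_integral_of_compact (μ := volume) (K := Icc (-(2 + |t|)) (2 + |t|))
    (r₀ := κ) one_pos isCompact_Icc
    (F := fun κ s => Real.exp (-(κ * s)) * g' (t + s ^ 2))
    (F' := fun κ s => -s * Real.exp (-(κ * s)) * g' (t + s ^ 2)) (fun r => by fun_prop)
    (by fun_prop) (fun r s => ?_) (fun r _ s hs => ?_)
  · refine key.congr_deriv ?_
    have ibp := integral_mul_deriv_eq_deriv_mul_of_integrable
      (u := fun s : ℝ => Real.exp (-(κ * s))) (u' := fun s => -κ * Real.exp (-(κ * s)))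
      (v := fun s : ℝ => g (t + s ^ 2)) (v' := fun s => g' (t + s ^ 2) * (2 * s)) ?_ ?_ ?_ ?_ ?_
    · have e1 : ∫ s, -s * Real.exp (-(κ * s)) * g' (t + s ^ 2)
          = -(1 / 2) * ∫ s, Real.exp (-(κ * s)) * (g' (t + s ^ 2) * (2 * s)) := by
        rw [← integral_const_mul]
        congr 1
        ext s
        ring
      have e2 : ∫ s, -κ * Real.exp (-(κ * s)) * g (t + s ^ 2) = -κ * expIntegral g κ t := by
        rw [expIntegral, ← integral_const_mul]
        congr 1
        ext s
        ring
      rw [e1, ibp, e2]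
      ring
    · intro s _
      refine ((((hasDerivAt_id s).const_mul κ).neg).exp).congr_deriv ?_
      simp [mul_comm]
    · intro s _
      have h2 : HasDerivAt (fun s : ℝ => t + s ^ 2) (2 * s) s := by
        simpa using (hasDerivAt_pow 2 s).const_add t
      exact (hg _).comp s h2
    all_goals
      refine Continuous.integrable_of_hasCompactSupport (by simp only [Pi.mul_def]; fun_prop)
        (HasCompactSupport.intro (isCompact_Icc (a := -(2 + |t|)) (b := 2 + |t|)) fun s hs => ?_)
      simp [comp_add_sq_eq_zero hg0 hB hB' hs, comp_add_sq_eq_zero hg'0 hB hB' hs]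
  · refine ((((hasDerivAt_id r).mul_const s).neg).exp.mul_const (g' (t + s ^ 2))).congr_deriv ?_
    simp [mul_comm]
  · rw [comp_add_sq_eq_zero hg'0 hB hB' hs, mul_zero]

/-! ### The mean value formula for smooth solutions -/

section Kernel

variable {d : ℕ}

local notation "E" => EuclideanSpace ℝ (Fin d)

/-- The kernel of the mean value formula. -/
def mvKernel (κ : ℝ) (y : E) : ℝ := expIntegral profile κ (‖y‖ ^ 2)

/-- The potential of the kernel of the mean value formula. -/
def mvPotential (κ : ℝ) (y : E) : ℝ := expIntegral profileInt κ (‖y‖ ^ 2) / 2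

lemma contDiff_mvKernel : ContDiff ℝ ∞ fun p : ℝ × E => mvKernel p.1 p.2 := by
  refine (contDiffOn_expIntegral contDiff_profile fun t => profile_eq_zero).comp_contDiff
    (f := fun p : ℝ × E => (p.1, ‖p.2‖ ^ 2)) ?_ fun p => ?_
  · exact contDiff_fst.prodMk (contDiff_snd.norm_sq ℝ)
  · exact lt_of_lt_of_le (by norm_num : (-1 : ℝ) < 0) (sq_nonneg ‖p.2‖)

lemma contDiff_mvPotential : ContDiff ℝ ∞ fun p : ℝ × E => mvPotential p.1 p.2 := by
  refine ContDiff.div_const ((contDiffOn_expIntegral contDiff_profileInt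
    fun t => profileInt_eq_zero).comp_contDiff
    (f := fun p : ℝ × E => (p.1, ‖p.2‖ ^ 2)) ?_ fun p => ?_) 2
  · exact contDiff_fst.prodMk (contDiff_snd.norm_sq ℝ)
  · exact lt_of_lt_of_le (by norm_num : (-1 : ℝ) < 0) (sq_nonneg ‖p.2‖)

lemma contDiff_mvKernel_right (κ : ℝ) : ContDiff ℝ ∞ (mvKernel κ : E → ℝ) :=
  contDiff_mvKernel.comp (contDiff_prodMk_right κ)

lemma contDiff_mvPotential_right (κ : ℝ) : ContDiff ℝ ∞ (mvPotential κ : E → ℝ) :=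
  contDiff_mvPotential.comp (contDiff_prodMk_right κ)

lemma one_le_norm_sq {y : E} (hy : y ∉ Metric.closedBall 0 1) : 1 ≤ ‖y‖ ^ 2 := by
  rw [mem_closedBall_zero_iff, not_le] at hy
  nlinarith

lemma mvKernel_eq_zero {κ : ℝ} {y : E} (hy : y ∉ Metric.closedBall 0 1) : mvKernel κ y = 0 :=
  expIntegral_eq_zero (fun _ => profile_eq_zero) (one_le_norm_sq hy)

lemma mvPotential_eq_zero {κ : ℝ} {y : E} (hy : y ∉ Metric.closedBall 0 1) :
    mvPotential κ y = 0 := by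
  rw [mvPotential, expIntegral_eq_zero (fun _ => profileInt_eq_zero) (one_le_norm_sq hy), zero_div]

lemma hasCompactSupport_mvKernel (κ : ℝ) : HasCompactSupport (mvKernel κ : E → ℝ) :=
  HasCompactSupport.intro (isCompact_closedBall 0 1) fun _ => mvKernel_eq_zero

lemma hasCompactSupport_mvPotential (κ : ℝ) : HasCompactSupport (mvPotential κ : E → ℝ) :=
  HasCompactSupport.intro (isCompact_closedBall 0 1) fun _ => mvPotential_eq_zero

/-- The chain rule contributes `∇‖y‖² = 2y`; the factor `2` is absorbed by the division by `2` in
`mvPotential`. -/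
lemma partialDeriv_mvPotential (κ : ℝ) (i : Fin d) (y : E) :
    partialDeriv (mvPotential κ) i y = y i * mvKernel κ y := by
  have h1 : HasFDerivAt (fun y : E => ‖y‖ ^ 2) (2 • innerSL ℝ y) y :=
    (hasStrictFDerivAt_norm_sq y).hasFDerivAt
  have h2 := (hasDerivAt_expIntegral_right hasDerivAt_profileInt contDiff_profile.continuous
    (fun _ => profileInt_eq_zero) κ (‖y‖ ^ 2)).comp_hasFDerivAt y h1
  have h3 := (h2.const_mul (2⁻¹ : ℝ)).fderiv
  have e : (mvPotential κ : E → ℝ) = fun y => 2⁻¹ * expIntegral profileInt κ (‖y‖ ^ 2) := by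
    ext y
    simp only [mvPotential]
    ring
  rw [partialDeriv, e]
  erw [h3]
  simp [mvKernel, EuclideanSpace.inner_single_right]
  ring

/-- The same potential governs the dependence on `κ` and, by `partialDeriv_mvPotential`, the
dependence on `y`. This is what lets the two contributions to the derivative of a mean combine into
`Δf + l²f`. -/
lemma hasDerivAt_mvKernel (κ : ℝ) (y : E) :
    HasDerivAt (fun κ => mvKernel κ y) (-κ * mvPotential κ y) κ := by
  refine (hasDerivAt_expIntegral_left hasDerivAt_profileInt contDiff_profile.continuous
    (fun _ => profileInt_eq_zero) κ (‖y‖ ^ 2)).congr_deriv ?_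
  simp only [mvPotential]
  ring

/-- The total mass of the kernel of the mean value formula. -/
def mvMass (d : ℕ) : ℝ := ∫ y : EuclideanSpace ℝ (Fin d), mvKernel 0 y

lemma mvMass_pos : 0 < mvMass d := by
  have nn : ∀ t, 0 ≤ profile t := fun t => Real.smoothTransition.nonneg _
  refine (contDiff_mvKernel_right 0).continuous.integral_pos_of_hasCompactSupport_nonneg_nonzero
    (x := 0) (hasCompactSupport_mvKernel 0) (fun y => integral_nonneg fun s => ?_) (ne_of_gt ?_)
  · exact mul_nonneg (Real.exp_pos _).le (nn _)
  · refine Continuous.integral_pos_of_hasCompactSupport_nonneg_nonzero (x := 0) ?_ ?_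
      (fun s => mul_nonneg (Real.exp_pos _).le (nn _)) ?_
    · have := contDiff_profile.continuous
      fun_prop
    · refine HasCompactSupport.intro (isCompact_Icc (a := (-1 : ℝ)) (b := 1)) fun s hs => ?_
      rw [comp_add_sq_eq_zero (fun _ => profile_eq_zero) le_rfl (by simp) hs, mul_zero]
    · have : 0 < profile 0 := Real.smoothTransition.pos_of_pos (by norm_num)
      simpa using this.ne'

lemma contDiff_partialDeriv {V : Type*} [NormedAddCommGroup V] [NormedSpace ℝ V] {f : E → V}
    (hf : ContDiff ℝ ∞ f) (i : Fin d) : ContDiff ℝ ∞ (partialDeriv f i) :=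
  (hf.fderiv_right (by simp)).clm_apply contDiff_const

/-- Integration by parts against a compactly supported function. -/
lemma integral_smul_fderiv_apply {φ : E → ℝ} {f : E → ℂ} (hφ : ContDiff ℝ ∞ φ)
    (hc : HasCompactSupport φ) (hf : ContDiff ℝ ∞ f) (v : E) :
    ∫ x, φ x • fderiv ℝ f x v = -∫ x, fderiv ℝ φ x v • f x := by
  refine integral_smul_fderiv_eq_neg_fderiv_smul_of_integrable (v := v)
    ?_ ?_ ?_ (fun x _ => hφ.differentiable (by simp) x)
    (fun x _ => hf.differentiable (by simp) x)
  · exact (((hφ.continuous_fderiv (by simp)).clm_apply continuous_const).smul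
      hf.continuous).integrable_of_hasCompactSupport (hc.fderiv_apply ℝ _).smul_right
  · exact (hφ.continuous.smul ((hf.continuous_fderiv (by simp)).clm_apply
      continuous_const)).integrable_of_hasCompactSupport hc.smul_right
  · exact (hφ.continuous.smul hf.continuous).integrable_of_hasCompactSupport hc.smul_right

lemma integral_smul_partialDeriv {φ : E → ℝ} {f : E → ℂ} (hφ : ContDiff ℝ ∞ φ)
    (hc : HasCompactSupport φ) (hf : ContDiff ℝ ∞ f) (i : Fin d) :
    ∫ x, φ x • partialDeriv f i x = -∫ x, partialDeriv φ i x • f x :=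
  integral_smul_fderiv_apply hφ hc hf _

lemma fderiv_eq_sum_partialDeriv {V : Type*} [NormedAddCommGroup V] [NormedSpace ℝ V]
    (f : E → V) (x y : E) : fderiv ℝ f x y = ∑ i, y i • partialDeriv f i x := by
  conv_lhs => rw [← (EuclideanSpace.basisFun (Fin d) ℝ).sum_repr y]
  simp [partialDeriv]

/-- The Laplacian. -/
def lap {V : Type*} [NormedAddCommGroup V] [NormedSpace ℝ V] (f : E → V) (x : E) : V :=
  ∑ i, partialDeriv (partialDeriv f i) i x

lemma partialDeriv_comp_sub_smul {V : Type*} [NormedAddCommGroup V] [NormedSpace ℝ V]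
    {f : E → V} (hf : ContDiff ℝ ∞ f) (x : E) (r : ℝ) (i : Fin d) (y : E) :
    partialDeriv (fun y => f (x - r • y)) i y = -r • partialDeriv f i (x - r • y) := by
  have h1 : HasFDerivAt (fun y : E => x - r • y) (-(r • ContinuousLinearMap.id ℝ E)) y :=
    ((hasFDerivAt_id y).const_smul r).const_sub x
  have h2 := ((hf.differentiable (by simp) (x - r • y)).hasFDerivAt.comp y h1).fderiv
  rw [partialDeriv]
  erw [h2]
  simp [partialDeriv]

/-- The derivative in the radius of the mean of `f`, before integration by parts. -/
lemma hasDerivAt_integral_mvKernel_smul {f : E → ℂ} (hf : ContDiff ℝ ∞ f) (l ρ : ℝ) (x : E) :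
    HasDerivAt (fun ρ => ∫ y, mvKernel (l * ρ) y • f (x - ρ • y))
      (∫ y, (mvKernel (l * ρ) y • -(fderiv ℝ f (x - ρ • y) y)
        + (-(l * ρ) * mvPotential (l * ρ) y * l) • f (x - ρ • y))) ρ := by
  have hfc := hf.continuous
  have hfd : Continuous (fderiv ℝ f) := hf.continuous_fderiv (by simp)
  have kc : Continuous fun p : ℝ × E => mvKernel p.1 p.2 := contDiff_mvKernel.continuous
  have pc : Continuous fun p : ℝ × E => mvPotential p.1 p.2 := contDiff_mvPotential.continuous
  refine hasDerivAt_integral_of_compact (μ := (volume : Measure E)) (r₀ := ρ) one_pos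
      (isCompact_closedBall (0 : E) 1)
      (F := fun ρ y => mvKernel (l * ρ) y • f (x - ρ • y))
      (F' := fun ρ y => mvKernel (l * ρ) y • -(fderiv ℝ f (x - ρ • y) y)
        + (-(l * ρ) * mvPotential (l * ρ) y * l) • f (x - ρ • y)) ?_ ?_ ?_ ?_
  · intro ρ
    have := (contDiff_mvKernel_right (d := d) (l * ρ)).continuous
    fun_prop
  · have c1 : Continuous fun p : ℝ × E => mvKernel (l * p.1) p.2 :=
      kc.comp (f := fun p : ℝ × E => (l * p.1, p.2)) (by fun_prop)
    have c2 : Continuous fun p : ℝ × E => mvPotential (l * p.1) p.2 :=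
      pc.comp (f := fun p : ℝ × E => (l * p.1, p.2)) (by fun_prop)
    have c3 : Continuous fun p : ℝ × E => x - p.1 • p.2 := by fun_prop
    exact (c1.smul ((hfd.comp c3).clm_apply continuous_snd).neg).add
      ((((continuous_const.mul continuous_fst).neg.mul c2).mul continuous_const).smul
        (hfc.comp c3))
  · intro ρ y
    have h1 : HasDerivAt (fun ρ : ℝ => x - ρ • y) (-y) ρ :=
      (((hasDerivAt_id ρ).smul_const y).const_sub x).congr_deriv (by simp)
    have h2 := (hf.differentiable (by simp) (x - ρ • y)).hasFDerivAt.comp_hasDerivAt ρ h1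
    have h3 := (hasDerivAt_mvKernel (l * ρ) y).comp ρ ((hasDerivAt_id ρ).const_mul l)
    have h4 := h3.smul h2
    refine h4.congr_deriv ?_
    simp [mul_assoc]
  · intro ρ _ y hy
    rw [mvKernel_eq_zero hy, zero_smul]

lemma contDiff_comp_sub_smul {V : Type*} [NormedAddCommGroup V] [NormedSpace ℝ V] {f : E → V}
    (hf : ContDiff ℝ ∞ f) (x : E) (ρ : ℝ) : ContDiff ℝ ∞ fun y => f (x - ρ • y) :=
  hf.comp (contDiff_const.sub (contDiff_id.const_smul ρ))

lemma integral_partialDeriv_mvPotential_smul {f : E → ℂ} (hf : ContDiff ℝ ∞ f) (κ ρ : ℝ) (x : E)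
    (i : Fin d) :
    ∫ y, partialDeriv (mvPotential κ) i y • f (x - ρ • y)
      = ∫ y, mvPotential κ y • ρ • partialDeriv f i (x - ρ • y) := by
  have := integral_smul_partialDeriv (contDiff_mvPotential_right κ)
    (hasCompactSupport_mvPotential (d := d) κ) (contDiff_comp_sub_smul hf x ρ) i
  rw [← neg_eq_iff_eq_neg] at this
  rw [← this, ← integral_neg]
  refine integral_congr_ae (.of_forall fun y => ?_)
  simp only
  rw [partialDeriv_comp_sub_smul hf, neg_smul, smul_neg, neg_neg]

lemma mvKernel_smul_fderiv (f : E → ℂ) (κ : ℝ) (z y : E) :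
    mvKernel κ y • -(fderiv ℝ f z y)
      = -∑ i, partialDeriv (mvPotential κ) i y • partialDeriv f i z := by
  rw [fderiv_eq_sum_partialDeriv, smul_neg, Finset.smul_sum]
  congr 1
  refine Finset.sum_congr rfl fun i _ => ?_
  rw [partialDeriv_mvPotential, smul_smul, mul_comm]

/-- The vector field `y ↦ mvKernel κ y • y` is the gradient of `mvPotential κ`, so one integration
by parts turns the radial derivative of `f` into its Laplacian, with a factor `ρ` from the rescaled
argument. -/
lemma integral_mvKernel_smul_fderiv {f : E → ℂ} (hf : ContDiff ℝ ∞ f) (κ ρ : ℝ) (x : E) :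
    ∫ y, mvKernel κ y • -(fderiv ℝ f (x - ρ • y) y)
      = ∫ y, mvPotential κ y • -(ρ • lap f (x - ρ • y)) := by
  have hP : ContDiff ℝ ∞ (mvPotential κ : E → ℝ) := contDiff_mvPotential_right _
  have hPc := hasCompactSupport_mvPotential (d := d) κ
  have i1 : ∀ i, Integrable fun y =>
      partialDeriv (mvPotential κ) i y • partialDeriv f i (x - ρ • y) := fun i =>
    ((contDiff_partialDeriv hP i).continuous.smul (contDiff_comp_sub_smul
      (contDiff_partialDeriv hf i) x ρ).continuous).integrable_of_hasCompactSupport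
      (hPc.fderiv_apply ℝ _).smul_right
  have i2 : ∀ i, Integrable fun y =>
      mvPotential κ y • ρ • partialDeriv (partialDeriv f i) i (x - ρ • y) := fun i =>
    Continuous.integrable_of_hasCompactSupport
      (hP.continuous.smul ((contDiff_comp_sub_smul (contDiff_partialDeriv
        (contDiff_partialDeriv hf i) i) x ρ).continuous.const_smul ρ)) hPc.smul_right
  calc ∫ y, mvKernel κ y • -(fderiv ℝ f (x - ρ • y) y)
      = ∫ y, -∑ i, partialDeriv (mvPotential κ) i y • partialDeriv f i (x - ρ • y) :=
        integral_congr_ae (.of_forall fun y => mvKernel_smul_fderiv f κ _ y)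
    _ = -∑ i, ∫ y, partialDeriv (mvPotential κ) i y • partialDeriv f i (x - ρ • y) := by
        rw [integral_neg, integral_finsetSum _ fun i _ => i1 i]
    _ = -∑ i, ∫ y, mvPotential κ y • ρ • partialDeriv (partialDeriv f i) i (x - ρ • y) := by
        congr 1
        exact Finset.sum_congr rfl fun i _ =>
          integral_partialDeriv_mvPotential_smul (contDiff_partialDeriv hf i) κ ρ x i
    _ = ∫ y, -∑ i, mvPotential κ y • ρ • partialDeriv (partialDeriv f i) i (x - ρ • y) := by
        rw [← integral_finsetSum _ fun i _ => i2 i, ← integral_neg]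
    _ = _ := by
        refine integral_congr_ae (.of_forall fun y => ?_)
        simp only [lap, Finset.smul_sum, smul_neg]

/-- The mean value formula for solutions of `Δ f = -l² f`. -/
theorem integral_mvKernel_smul {f : E → ℂ} (hf : ContDiff ℝ ∞ f) {l r : ℝ} {x : E} (hr : 0 ≤ r)
    (hlap : ∀ z ∈ Metric.closedBall x r, lap f z = -(l ^ 2) • f z) :
    ∫ y, mvKernel (l * r) y • f (x - r • y) = mvMass d • f x := by
  have hfc := hf.continuous
  have hderiv : ∀ ρ ∈ Icc 0 r,
      HasDerivAt (fun ρ => ∫ y, mvKernel (l * ρ) y • f (x - ρ • y)) 0 ρ := by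
    intro ρ hρ
    refine (hasDerivAt_integral_mvKernel_smul hf l ρ x).congr_deriv ?_
    have hz : ∀ y ∈ Metric.closedBall (0 : E) 1, x - ρ • y ∈ Metric.closedBall x r := by
      intro y hy
      rw [mem_closedBall_zero_iff] at hy
      rw [mem_closedBall_iff_norm, sub_sub_cancel_left, norm_neg, norm_smul, Real.norm_eq_abs,
        abs_of_nonneg hρ.1]
      nlinarith [hρ.1, hρ.2, norm_nonneg y]
    have hP := (contDiff_mvPotential_right (d := d) (l * ρ)).continuous
    have hPc := hasCompactSupport_mvPotential (d := d) (l * ρ)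
    have hK := (contDiff_mvKernel_right (d := d) (l * ρ)).continuous
    have hfd : Continuous fun y : E => fderiv ℝ f (x - ρ • y) y :=
      ((hf.continuous_fderiv (by simp)).comp (by fun_prop)).clm_apply continuous_id
    have i1 : Integrable fun y : E => mvKernel (l * ρ) y • -(fderiv ℝ f (x - ρ • y) y) :=
      (hK.smul hfd.neg).integrable_of_hasCompactSupport (hasCompactSupport_mvKernel _).smul_right
    have i2 : Integrable fun y : E => (-(l * ρ) * mvPotential (l * ρ) y * l) • f (x - ρ • y) :=
      Continuous.integrable_of_hasCompactSupport (by fun_prop)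
        (hPc.mul_left.mul_right).smul_right
    have i3 : Integrable fun y : E => mvPotential (l * ρ) y • -(ρ • lap f (x - ρ • y)) := by
      have : Continuous (lap f) := continuous_finsetSum _ fun i _ =>
        (contDiff_partialDeriv (contDiff_partialDeriv hf i) i).continuous
      exact Continuous.integrable_of_hasCompactSupport (by fun_prop) hPc.smul_right
    rw [integral_add i1 i2, integral_mvKernel_smul_fderiv hf, ← integral_add i3 i2]
    -- The integrand is `-ρ` times the potential times `Δf + l²f` at `x - ρ • y`. It vanishes by the
    -- equation for `y` in the unit ball, and because the potential is zero elsewhere.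
    refine integral_eq_zero_of_ae (.of_forall fun y => ?_)
    by_cases hy : y ∈ Metric.closedBall (0 : E) 1
    · simp only [Pi.zero_apply, hlap _ (hz y hy), Complex.real_smul]
      push_cast
      ring
    · simp [mvPotential_eq_zero hy]
  -- The mean is constant in the radius, and at radius `0` it is the mass of the kernel times `f x`.
  have := constant_of_has_deriv_right_zero
    (f := fun ρ => ∫ y, mvKernel (l * ρ) y • f (x - ρ • y)) (a := 0) (b := r)
    (fun ρ hρ => (hderiv ρ hρ).continuousAt.continuousWithinAt)
    (fun ρ hρ => (hderiv ρ ⟨hρ.1, hρ.2.le⟩).hasDerivWithinAt) r ⟨hr, le_rfl⟩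
  simp only [mul_zero, zero_smul, sub_zero] at this
  rw [this, integral_smul_const, mvMass]

end Kernel

/-! ### Mean value formula and smoothness for weak solutions -/

section WeakSolutions

variable {d : ℕ}

local notation "E" => EuclideanSpace ℝ (Fin d)

/-- `Δ u = -l² u` in the sense of distributions on `s`. -/
def IsWeakEigenfunction (s : Set E) (l : ℝ) (u : E → ℂ) : Prop :=
  ∀ φ : E → ℝ, ContDiff ℝ ∞ φ → HasCompactSupport φ → tsupport φ ⊆ s →
    ∫ x, (lap φ x + l ^ 2 * φ x) • u x = 0

local notation φ " ⋆ᵣ " u => convolution φ u (ContinuousLinearMap.lsmul ℝ ℝ) volume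

lemma contDiff_conv {η : E → ℝ} {u : E → ℂ} (hη : ContDiff ℝ ∞ η) (hc : HasCompactSupport η)
    (hu : Integrable u) : ContDiff ℝ ∞ (η ⋆ᵣ u) :=
  hc.contDiff_convolution_left (n := ⊤) _ hη hu.locallyIntegrable

lemma partialDeriv_conv {η : E → ℝ} {u : E → ℂ} (hη : ContDiff ℝ ∞ η) (hc : HasCompactSupport η)
    (hu : Integrable u) (i : Fin d) :
    partialDeriv (η ⋆ᵣ u) i = (partialDeriv η i ⋆ᵣ u) := by
  ext x
  have h := hc.hasFDerivAt_convolution_right (ContinuousLinearMap.lsmul ℝ ℝ).flip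
    hu.locallyIntegrable (hη.of_le (by simp)) (μ := (volume : Measure E)) x
  rw [convolution_flip] at h
  rw [partialDeriv, h.fderiv, convolution_precompR_apply _ hu.locallyIntegrable (hc.fderiv ℝ)
    (hη.continuous_fderiv (by simp)), convolution_flip]
  rfl

lemma contDiff_lap {V : Type*} [NormedAddCommGroup V] [NormedSpace ℝ V] {f : E → V}
    (hf : ContDiff ℝ ∞ f) : ContDiff ℝ ∞ (lap f) :=
  ContDiff.sum fun i _ => contDiff_partialDeriv (contDiff_partialDeriv hf i) i

lemma _root_.HasCompactSupport.partialDeriv {V : Type*} [NormedAddCommGroup V] [NormedSpace ℝ V]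
    {f : E → V} (hf : HasCompactSupport f) (i : Fin d) :
    HasCompactSupport (KelvinVoigt.partialDeriv f i) :=
  hf.fderiv_apply ℝ _

lemma tsupport_partialDeriv_subset {V : Type*} [NormedAddCommGroup V] [NormedSpace ℝ V]
    (f : E → V) (i : Fin d) : tsupport (partialDeriv f i) ⊆ tsupport f :=
  tsupport_fderiv_apply_subset ℝ _

lemma tsupport_lap_subset {V : Type*} [NormedAddCommGroup V] [NormedSpace ℝ V] (f : E → V) :
    tsupport (lap f) ⊆ tsupport f := by
  refine closure_minimal (fun x hx => ?_) (isClosed_tsupport f)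
  by_contra h
  refine hx (Finset.sum_eq_zero fun i _ => image_eq_zero_of_notMem_tsupport fun h' => h ?_)
  exact tsupport_partialDeriv_subset f i (tsupport_partialDeriv_subset _ i h')

/-- The weak equation is tested against `t ↦ η (x - t)`, which the hypothesis on `x` makes
admissible on `s`. -/
lemma lap_conv_eq {η : E → ℝ} {u : E → ℂ} (hη : ContDiff ℝ ∞ η) (hc : HasCompactSupport η)
    (hu : Integrable u) {l : ℝ} {s : Set E} (hw : IsWeakEigenfunction s l u) {x : E}
    (hx : ∀ t ∈ tsupport η, x - t ∈ s) :
    lap (η ⋆ᵣ u) x = -(l ^ 2) • (η ⋆ᵣ u) x := by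
  have h1 : ∀ i, partialDeriv (partialDeriv (η ⋆ᵣ u) i) i x
      = ∫ t, partialDeriv (partialDeriv η i) i (x - t) • u t := by
    intro i
    rw [partialDeriv_conv hη hc hu, partialDeriv_conv (contDiff_partialDeriv hη i)
      (hc.partialDeriv i) hu, convolution_lsmul_swap]
  have hint : ∀ ζ : E → ℝ, Continuous ζ → HasCompactSupport ζ →
      Integrable fun t => ζ (x - t) • u t := by
    intro ζ hζ hζc
    have := hζc.convolutionExists_left (ContinuousLinearMap.lsmul ℝ ℝ) hζ hu.locallyIntegrable x
    exact this.integrable_swap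
  have h2 : lap (η ⋆ᵣ u) x = ∫ t, lap η (x - t) • u t := by
    rw [lap]
    simp only [h1, lap, Finset.sum_smul]
    rw [integral_finsetSum]
    exact fun i _ => hint _ (contDiff_partialDeriv (contDiff_partialDeriv hη i) i).continuous
      ((hc.partialDeriv i).partialDeriv i)
  have hφ := contDiff_comp_sub_smul hη x 1
  have h3 := hw (fun t => η (x - (1 : ℝ) • t)) hφ ?_ ?_
  · have e : ∀ t, lap (fun t => η (x - (1 : ℝ) • t)) t = lap η (x - t) := by
      intro t
      rw [lap, lap]
      refine Finset.sum_congr rfl fun i _ => ?_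
      have : partialDeriv (fun t => η (x - (1 : ℝ) • t)) i
          = fun t => -(1 : ℝ) • partialDeriv η i (x - (1 : ℝ) • t) :=
        funext fun y => partialDeriv_comp_sub_smul hη x 1 i y
      rw [this, partialDeriv, fderiv_fun_const_smul]
      · have h4 := partialDeriv_comp_sub_smul (contDiff_partialDeriv hη i) x 1 i t
        rw [partialDeriv] at h4
        rw [_root_.smul_apply, h4]
        simp
      · exact (contDiff_comp_sub_smul (contDiff_partialDeriv hη i) x 1).differentiable (by simp) t
    simp only [e, add_smul] at h3
    simp only [one_smul] at h3
    rw [integral_add] at h3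
    · have h5 : ∫ t, (l ^ 2 * η (x - t)) • u t = (l ^ 2) • (η ⋆ᵣ u) x := by
        rw [convolution_lsmul_swap, ← integral_smul]
        exact integral_congr_ae (.of_forall fun t => mul_smul _ _ _)
      rw [h2, neg_smul, ← h5]
      exact eq_neg_of_add_eq_zero_left h3
    · exact hint _ (contDiff_lap hη).continuous
        (hc.of_isClosed_subset (isClosed_tsupport _) (tsupport_lap_subset η))
    · exact hint _ (continuous_const.mul hη.continuous) hc.mul_left
  · simp only [one_smul]
    exact hc.comp_homeomorph (Homeomorph.subLeft x)
  · simp only [one_smul]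
    intro t ht
    have ht' : t ∈ tsupport (η ∘ Homeomorph.subLeft x) := ht
    rw [tsupport_comp_eq_preimage] at ht'
    simpa using hx _ ht'

/-- The mean of `u` with the kernel of the mean value formula at scale `r`. -/
def mvMean (l r : ℝ) (u : E → ℂ) (x : E) : ℂ := ∫ y, mvKernel (l * r) y • u (x - r • y)

/-- The rescaled kernel of the mean value formula. -/
def mvKernelScaled (l r : ℝ) (y : E) : ℝ := mvKernel (l * r) (r⁻¹ • y)

lemma contDiff_mvKernelScaled (l r : ℝ) : ContDiff ℝ ∞ (mvKernelScaled l r : E → ℝ) :=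
  (contDiff_mvKernel_right _).comp (contDiff_id.const_smul r⁻¹)

lemma hasCompactSupport_mvKernelScaled (l : ℝ) {r : ℝ} (hr : 0 < r) :
    HasCompactSupport (mvKernelScaled l r : E → ℝ) :=
  (hasCompactSupport_mvKernel _).comp_homeomorph (Homeomorph.smulOfNeZero r⁻¹ (inv_pos.2 hr).ne')

/-- The substitution `y ↦ r • y` turns the mean into a convolution, so that means of merely
integrable functions are smooth and commute with mollification. -/
lemma mvMean_eq_conv (l : ℝ) {r : ℝ} (hr : 0 < r) (u : E → ℂ) (x : E) :
    mvMean l r u x = |(r ^ Module.finrank ℝ E)⁻¹| • (mvKernelScaled l r ⋆ᵣ u) x := by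
  rw [convolution_lsmul, ← Measure.integral_comp_smul]
  simp [mvMean, mvKernelScaled, smul_smul, inv_mul_cancel₀ hr.ne']

lemma contDiff_mvMean (l : ℝ) {r : ℝ} (hr : 0 < r) {u : E → ℂ} (hu : Integrable u) :
    ContDiff ℝ ∞ (mvMean l r u) := by
  rw [show mvMean l r u = fun x => |(r ^ Module.finrank ℝ E)⁻¹| • (mvKernelScaled l r ⋆ᵣ u) x from
    funext (mvMean_eq_conv l hr u)]
  exact (contDiff_conv (contDiff_mvKernelScaled l r)
    (hasCompactSupport_mvKernelScaled l hr) hu).const_smul _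

lemma conv_conv {η ζ : E → ℝ} {u : E → ℂ} (hη : Continuous η) (hηc : HasCompactSupport η)
    (hζ : Continuous ζ) (hζc : HasCompactSupport ζ) (hu : Integrable u) (x : E) :
    ((convolution η ζ (ContinuousLinearMap.mul ℝ ℝ) volume) ⋆ᵣ u) x = (η ⋆ᵣ (ζ ⋆ᵣ u)) x := by
  refine convolution_assoc _ _ _ _ (fun a b c => ?_) hη.aestronglyMeasurable
    hζ.aestronglyMeasurable hu.aestronglyMeasurable ?_ ?_ ?_
  · simp [mul_smul]
  · exact .of_forall fun y => hηc.convolutionExists_left _ hη hζ.locallyIntegrable y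
  · exact .of_forall fun y => hζc.norm.convolutionExists_left _ hζ.norm hu.norm.locallyIntegrable y
  · refine hηc.norm.convolutionExists_left _ hη.norm ?_ x
    exact (hζc.norm.continuous_convolution_left _ hζ.norm hu.norm.locallyIntegrable).locallyIntegrable

lemma conv_conv_comm {η ζ : E → ℝ} {u : E → ℂ} (hη : Continuous η) (hηc : HasCompactSupport η)
    (hζ : Continuous ζ) (hζc : HasCompactSupport ζ) (hu : Integrable u) (x : E) :
    (η ⋆ᵣ (ζ ⋆ᵣ u)) x = (ζ ⋆ᵣ (η ⋆ᵣ u)) x := by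
  have hcomm : convolution η ζ (ContinuousLinearMap.mul ℝ ℝ) (volume : Measure E)
      = convolution ζ η (ContinuousLinearMap.mul ℝ ℝ) volume := by
    rw [← convolution_flip,
      show (ContinuousLinearMap.mul ℝ ℝ).flip = ContinuousLinearMap.mul ℝ ℝ by ext; simp]
  rw [← conv_conv hη hηc hζ hζc hu, ← conv_conv hζ hζc hη hηc hu, hcomm]

lemma mvMean_conv (l : ℝ) {r : ℝ} (hr : 0 < r) {η : E → ℝ} {u : E → ℂ} (hη : Continuous η)
    (hηc : HasCompactSupport η) (hu : Integrable u) (x : E) :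
    mvMean l r (η ⋆ᵣ u) x = (η ⋆ᵣ (mvMean l r u)) x := by
  rw [mvMean_eq_conv l hr, conv_conv_comm (contDiff_mvKernelScaled l r).continuous
    (hasCompactSupport_mvKernelScaled l hr) hη hηc hu, convolution_lsmul, convolution_lsmul,
    ← integral_smul]
  refine integral_congr_ae (.of_forall fun t => ?_)
  simp only [mvMean_eq_conv l hr]
  rw [smul_comm]

/-- The mean value formula for weak solutions. -/
lemma ae_mvMean_eq {u : E → ℂ} (hu : Integrable u) {l : ℝ} {s : Set E} (hs : IsOpen s)
    (hw : IsWeakEigenfunction s l u) {r : ℝ} (hr : 0 < r) :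
    ∀ᵐ x, closedBall x r ⊆ s → mvMean l r u x = mvMass d • u x := by
  -- The ratio `2` of outer to inner radius is the bound `K = 2` used for almost everywhere
  -- convergence of the mollifications.
  let φ : ℕ → ContDiffBump (0 : E) := fun n =>
    ⟨1 / (n + 1), 2 / (n + 1), by positivity, by gcongr; norm_num⟩
  have hφ : Tendsto (fun n => (φ n).rOut) atTop (𝓝 0) := by
    have := (tendsto_one_div_add_atTop_nhds_zero_nat (𝕜 := ℝ)).const_mul 2
    simpa [φ, div_eq_mul_inv] using this
  have hae := ContDiffBump.ae_convolution_tendsto_right_of_locallyIntegrable (K := 2) hφ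
    (.of_forall fun n => by simp [φ, div_eq_mul_inv]) hu.locallyIntegrable
  filter_upwards [hae] with x hx hxs
  -- Once the mollifier is supported within distance `δ`, the mollified function is a classical
  -- solution on the whole of `closedBall x r`.
  obtain ⟨δ, hδ, hδs⟩ := (isCompact_closedBall x r).exists_cthickening_subset_open hs hxs
  have hev : ∀ᶠ n in atTop, mvMean l r ((φ n).normed volume ⋆ᵣ u) x
      = mvMass d • ((φ n).normed volume ⋆ᵣ u) x := by
    filter_upwards [hφ.eventually (gt_mem_nhds hδ)] with n hn
    refine integral_mvKernel_smul (contDiff_conv (φ n).contDiff_normed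
      (φ n).hasCompactSupport_normed hu) hr.le fun z hz => ?_
    refine lap_conv_eq (φ n).contDiff_normed (φ n).hasCompactSupport_normed hu hw fun t ht => ?_
    rw [ContDiffBump.tsupport_normed_eq] at ht
    refine hδs (mem_cthickening_of_dist_le _ z _ _ hz ?_)
    rw [dist_eq_norm, sub_sub_cancel_left, norm_neg]
    exact (mem_closedBall_zero_iff.1 ht).trans hn.le
  -- The mean of the mollification is the mollification of the mean, a continuous function, so this
  -- side converges at every point. Only the other side needs the exceptional null set.
  have h1 : Tendsto (fun n => mvMean l r ((φ n).normed volume ⋆ᵣ u) x) atTop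
      (𝓝 (mvMean l r u x)) := by
    simp only [mvMean_conv l hr (φ _).continuous_normed (φ _).hasCompactSupport_normed hu]
    exact ContDiffBump.convolution_tendsto_right_of_continuous hφ
      (contDiff_mvMean l hr hu).continuous x
  exact tendsto_nhds_unique (h1.congr' hev) (hx.const_smul _)

/-- The mean value formula holds for `f` on the ball of centre `x₀` and radius `ρ`, for all radii
less than `ρ`. -/
def HasMeanValue (l : ℝ) (x₀ : E) (ρ : ℝ) (f : E → ℂ) : Prop :=
  ∀ r ∈ Ioo 0 ρ, ∀ x ∈ ball x₀ ρ, mvMean l r f x = mvMass d • f x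

/-- A weak solution is locally almost everywhere equal to a smooth function with the mean value
property. -/
lemma exists_hasMeanValue {u : E → ℂ} (hu : Integrable u) {l : ℝ} {s : Set E} (hs : IsOpen s)
    (hw : IsWeakEigenfunction s l u) {x₀ : E} {ρ : ℝ} (hρ : 0 < ρ)
    (hball : closedBall x₀ (3 * ρ) ⊆ s) :
    ∃ f : E → ℂ, ContDiff ℝ ∞ f ∧ HasMeanValue l x₀ ρ f ∧
      ∀ᵐ x, x ∈ ball x₀ (2 * ρ) → u x = f x := by
  have hm : mvMass d ≠ 0 := mvMass_pos.ne'
  -- The normalised mean at the single radius `ρ` is the smooth representative. It agrees with `u`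
  -- on `ball x₀ (2 * ρ)`, since there `closedBall x ρ` stays inside `closedBall x₀ (3 * ρ)`.
  let f : E → ℂ := fun x => (mvMass d)⁻¹ • mvMean l ρ u x
  have hf : ContDiff ℝ ∞ f := (contDiff_mvMean l hρ hu).const_smul _
  have huf : ∀ᵐ x, x ∈ ball x₀ (2 * ρ) → u x = f x := by
    filter_upwards [ae_mvMean_eq hu hs hw hρ] with x hx hxb
    have := hx ((closedBall_subset_closedBall' (by rw [mem_ball] at hxb; linarith)).trans hball)
    simp only [f, this, smul_smul, inv_mul_cancel₀ hm, one_smul]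
  refine ⟨f, hf, fun r hr => ?_, huf⟩
  -- For `r < ρ` and `x` in `ball x₀ ρ` the mean only sees `ball x₀ (2 * ρ)`, where `f` may be
  -- replaced by `u`. The resulting almost everywhere identity holds everywhere on the ball because
  -- both sides are continuous.
  have hae : mvMean l r f =ᵐ[volume.restrict (ball x₀ ρ)] fun x => mvMass d • f x := by
    refine (ae_restrict_iff' isOpen_ball.measurableSet).2 ?_
    filter_upwards [ae_mvMean_eq hu hs hw hr.1, huf] with x hx hxu hxb
    rw [← hxu (ball_subset_ball (by linarith) hxb), ← hx
      ((closedBall_subset_closedBall' (by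
        rw [mem_ball] at hxb; linarith [hr.2])).trans hball)]
    have hq : Measure.QuasiMeasurePreserving (fun y : E => x - r • y) volume volume :=
      (quasiMeasurePreserving_sub_left_of_right_invariant volume x).comp
        (Measure.quasiMeasurePreserving_smul volume hr.1.ne')
    refine integral_congr_ae ?_
    filter_upwards [hq.ae huf] with y hy
    by_cases hy1 : y ∈ closedBall (0 : E) 1
    · rw [hy]
      rw [mem_closedBall_zero_iff] at hy1
      rw [mem_ball] at hxb ⊢
      calc dist (x - r • y) x₀ ≤ dist (x - r • y) x + dist x x₀ := dist_triangle _ _ _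
        _ < 2 * ρ := by
          rw [dist_eq_norm, sub_sub_cancel_left, norm_neg, norm_smul, Real.norm_eq_abs,
            abs_of_pos hr.1]
          nlinarith [hr.1, hr.2, norm_nonneg y]
    · rw [mvKernel_eq_zero hy1, zero_smul, zero_smul]
  have hcont : Continuous (mvMean l r f) := by
    have hK := (contDiff_mvKernel_right (d := d) (l * r)).continuous
    have := hf.continuous
    convert continuous_parametric_integral_of_continuous (μ := (volume : Measure E))
      (f := fun (x : E) (y : E) => mvKernel (l * r) y • f (x - r • y)) (by fun_prop)
      (isCompact_closedBall (0 : E) 1) using 2 with x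
    refine (setIntegral_eq_integral_of_forall_compl_eq_zero fun y hy => ?_).symm
    rw [mvKernel_eq_zero hy, zero_smul]
  exact Measure.eqOn_open_of_ae_eq hae isOpen_ball hcont.continuousOn
    (hf.continuous.const_smul (mvMass d)).continuousOn

end WeakSolutions

/-! ### Gradient estimate from the mean value property -/

section GradientEstimate

variable {d : ℕ}

local notation "E" => EuclideanSpace ℝ (Fin d)

/-- The derivative of `f` in the direction `h`. -/
def dirDeriv (h : E) (f : E → ℂ) (x : E) : ℂ := fderiv ℝ f x h

lemma contDiff_dirDeriv {f : E → ℂ} (hf : ContDiff ℝ ∞ f) (h : E) :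
    ContDiff ℝ ∞ (dirDeriv h f) :=
  (hf.fderiv_right (by simp)).clm_apply contDiff_const

lemma hasDerivAt_comp_line {f : E → ℂ} (hf : ContDiff ℝ ∞ f) (h y : E) (t : ℝ) :
    HasDerivAt (fun t : ℝ => f (y + t • h)) (dirDeriv h f (y + t • h)) t := by
  have h1 : HasDerivAt (fun t : ℝ => y + t • h) h t :=
    (((hasDerivAt_id t).smul_const h).const_add y).congr_deriv (by simp)
  exact (hf.differentiable (by simp) (y + t • h)).hasFDerivAt.comp_hasDerivAt t h1

/-- Since the kernel does not depend on the centre, the identity can be differentiated along `t ↦ x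
+ t • h` at `t = 0`. -/
lemma HasMeanValue.dirDeriv {l ρ : ℝ} {x₀ : E} {f : E → ℂ} (hm : HasMeanValue l x₀ ρ f)
    (hf : ContDiff ℝ ∞ f) (h : E) : HasMeanValue l x₀ ρ (dirDeriv h f) := by
  intro r hr x hx
  have hfc := hf.continuous
  have hK := (contDiff_mvKernel_right (d := d) (l * r)).continuous
  have hline := hasDerivAt_comp_line hf h
  have hd := (contDiff_dirDeriv hf h).continuous
  have key := hasDerivAt_integral_of_compact (μ := (volume : Measure E)) (r₀ := (0 : ℝ)) one_pos
    (isCompact_closedBall (0 : E) 1)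
    (F := fun t y => mvKernel (l * r) y • f (x - r • y + t • h))
    (F' := fun t y => mvKernel (l * r) y • KelvinVoigt.dirDeriv h f (x - r • y + t • h))
    (fun t => by fun_prop) (by fun_prop) (fun t y => (hline _ t).fun_const_smul _)
    (fun t _ y hy => by rw [mvKernel_eq_zero hy, zero_smul])
  have key2 := (hline x 0).const_smul (mvMass d)
  have hev : (fun t : ℝ => ∫ y, mvKernel (l * r) y • f (x - r • y + t • h)) =ᶠ[𝓝 0]
      (mvMass d • fun t : ℝ => f (x + t • h)) := by
    have hc : Tendsto (fun t : ℝ => x + t • h) (𝓝 0) (𝓝 x) := by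
      have : Continuous fun t : ℝ => x + t • h := by fun_prop
      simpa using this.tendsto 0
    filter_upwards [hc.eventually (isOpen_ball.mem_nhds hx)] with t ht
    rw [Pi.smul_apply, ← hm r hr _ ht]
    refine integral_congr_ae (.of_forall fun y => ?_)
    simp only
    rw [sub_add_eq_add_sub]
  have := (key.congr_of_eventuallyEq hev.symm).unique key2
  simpa [mvMean] using this

/-- The bound is uniform in `r` because `l * r` stays in `[-|l|, |l|]` and the kernel is jointly
smooth, with support in the unit ball. -/
lemma exists_integral_fderiv_mvKernel_le (l : ℝ) : ∃ C : ℝ, 1 ≤ C ∧ ∀ r ∈ Ioo (0 : ℝ) 1, ∀ h : E,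
    ∫ y : E, ‖fderiv ℝ (mvKernel (l * r)) y h‖ ≤ C * ‖h‖ := by
  have hcont : Continuous fun p : ℝ × E => fderiv ℝ (mvKernel p.1) p.2 := by
    refine (ContDiff.fderiv (m := ∞) (n := 0) (f := fun (q : ℝ × E) (y : E) => mvKernel q.1 y)
      (g := fun q => q.2) ?_ contDiff_snd (by simp)).continuous
    exact contDiff_mvKernel.comp (f := fun q : (ℝ × E) × E => (q.1.1, q.2)) (by fun_prop)
  obtain ⟨B, hB⟩ := (((isCompact_Icc (a := -|l|) (b := |l|)).prod
    (isCompact_closedBall (0 : E) 1)).image hcont).isBounded.exists_norm_le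
  have hB0 : 0 ≤ B := (norm_nonneg _).trans
    (hB _ ⟨((0 : ℝ), (0 : E)), ⟨by simp, by simp⟩, rfl⟩)
  refine ⟨max 1 (B * volume.real (closedBall (0 : E) 1)), le_max_left _ _, fun r hr h => ?_⟩
  have hκ : l * r ∈ Icc (-|l|) |l| := by
    rw [mem_Icc, ← abs_le, abs_mul, abs_of_pos hr.1]
    exact mul_le_of_le_one_right (abs_nonneg l) hr.2.le
  have hz : ∀ y ∉ closedBall (0 : E) 1, ‖fderiv ℝ (mvKernel (l * r)) y h‖ = 0 := by
    intro y hy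
    have : fderiv ℝ (mvKernel (l * r)) y = 0 := by
      have he : (mvKernel (l * r) : E → ℝ) =ᶠ[𝓝 y] fun _ => 0 := by
        filter_upwards [isClosed_closedBall.isOpen_compl.mem_nhds hy] with z hz
          using mvKernel_eq_zero hz
      rw [he.fderiv_eq, fderiv_fun_const, Pi.zero_apply]
    simp [this]
  rw [← setIntegral_eq_integral_of_forall_compl_eq_zero hz]
  calc ∫ y in closedBall (0 : E) 1, ‖fderiv ℝ (mvKernel (l * r)) y h‖
      ≤ ∫ y in closedBall (0 : E) 1, B * ‖h‖ := by
        refine setIntegral_mono_on ?_ (integrableOn_const measure_closedBall_lt_top.ne)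
          measurableSet_closedBall fun y hy => ?_
        · exact ((((contDiff_mvKernel_right (d := d) (l * r)).continuous_fderiv
            (by simp)).clm_apply continuous_const).norm.continuousOn.integrableOn_compact
            (isCompact_closedBall 0 1))
        · exact (ContinuousLinearMap.le_opNorm _ _).trans
            (mul_le_mul_of_nonneg_right (hB _ ⟨(l * r, y), ⟨hκ, hy⟩, rfl⟩) (norm_nonneg h))
    _ = B * volume.real (closedBall (0 : E) 1) * ‖h‖ := by
        rw [setIntegral_const, smul_eq_mul]
        ring
    _ ≤ _ := mul_le_mul_of_nonneg_right (le_max_right _ _) (norm_nonneg h)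

/-- The gradient estimate for functions with the mean value property. -/
lemma exists_norm_dirDeriv_le (d : ℕ) (l : ℝ) : ∃ C : ℝ, 1 ≤ C ∧
    ∀ (x₀ : EuclideanSpace ℝ (Fin d)) (ρ : ℝ) (f : EuclideanSpace ℝ (Fin d) → ℂ), ρ ≤ 1 →
      ContDiff ℝ ∞ f → HasMeanValue l x₀ ρ f → ∀ r ∈ Ioo 0 ρ, ∀ x ∈ ball x₀ ρ,
      ∀ h : EuclideanSpace ℝ (Fin d), ‖h‖ ≤ 1 → ∀ M : ℝ, (∀ z ∈ closedBall x r, ‖f z‖ ≤ M) →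
      ‖dirDeriv h f x‖ ≤ C / r * M := by
  obtain ⟨C, hC, hCb⟩ := exists_integral_fderiv_mvKernel_le (d := d) l
  have hm := mvMass_pos (d := d)
  refine ⟨max 1 (C / mvMass d), le_max_left _ _, ?_⟩
  intro x₀ ρ f hρ hf hmv r hr x hx h hh M hM
  have hM0 : 0 ≤ M := (norm_nonneg _).trans (hM x (mem_closedBall_self hr.1.le))
  have h1 := hmv.dirDeriv hf h r hr x hx
  have hK := contDiff_mvKernel_right (d := d) (l * r)
  have h2 := integral_smul_fderiv_apply hK (hasCompactSupport_mvKernel _)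
    (contDiff_comp_sub_smul hf x r) h
  have h3 : ∀ y, fderiv ℝ (fun y => f (x - r • y)) y h = -r • dirDeriv h f (x - r • y) := by
    intro y
    have h1 : HasFDerivAt (fun y : EuclideanSpace ℝ (Fin d) => x - r • y)
        (-(r • ContinuousLinearMap.id ℝ _)) y :=
      ((hasFDerivAt_id y).const_smul r).const_sub x
    have h2 := ((hf.differentiable (by simp) (x - r • y)).hasFDerivAt.comp y h1).fderiv
    erw [h2]
    simp [dirDeriv]
  -- Integration by parts moves the derivative from `f` to the kernel; the factor `r` from the inner
  -- argument becomes the `1 / r` of the estimate.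
  have h4 : r • mvMean l r (dirDeriv h f) x
      = ∫ y, fderiv ℝ (mvKernel (l * r)) y h • f (x - r • y) := by
    rw [← neg_eq_iff_eq_neg.2 h2, mvMean, ← integral_smul, ← integral_neg]
    refine integral_congr_ae (.of_forall fun y => ?_)
    simp only [h3, neg_smul, smul_neg, neg_neg]
    rw [smul_comm]
  have h5 : ‖r • mvMean l r (dirDeriv h f) x‖ ≤ C * M := by
    rw [h4]
    have hint : Integrable fun y => ‖fderiv ℝ (mvKernel (l * r)) y h‖ :=
      Continuous.integrable_of_hasCompactSupport
        ((hK.continuous_fderiv (by simp)).clm_apply continuous_const).norm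
        ((hasCompactSupport_mvKernel _).fderiv_apply ℝ h).norm
    calc _ ≤ ∫ y, ‖fderiv ℝ (mvKernel (l * r)) y h‖ * M := by
          refine norm_integral_le_of_norm_le (hint.mul_const M) (.of_forall fun y => ?_)
          rw [norm_smul]
          by_cases hy : y ∈ closedBall (0 : EuclideanSpace ℝ (Fin d)) 1
          · refine mul_le_mul_of_nonneg_left (hM _ ?_) (norm_nonneg _)
            rw [mem_closedBall_zero_iff] at hy
            rw [mem_closedBall_iff_norm, sub_sub_cancel_left, norm_neg, norm_smul,
              Real.norm_eq_abs, abs_of_pos hr.1]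
            nlinarith [hr.1, norm_nonneg y]
          · have : fderiv ℝ (mvKernel (l * r)) y = 0 := by
              refine image_eq_zero_of_notMem_tsupport fun h' => hy ?_
              refine closure_minimal (fun z hz => ?_) isClosed_closedBall
                (tsupport_fderiv_subset ℝ h')
              by_contra hz'
              exact hz (mvKernel_eq_zero hz')
            simp [this]
      _ = (∫ y, ‖fderiv ℝ (mvKernel (l * r)) y h‖) * M := integral_mul_const _ _
      _ ≤ C * M := by
          refine mul_le_mul_of_nonneg_right ?_ hM0
          refine (hCb r ⟨hr.1, hr.2.trans_le hρ⟩ h).trans ?_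
          exact mul_le_of_le_one_right (by linarith) hh
  rw [h1, norm_smul, norm_smul, Real.norm_eq_abs, Real.norm_eq_abs, abs_of_pos hr.1,
    abs_of_pos hm] at h5
  calc ‖dirDeriv h f x‖ = r * (mvMass d * ‖dirDeriv h f x‖) / (r * mvMass d) := by
        have := hr.1
        field_simp
    _ ≤ C * M / (r * mvMass d) := by
        have := hr.1
        gcongr
    _ = C / mvMass d / r * M := by
        have := hr.1
        field_simp
    _ ≤ _ := by
        have := hr.1
        gcongr
        exact le_max_right _ _

end GradientEstimate

/-! ### Unique continuation from sets of positive measure -/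

section UniqueContinuation

variable {d : ℕ}

local notation "E" => EuclideanSpace ℝ (Fin d)

lemma contDiff_iterate_dirDeriv {f : E → ℂ} (hf : ContDiff ℝ ∞ f) (h : E) (k : ℕ) :
    ContDiff ℝ ∞ ((dirDeriv h)^[k] f) := by
  induction k with
  | zero => exact hf
  | succ k ih =>
    rw [Function.iterate_succ_apply']
    exact contDiff_dirDeriv ih h

lemma HasMeanValue.iterate_dirDeriv {l ρ : ℝ} {x₀ : E} {f : E → ℂ} (hm : HasMeanValue l x₀ ρ f)
    (hf : ContDiff ℝ ∞ f) (h : E) (k : ℕ) :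
    HasMeanValue l x₀ ρ ((KelvinVoigt.dirDeriv h)^[k] f) := by
  induction k with
  | zero => exact hm
  | succ k ih =>
    rw [Function.iterate_succ_apply']
    exact ih.dirDeriv (contDiff_iterate_dirDeriv hf h k) h

/-- Derivatives inherit the mean value property, so the gradient estimate can be iterated. Each
derivative costs a radius `s` and a factor `C / s`, and `dist x x₀ + k * s < ρ` leaves room for `k`
of them. -/
lemma exists_norm_iterate_dirDeriv_le (d : ℕ) (l : ℝ) : ∃ C : ℝ, 1 ≤ C ∧
    ∀ (x₀ : EuclideanSpace ℝ (Fin d)) (ρ : ℝ) (f : EuclideanSpace ℝ (Fin d) → ℂ), ρ ≤ 1 →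
      ContDiff ℝ ∞ f → HasMeanValue l x₀ ρ f → ∀ M : ℝ, (∀ z ∈ ball x₀ ρ, ‖f z‖ ≤ M) →
      ∀ h : EuclideanSpace ℝ (Fin d), ‖h‖ ≤ 1 → ∀ s ∈ Ioo 0 ρ, ∀ (k : ℕ) (x),
      dist x x₀ + k * s < ρ → ‖(dirDeriv h)^[k] f x‖ ≤ (C / s) ^ k * M := by
  obtain ⟨C, hC, hCb⟩ := exists_norm_dirDeriv_le d l
  refine ⟨C, hC, fun x₀ ρ f hρ hf hm M hM h hh s hs k => ?_⟩
  induction k with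
  | zero =>
    intro x hx
    simpa using hM x (by simpa using hx)
  | succ k ih =>
    intro x hx
    push_cast at hx
    rw [Function.iterate_succ_apply', pow_succ', mul_assoc]
    refine hCb x₀ ρ _ hρ (contDiff_iterate_dirDeriv hf h k) (hm.iterate_dirDeriv hf h k) s hs x ?_
      h hh _ fun z hz => ih z ?_
    · rw [mem_ball]
      nlinarith [hs.1, hs.2, (Nat.cast_nonneg k : (0 : ℝ) ≤ k)]
    · have := dist_triangle z x x₀
      rw [mem_closedBall] at hz
      linarith

/-- Taylor's formula when all the Taylor coefficients vanish. -/
lemma norm_le_of_iterated_deriv_eq_zero {V : Type*} [NormedAddCommGroup V] [NormedSpace ℝ V]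
    {T B : ℝ} (n : ℕ) {F : ℕ → ℝ → V} (hF : ∀ j t, HasDerivAt (F j) (F (j + 1) t) t)
    (h0 : ∀ j, F j 0 = 0) (hB : ∀ t ∈ Icc 0 T, ‖F n t‖ ≤ B) :
    ∀ t ∈ Icc 0 T, ‖F 0 t‖ ≤ B * t ^ n / n.factorial := by
  induction n generalizing F with
  | zero =>
    intro t ht
    simpa using hB t ht
  | succ n ih =>
    have h1 := ih (F := fun j => F (j + 1)) (fun j t => hF (j + 1) t) (fun j => h0 (j + 1)) hB
    intro t ht
    refine image_norm_le_of_norm_deriv_right_le_deriv_boundary (f := F 0) (f' := F 1)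
      (a := 0) (b := T) (B := fun t => B * t ^ (n + 1) / (n + 1).factorial)
      (B' := fun t => B * t ^ n / n.factorial)
      (fun s _ => (hF 0 s).continuousAt.continuousWithinAt)
      (fun s _ => (hF 0 s).hasDerivWithinAt) (by simp [h0]) (fun s => ?_)
      (fun s hs => h1 s ⟨hs.1, hs.2.le⟩) ht
    refine (((hasDerivAt_pow (n + 1) s).const_mul B).div_const _).congr_deriv ?_
    rw [Nat.factorial_succ]
    push_cast
    have : (n.factorial : ℝ) ≠ 0 := by positivity
    field_simp

/-- A function with the mean value property that vanishes to infinite order at a point vanishes in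
a neighbourhood of controlled size. -/
lemma exists_eq_zero_of_iterate_dirDeriv_eq_zero (d : ℕ) (l : ℝ) : ∃ c : ℝ, 0 < c ∧
    ∀ (x₀ : EuclideanSpace ℝ (Fin d)) (ρ : ℝ) (f : EuclideanSpace ℝ (Fin d) → ℂ), 0 < ρ → ρ ≤ 1 →
      ContDiff ℝ ∞ f → HasMeanValue l x₀ ρ f → ∀ x ∈ ball x₀ (ρ / 2),
      (∀ h k, (dirDeriv h)^[k] f x = 0) → ∀ z ∈ ball x (c * ρ), f z = 0 := by
  obtain ⟨C, hC, hCb⟩ := exists_norm_iterate_dirDeriv_le d l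
  -- With `t < ρ / (12 * C)` the ratio `q = 4 * C * t / ρ * e` below is less than `e / 3 < 1`.
  refine ⟨1 / (12 * C), by positivity, fun x₀ ρ f hρ hρ1 hf hm x hx hx0 z hz => ?_⟩
  obtain ⟨M, hM⟩ := (((isCompact_closedBall x₀ ρ).image hf.continuous)).isBounded.exists_norm_le
  have hM' : ∀ z ∈ ball x₀ ρ, ‖f z‖ ≤ M := fun z hz =>
    hM _ ⟨z, ball_subset_closedBall hz, rfl⟩
  have hM0 : 0 ≤ M := (norm_nonneg _).trans (hM' x₀ (mem_ball_self hρ))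
  set t := ‖z - x‖ with ht
  rcases eq_or_ne z x with rfl | hzx
  · exact hx0 0 0
  have ht0 : 0 < t := norm_pos_iff.2 (sub_ne_zero.2 hzx)
  have htc : t * (12 * C) < ρ := by
    rw [mem_ball, dist_eq_norm, ← ht, div_mul_eq_mul_div, one_mul, lt_div_iff₀ (by positivity)] at hz
    exact hz
  have htρ : t ≤ ρ / 4 := by nlinarith
  set h := t⁻¹ • (z - x) with hh
  have hh1 : ‖h‖ = 1 := by
    rw [hh, norm_smul, ← ht, norm_inv, Real.norm_eq_abs, abs_of_pos ht0, inv_mul_cancel₀ ht0.ne']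
  have hz' : x + t • h = z := by
    rw [hh, smul_smul, mul_inv_cancel₀ ht0.ne', one_smul, add_sub_cancel]
  set q := 4 * C * t / ρ * Real.exp 1 with hq
  have hq0 : 0 ≤ q := by positivity
  have hq1 : q < 1 := by
    have he := Real.exp_one_lt_d9
    rw [hq, div_mul_eq_mul_div, div_lt_one hρ]
    have : 0 < C * t := by positivity
    nlinarith
  have key : ∀ k : ℕ, ‖f z‖ ≤ M * q ^ (k + 1) := by
    intro k
    have hk : (0 : ℝ) < (k + 1 : ℕ) := by positivity
    -- The `k + 1` derivatives together use up a distance `ρ / 4`. The centre is within `ρ / 2` of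
    -- `x₀` and the segment has length at most `ρ / 4`, so everything stays inside `ball x₀ ρ`.
    set s := ρ / (4 * (k + 1 : ℕ)) with hs
    have hs0 : 0 < s := by positivity
    have hks : (k + 1 : ℕ) * s = ρ / 4 := by
      rw [hs]
      field_simp
    have hsρ : s < ρ := by
      have : (1 : ℝ) ≤ (k + 1 : ℕ) := by simp
      nlinarith
    have h1 := norm_le_of_iterated_deriv_eq_zero (T := t) (B := (C / s) ^ (k + 1) * M) (k + 1)
      (F := fun j t => (dirDeriv h)^[j] f (x + t • h)) (fun j τ => by
        simp only [Function.iterate_succ_apply']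
        exact hasDerivAt_comp_line (contDiff_iterate_dirDeriv hf h j) h x τ)
      (fun j => by simpa using hx0 h j) (fun τ hτ => ?_) t ⟨ht0.le, le_rfl⟩
    · simp only [hz', Function.iterate_zero, id] at h1
      refine h1.trans ?_
      -- The inequality `n ^ n / n! ≤ e ^ n` makes the Taylor remainder geometric.
      have h2 := Real.pow_div_factorial_le_exp (k + 1 : ℕ) hk.le (k + 1)
      have h3 : C / s = 4 * C / ρ * (k + 1 : ℕ) := by
        rw [hs]
        field_simp
      have h4 : Real.exp (k + 1 : ℕ) = Real.exp 1 ^ (k + 1) := by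
        rw [← Real.exp_nat_mul, mul_one]
      calc (C / s) ^ (k + 1) * M * t ^ (k + 1) / (k + 1).factorial
          = M * (4 * C * t / ρ) ^ (k + 1)
            * (((k + 1 : ℕ) : ℝ) ^ (k + 1) / (k + 1).factorial) := by
            rw [h3, mul_pow, show 4 * C * t / ρ = 4 * C / ρ * t by ring, mul_pow (4 * C / ρ) t]
            ring
        _ ≤ M * (4 * C * t / ρ) ^ (k + 1) * Real.exp 1 ^ (k + 1) := by
            rw [← h4]
            gcongr
        _ = M * q ^ (k + 1) := by rw [hq, mul_pow, mul_assoc]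
    · refine hCb x₀ ρ f hρ1 hf hm M hM' h hh1.le s ⟨hs0, hsρ⟩ (k + 1) _ ?_
      rw [hks]
      have h5 : dist (x + τ • h) x ≤ ρ / 4 := by
        rw [dist_eq_norm, add_sub_cancel_left, norm_smul, hh1, mul_one, Real.norm_eq_abs,
          abs_of_nonneg hτ.1]
        exact hτ.2.trans htρ
      have h6 := dist_triangle (x + τ • h) x x₀
      rw [mem_ball] at hx
      linarith
  have hlim : Tendsto (fun k : ℕ => M * q ^ (k + 1)) atTop (𝓝 0) := by
    simpa using ((tendsto_pow_atTop_nhds_zero_of_lt_one hq0 hq1).comp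
      (tendsto_add_atTop_nat 1)).const_mul M
  exact norm_le_zero_iff.1 (ge_of_tendsto' hlim key)

/-- Taylor's formula along rays needs every direction `h`, whereas an almost everywhere argument
allows only countably many conditions; the full derivatives of all orders meet both needs. -/
lemma iterate_dirDeriv_eq_iteratedFDeriv {f : E → ℂ} (hf : ContDiff ℝ ∞ f) (h : E) (k : ℕ)
    (x : E) : (dirDeriv h)^[k] f x = iteratedFDeriv ℝ k f x fun _ => h := by
  induction k generalizing x with
  | zero => simp
  | succ k ih =>
    rw [Function.iterate_succ_apply', show (dirDeriv h)^[k] f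
      = fun x => iteratedFDeriv ℝ k f x fun _ => h from funext ih, iteratedFDeriv_succ_apply_left,
      dirDeriv]
    have hd : DifferentiableAt ℝ (iteratedFDeriv ℝ k f) x :=
      hf.differentiable_iteratedFDeriv (by exact_mod_cast ENat.natCast_lt_top k) x
    rw [fderiv_continuousMultilinear_apply_const_apply hd]
    rfl

/-- The derivative of a function vanishes almost everywhere on its zero set. -/
lemma ae_fderiv_eq_zero {f : E → ℂ} (hf : Differentiable ℝ f) {A : Set E} (hA : MeasurableSet A)
    (h0 : ∀ x ∈ A, f x = 0) : ∀ᵐ x ∂(volume.restrict A), fderiv ℝ f x = 0 := by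
  rcases isEmpty_or_nonempty (Fin d) with hd | ⟨⟨i⟩⟩
  · refine .of_forall fun x => ?_
    ext y
    simp [Subsingleton.elim y 0]
  have key : ∀ L : ℂ →L[ℝ] ℝ, ∀ᵐ x ∂(volume.restrict A), L.comp (fderiv ℝ f x) = 0 := by
    intro L
    -- The estimate for maps approximated by a linear map applies to maps from `E` to itself, so the
    -- real function `L ∘ f` is placed along a nonzero vector. On `A` the result is approximated by
    -- `0` with error `0`, which makes its derivative vanish almost everywhere there.
    let e : E := EuclideanSpace.single i 1
    have he : e ≠ 0 := by simp [e]
    let T : ℂ →L[ℝ] E := L.smulRight e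
    have h1 : ApproximatesLinearOn (fun x => T (f x)) (0 : E →L[ℝ] E) A 0 := by
      intro x hx y hy
      simp [h0 x hx, h0 y hy]
    have h2 := h1.norm_fderiv_sub_le volume hA (fun x => T.comp (fderiv ℝ f x)) fun x _ =>
      (T.hasFDerivAt.comp x (hf x).hasFDerivAt).hasFDerivWithinAt
    filter_upwards [h2] with x hx
    simp only [sub_zero, nonpos_iff_eq_zero, nnnorm_eq_zero] at hx
    ext y
    have := congrArg (fun S : E →L[ℝ] E => S y) hx
    simpa [T, he] using this
  filter_upwards [key Complex.reCLM, key Complex.imCLM] with x h1 h2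
  ext y
  refine Complex.ext ?_ ?_
  · exact congrArg (fun S : E →L[ℝ] ℝ => S y) h1
  · exact congrArg (fun S : E →L[ℝ] ℝ => S y) h2

/-- By induction the `k`-th derivative vanishes on almost all of `A`. Applying `ae_fderiv_eq_zero`
to its finitely many components on that subset gives the next order. -/
lemma ae_iteratedFDeriv_eq_zero {f : E → ℂ} (hf : ContDiff ℝ ∞ f) {A : Set E}
    (hA : MeasurableSet A) (h0 : ∀ x ∈ A, f x = 0) (k : ℕ) :
    ∀ᵐ x ∂(volume.restrict A), iteratedFDeriv ℝ k f x = 0 := by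
  induction k with
  | zero =>
    filter_upwards [ae_restrict_mem hA] with x hx
    ext m
    simpa using h0 x hx
  | succ k ih =>
    have hd : Differentiable ℝ (iteratedFDeriv ℝ k f) :=
      hf.differentiable_iteratedFDeriv (by exact_mod_cast ENat.natCast_lt_top k)
    have hmeas : MeasurableSet {x | iteratedFDeriv ℝ k f x = 0} :=
      (isClosed_singleton.preimage hd.continuous).measurableSet
    let e : Fin d → E := fun i => EuclideanSpace.single i 1
    have key : ∀ v : Fin k → Fin d, ∀ᵐ x ∂(volume.restrict A),
        fderiv ℝ (fun y => iteratedFDeriv ℝ k f y fun j => e (v j)) x = 0 := by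
      intro v
      have hv := ae_fderiv_eq_zero (f := fun y => iteratedFDeriv ℝ k f y fun j => e (v j))
        (fun x => ((ContinuousMultilinearMap.apply ℝ (fun _ : Fin k => E) ℂ
          fun j => e (v j)).differentiableAt.comp x (hd x))) (hA.inter hmeas)
        (fun x hx => by rw [show iteratedFDeriv ℝ k f x = 0 from hx.2]; rfl)
      rw [ae_restrict_iff' (hA.inter hmeas)] at hv
      rw [ae_restrict_iff' hA] at ih ⊢
      filter_upwards [ih, hv] with x h1 h2 hx using h2 ⟨hx, h1 hx⟩
    filter_upwards [ae_all_iff.2 key] with x hx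
    refine ContinuousMultilinearMap.toMultilinearMap_injective ?_
    refine Module.Basis.ext_multilinear
      (fun _ => (EuclideanSpace.basisFun (Fin d) ℝ).toBasis) fun v => ?_
    have h1 := congrArg (fun S : E →L[ℝ] ℂ => S (e (v 0))) (hx fun j => v j.succ)
    simp only [zero_apply] at h1
    rw [fderiv_continuousMultilinear_apply_const_apply (hd x)] at h1
    simpa [e, Fin.tail_def] using (iteratedFDeriv_succ_apply_left _).trans h1

/-- Local form of unique continuation. -/
lemma exists_local_unique_continuation {u : E → ℂ} (hu : Integrable u) {l : ℝ} {s : Set E}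
    (hs : IsOpen s) (hw : IsWeakEigenfunction s l u) {x₀ : E} (hx₀ : x₀ ∈ s) :
    ∃ ρ > 0, ∃ θ > 0, ∃ f : E → ℂ, ball x₀ ρ ⊆ s ∧ ContDiff ℝ ∞ f ∧
      (∀ᵐ x, x ∈ ball x₀ ρ → u x = f x) ∧
      ∀ x ∈ ball x₀ ρ, (∀ k, iteratedFDeriv ℝ k f x = 0) → ∀ z ∈ ball x θ, f z = 0 := by
  obtain ⟨c, hc, hcb⟩ := exists_eq_zero_of_iterate_dirDeriv_eq_zero d l
  obtain ⟨ε, hε, hεs⟩ := nhds_basis_closedBall.mem_iff.1 (hs.mem_nhds hx₀)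
  -- The bound `1` is required by the derivative estimates, and `ε / 3` places the ball of radius `3
  -- * ρ` in `s`.
  set ρ := min 1 (ε / 3) with hρ
  have hρ0 : 0 < ρ := by positivity
  obtain ⟨f, hf, hm, huf⟩ := exists_hasMeanValue hu hs hw hρ0
    ((closedBall_subset_closedBall (by linarith [min_le_right 1 (ε / 3)])).trans hεs)
  refine ⟨ρ / 2, by positivity, c * ρ, by positivity, f, ?_, hf, ?_, fun x hx h0 =>
    hcb x₀ ρ f hρ0 (min_le_left _ _) hf hm x hx fun h k => ?_⟩
  · exact (ball_subset_closedBall.trans (closedBall_subset_closedBall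
      (by linarith [min_le_right 1 (ε / 3)]))).trans hεs
  · filter_upwards [huf] with x hx hxb
    exact hx (ball_subset_ball (by linarith) hxb)
  · rw [iterate_dirDeriv_eq_iteratedFDeriv hf, h0 k]
    rfl

/-- Unique continuation for weak solutions of `Δ u = -l² u` from sets of positive measure. -/
theorem ae_eq_zero_of_isWeakEigenfunction {u : E → ℂ} (hu : Integrable u) {l : ℝ} {s : Set E}
    (hs : IsOpen s) (hsc : IsPreconnected s) (hw : IsWeakEigenfunction s l u) {A : Set E}
    (hAs : A ⊆ s) (hA : volume A ≠ 0) (huA : ∀ᵐ x, x ∈ A → u x = 0) :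
    ∀ᵐ x, x ∈ s → u x = 0 := by
  -- The set of points near which `u` vanishes almost everywhere is open; it remains to see that it
  -- meets `s` and is relatively closed in `s`.
  let Z : Set E := {x | ∃ ε > 0, ∀ᵐ y, y ∈ ball x ε → u y = 0}
  have hZ : IsOpen Z := by
    refine isOpen_iff.2 fun x ⟨ε, hε, hx⟩ => ⟨ε / 2, by positivity, fun y hy =>
      ⟨ε / 2, by positivity, ?_⟩⟩
    filter_upwards [hx] with z hz hzy
    exact hz (ball_subset_ball' (by rw [mem_ball] at hy; linarith) hzy)
  have mem_Z : ∀ {f : E → ℂ} {x₀ w x : E} {ρ θ : ℝ}, (∀ᵐ y, y ∈ ball x₀ ρ → u y = f y) →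
      (∀ y ∈ ball w θ, f y = 0) → x ∈ ball x₀ ρ → x ∈ ball w θ → x ∈ Z := by
    intro f x₀ w x ρ θ huf hf h1 h2
    obtain ⟨ε, hε, hεs⟩ := Metric.mem_nhds_iff.1
      (inter_mem (isOpen_ball.mem_nhds h1) (isOpen_ball.mem_nhds h2))
    refine ⟨ε, hε, ?_⟩
    filter_upwards [huf] with y hy hyε
    rw [hy (hεs hyε).1, hf y (hεs hyε).2]
  have hsub : s ⊆ Z := by
    refine hsc.subset_of_closure_inter_subset hZ ?_ ?_
    -- Around this point of `A` every neighbourhood meets `A` in positive measure, so the smooth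
    -- representative has a zero set of positive measure, hence a zero of infinite order.
    · obtain ⟨x₀, hx₀, hpos⟩ := exists_mem_forall_mem_nhdsWithin_pos_measure hA
      obtain ⟨ρ, hρ, θ, hθ, f, hbs, hf, huf, hv⟩ :=
        exists_local_unique_continuation hu hs hw (hAs hx₀)
      let A' : Set E := ball x₀ ρ ∩ {x | f x = 0}
      have hA'm : MeasurableSet A' := measurableSet_ball.inter
        (isClosed_singleton.preimage hf.continuous).measurableSet
      have hA' : volume A' ≠ 0 := by
        have h1 := hpos (A ∩ ball x₀ ρ) (inter_mem self_mem_nhdsWithin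
          (mem_nhdsWithin_of_mem_nhds (ball_mem_nhds _ hρ)))
        refine (h1.trans_le (measure_mono_ae ?_)).ne'
        filter_upwards [huA, huf] with x h2 h3 hx
        exact ⟨hx.2, (h3 hx.2).symm.trans (h2 hx.1)⟩
      have h2 : ∀ᵐ x ∂(volume.restrict A'), ∀ k, iteratedFDeriv ℝ k f x = 0 :=
        ae_all_iff.2 fun k => ae_iteratedFDeriv_eq_zero hf hA'm (fun x hx => hx.2) k
      have : NeBot (ae (volume.restrict A')) := by
        rw [ae_neBot]
        exact fun h => hA' (Measure.restrict_eq_zero.1 h)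
      obtain ⟨x, hx, hxA⟩ := (h2.and (ae_restrict_mem hA'm)).exists
      exact ⟨x, hbs hxA.1, mem_Z huf (hv x hxA.1 hx) hxA.1 (mem_ball_self hθ)⟩
    · rintro x₀ ⟨hx₀, hx₀s⟩
      obtain ⟨ρ, hρ, θ, hθ, f, hbs, hf, huf, hv⟩ := exists_local_unique_continuation hu hs hw hx₀s
      -- The radius `θ` is the same for all centres in `ball x₀ ρ`. A point `z` of `Z` closer than
      -- `θ` to `x₀` is a zero of infinite order of `f`, so `f` vanishes on a ball about `z` that
      -- contains `x₀`.
      obtain ⟨z, ⟨ε, hε, hz⟩, hzx⟩ := Metric.mem_closure_iff.1 hx₀ (min ρ θ) (lt_min hρ hθ)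
      have hzρ : z ∈ ball x₀ ρ := mem_ball'.2 (hzx.trans_le (min_le_left _ _))
      obtain ⟨δ, hδ, hδs⟩ := Metric.mem_nhds_iff.1
        (inter_mem (isOpen_ball.mem_nhds hzρ) (ball_mem_nhds z hε))
      have hfz : f =ᶠ[𝓝 z] 0 := by
        have hae : f =ᵐ[volume.restrict (ball z δ)] 0 := by
          refine (ae_restrict_iff' measurableSet_ball).2 ?_
          filter_upwards [hz, huf] with y h1 h2 hy
          rw [← h2 (hδs hy).1, h1 (hδs hy).2, Pi.zero_apply]
        filter_upwards [ball_mem_nhds z hδ] with y hy using Measure.eqOn_open_of_ae_eq hae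
          isOpen_ball hf.continuous.continuousOn continuousOn_const hy
      refine mem_Z huf (hv z hzρ fun k => ?_) (mem_ball_self hρ)
        (hzx.trans_le (min_le_right _ _))
      rw [(hfz.iteratedFDeriv ℝ k).eq_of_nhds, show (0 : E → ℂ) = fun _ => 0 from rfl,
        iteratedFDeriv_fun_zero, Pi.zero_apply]
  have hnull : volume {x | x ∈ s ∧ u x ≠ 0} = 0 := by
    refine measure_null_of_locally_null _ fun x hx => ?_
    obtain ⟨ε, hε, hxε⟩ := hsub hx.1
    refine ⟨{x | x ∈ s ∧ u x ≠ 0} ∩ ball x ε, inter_mem self_mem_nhdsWithin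
      (mem_nhdsWithin_of_mem_nhds (ball_mem_nhds _ hε)), ?_⟩
    refine measure_mono_null ?_ hxε
    intro y hy h
    exact hy.1.2 (h hy.2)
  rw [ae_iff]
  refine measure_mono_null (fun x hx => ?_) hnull
  simpa using hx

end UniqueContinuation

/-! ### Translation estimate and Poincaré inequality on cubes -/

/-- Jensen's inequality for the square of the norm. -/
lemma enorm_integral_sq_le {α V : Type*} [MeasurableSpace α] [NormedAddCommGroup V]
    [NormedSpace ℝ V] {μ : Measure α} [IsProbabilityMeasure μ] {f : α → V}
    (hf : AEStronglyMeasurable f μ) : ‖∫ x, f x ∂μ‖ₑ ^ 2 ≤ ∫⁻ x, ‖f x‖ₑ ^ 2 ∂μ := by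
  have h1 : ‖∫ x, f x ∂μ‖ₑ ≤ eLpNorm f 2 μ := by
    refine (enorm_integral_le_lintegral_enorm f).trans ?_
    rw [← eLpNorm_one_eq_lintegral_enorm]
    exact eLpNorm_le_eLpNorm_of_exponent_le (by norm_num) hf
  have h2 := eLpNorm_nnreal_pow_eq_lintegral (p := 2) (f := f) (μ := μ) (by norm_num)
  norm_num at h2
  rw [← h2]
  gcongr

section Sobolev

variable {d : ℕ}

local notation "E" => EuclideanSpace ℝ (Fin d)

lemma enorm_fderiv_apply_sq_le {φ : E → ℂ} (x h : E) :
    ‖fderiv ℝ φ x h‖ₑ ^ 2 ≤ ‖h‖ₑ ^ 2 * ‖gradient φ x‖ₑ ^ 2 := by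
  have key : ‖fderiv ℝ φ x h‖ ≤ ‖h‖ * ‖gradient φ x‖ := by
    rw [fderiv_eq_sum_partialDeriv]
    refine (norm_sum_le _ _).trans ?_
    simp only [norm_smul]
    rw [EuclideanSpace.norm_eq, EuclideanSpace.norm_eq]
    exact Real.sum_mul_le_sqrt_mul_sqrt _ _ _
  rw [← mul_pow]
  gcongr
  rw [← ofReal_norm, ← ofReal_norm, ← ofReal_norm, ← ENNReal.ofReal_mul (norm_nonneg _)]
  exact ENNReal.ofReal_le_ofReal key

/-- The difference quotients of `φ` are controlled by its gradient. -/
lemma lintegral_translate_sub_sq_le {φ : E → ℂ} (hφ : ContDiff ℝ ∞ φ) (h : E) :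
    ∫⁻ x, ‖φ (x + h) - φ x‖ₑ ^ 2 ≤ ‖h‖ₑ ^ 2 * ∫⁻ x, ‖gradient φ x‖ₑ ^ 2 := by
  have hd := (contDiff_dirDeriv hφ h).continuous
  have : IsProbabilityMeasure (volume.restrict (Ioc (0 : ℝ) 1)) := ⟨by simp⟩
  -- The increment is the integral of the directional derivative along the segment, to which Jensen
  -- applies; translation invariance later removes `t • h`.
  have h1 : ∀ x, ‖φ (x + h) - φ x‖ₑ ^ 2
      ≤ ∫⁻ t in Ioc (0 : ℝ) 1, ‖dirDeriv h φ (x + t • h)‖ₑ ^ 2 := by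
    intro x
    have e : ∫ t in (0 : ℝ)..1, dirDeriv h φ (x + t • h) = φ (x + h) - φ x := by
      rw [intervalIntegral.integral_eq_sub_of_hasDerivAt (f := fun t : ℝ => φ (x + t • h))
        (fun t _ => hasDerivAt_comp_line hφ h x t)]
      · simp
      · exact Continuous.intervalIntegrable (by fun_prop) _ _
    rw [← e, intervalIntegral.integral_of_le zero_le_one]
    refine enorm_integral_sq_le (Continuous.aestronglyMeasurable ?_)
    fun_prop
  calc ∫⁻ x, ‖φ (x + h) - φ x‖ₑ ^ 2
      ≤ ∫⁻ x, ∫⁻ t in Ioc (0 : ℝ) 1, ‖dirDeriv h φ (x + t • h)‖ₑ ^ 2 := lintegral_mono h1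
    _ = ∫⁻ t in Ioc (0 : ℝ) 1, ∫⁻ x, ‖dirDeriv h φ (x + t • h)‖ₑ ^ 2 := by
        refine lintegral_lintegral_swap (Continuous.measurable ?_).aemeasurable
        change Continuous fun p : E × ℝ => ‖dirDeriv h φ (p.1 + p.2 • h)‖ₑ ^ 2
        exact ENNReal.continuous_pow 2 |>.comp (continuous_enorm.comp (by fun_prop))
    _ = ∫⁻ x, ‖dirDeriv h φ x‖ₑ ^ 2 := by
        simp only [lintegral_add_right_eq_self (fun x => ‖dirDeriv h φ x‖ₑ ^ 2)]
        simp
    _ ≤ ∫⁻ x, ‖h‖ₑ ^ 2 * ‖gradient φ x‖ₑ ^ 2 :=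
        lintegral_mono fun x => enorm_fderiv_apply_sq_le x h
    _ = _ := lintegral_const_mul' _ _ (by finiteness)

/-- The half open cube of side `δ` with index `k`. -/
def cell (δ : ℝ) (k : Fin d → ℤ) : Set E := {x | ∀ i, x i ∈ Ico (k i * δ) ((k i + 1) * δ)}

lemma cell_eq_preimage (δ : ℝ) (k : Fin d → ℤ) :
    cell δ k = (MeasurableEquiv.toLp 2 (Fin d → ℝ)).symm ⁻¹'
      univ.pi fun i => Ico (k i * δ) ((k i + 1) * δ) := by
  ext x
  simp [cell, Set.mem_pi]

lemma measurableSet_cell (δ : ℝ) (k : Fin d → ℤ) : MeasurableSet (cell δ k) := by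
  rw [cell_eq_preimage]
  exact (MeasurableEquiv.measurable _) (MeasurableSet.univ_pi fun i => measurableSet_Ico)

lemma volume_cell {δ : ℝ} (k : Fin d → ℤ) : volume (cell δ k) = ENNReal.ofReal δ ^ d := by
  rw [cell_eq_preimage, (EuclideanSpace.volume_preserving_symm_measurableEquiv_toLp
    (Fin d)).measure_preimage_equiv, Real.volume_pi_Ico]
  simp [add_mul]

/-- The index of the cube that contains `x`. -/
def cellIndex (δ : ℝ) (x : E) : Fin d → ℤ := fun i => ⌊x i / δ⌋

lemma mem_cell_iff {δ : ℝ} (hδ : 0 < δ) {k : Fin d → ℤ} {x : E} :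
    x ∈ cell δ k ↔ cellIndex δ x = k := by
  simp only [cell, mem_ofPred_eq, mem_Ico, cellIndex, funext_iff, Int.floor_eq_iff,
    le_div_iff₀ hδ, div_lt_iff₀ hδ]

lemma cell_subset_closedBall {δ : ℝ} (hδ : 0 < δ) {k : Fin d → ℤ} {x : E} (hx : x ∈ cell δ k) :
    cell δ k ⊆ closedBall x (δ * √d) := by
  intro y hy
  rw [mem_closedBall_iff_norm, EuclideanSpace.norm_eq]
  have h1 : ∀ i, ‖(y - x) i‖ ^ 2 ≤ δ ^ 2 := by
    intro i
    have h1 := hx i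
    have h2 := hy i
    rw [mem_Ico] at h1 h2
    rw [Real.norm_eq_abs, sq_abs, PiLp.sub_apply]
    refine sq_le_sq' ?_ ?_ <;> linarith
  calc √(∑ i, ‖(y - x) i‖ ^ 2) ≤ √(∑ _i : Fin d, δ ^ 2) :=
        Real.sqrt_le_sqrt (Finset.sum_le_sum fun i _ => h1 i)
    _ = δ * √d := by
        rw [Finset.sum_const, Finset.card_univ, Fintype.card_fin, nsmul_eq_mul, mul_comm,
          Real.sqrt_mul (sq_nonneg δ), Real.sqrt_sq hδ.le]

/-- The mean of `φ` on a cube. -/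
def cellMean (δ : ℝ) (φ : E → ℂ) (k : Fin d → ℤ) : ℂ :=
  ∫ y, φ y ∂(ProbabilityTheory.cond volume (cell δ k))

/-- The constant in the Poincaré inequality on cubes. -/
def cellConst (d : ℕ) : ℝ≥0∞ :=
  volume (closedBall (0 : EuclideanSpace ℝ (Fin d)) √d) * ENNReal.ofReal √d ^ 2

lemma cellConst_ne_top (d : ℕ) : cellConst d ≠ ⊤ :=
  ENNReal.mul_ne_top measure_closedBall_lt_top.ne (by finiteness)

/-- The Poincaré inequality on cubes, summed over all cubes. -/
lemma lintegral_sub_cellMean_sq_le {φ : E → ℂ} (hφ : ContDiff ℝ ∞ φ) (hc : HasCompactSupport φ)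
    {δ : ℝ} (hδ : 0 < δ) :
    ∫⁻ x, ‖φ x - cellMean δ φ (cellIndex δ x)‖ₑ ^ 2
      ≤ cellConst d * ENNReal.ofReal δ ^ 2 * ∫⁻ x, ‖gradient φ x‖ₑ ^ 2 := by
  have hφc := hφ.continuous
  have hδ0 : ENNReal.ofReal δ ^ d ≠ 0 := pow_ne_zero _ (ENNReal.ofReal_pos.2 hδ).ne'
  have hδt : ENNReal.ofReal δ ^ d ≠ ⊤ := by finiteness
  set ρ := δ * √d with hρ
  -- The difference is an average of increments over the cube of `x`; enlarging that cube to a ball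
  -- about `x` makes the set of increments `h` independent of `x`, so the integrals can be
  -- exchanged.
  have h1 : ∀ x, ‖φ x - cellMean δ φ (cellIndex δ x)‖ₑ ^ 2
      ≤ (ENNReal.ofReal δ ^ d)⁻¹ * ∫⁻ h in closedBall (0 : E) ρ, ‖φ (x + h) - φ x‖ₑ ^ 2 := by
    intro x
    set Q : Set E := cell δ (cellIndex δ x) with hQ
    have hxQ : x ∈ Q := (mem_cell_iff hδ).2 rfl
    have hvol : volume Q = ENNReal.ofReal δ ^ d := volume_cell _
    have : IsProbabilityMeasure (ProbabilityTheory.cond volume Q) :=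
      ProbabilityTheory.cond_isProbabilityMeasure_of_finite (by rwa [hvol]) (by rwa [hvol])
    have hint : Integrable φ (ProbabilityTheory.cond volume Q) :=
      hφc.integrable_of_hasCompactSupport hc
    have e : φ x - cellMean δ φ (cellIndex δ x)
        = -∫ y, (φ y - φ x) ∂(ProbabilityTheory.cond volume Q) := by
      rw [integral_sub hint (integrable_const _), integral_const]
      simp [cellMean, hQ]
    rw [e, enorm_neg]
    refine (enorm_integral_sq_le (by fun_prop)).trans ?_
    rw [ProbabilityTheory.cond, lintegral_smul_measure, hvol, smul_eq_mul]
    refine mul_le_mul' le_rfl ?_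
    calc ∫⁻ y in Q, ‖φ y - φ x‖ₑ ^ 2 ≤ ∫⁻ y in closedBall x ρ, ‖φ y - φ x‖ₑ ^ 2 :=
          lintegral_mono_set (cell_subset_closedBall hδ hxQ)
      _ = ∫⁻ y, (closedBall x ρ).indicator (fun y => ‖φ y - φ x‖ₑ ^ 2) y :=
          (lintegral_indicator measurableSet_closedBall _).symm
      _ = ∫⁻ h, (closedBall x ρ).indicator (fun y => ‖φ y - φ x‖ₑ ^ 2) (x + h) :=
          (lintegral_add_left_eq_self _ x).symm
      _ = ∫⁻ h, (closedBall (0 : E) ρ).indicator (fun h => ‖φ (x + h) - φ x‖ₑ ^ 2) h := by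
          congr 1
          ext h
          simp [indicator]
      _ = _ := lintegral_indicator measurableSet_closedBall _
  have hmeas : Measurable (Function.uncurry fun x h : E => ‖φ (x + h) - φ x‖ₑ ^ 2) := by
    refine Continuous.measurable ?_
    change Continuous fun p : E × E => ‖φ (p.1 + p.2) - φ p.1‖ₑ ^ 2
    exact ENNReal.continuous_pow 2 |>.comp (continuous_enorm.comp (by fun_prop))
  calc ∫⁻ x, ‖φ x - cellMean δ φ (cellIndex δ x)‖ₑ ^ 2
      ≤ ∫⁻ x, (ENNReal.ofReal δ ^ d)⁻¹ *
          ∫⁻ h in closedBall (0 : E) ρ, ‖φ (x + h) - φ x‖ₑ ^ 2 := lintegral_mono h1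
    _ = (ENNReal.ofReal δ ^ d)⁻¹ *
          ∫⁻ h in closedBall (0 : E) ρ, ∫⁻ x, ‖φ (x + h) - φ x‖ₑ ^ 2 := by
        rw [lintegral_const_mul' _ _ (ENNReal.inv_ne_top.2 hδ0)]
        congr 1
        exact lintegral_lintegral_swap hmeas.aemeasurable
    _ ≤ (ENNReal.ofReal δ ^ d)⁻¹ * ∫⁻ _h in closedBall (0 : E) ρ,
          ENNReal.ofReal ρ ^ 2 * ∫⁻ x, ‖gradient φ x‖ₑ ^ 2 := by
        gcongr 1
        refine setLIntegral_mono' measurableSet_closedBall fun h hh => ?_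
        refine (lintegral_translate_sub_sq_le hφ h).trans ?_
        gcongr
        rw [← ofReal_norm]
        exact ENNReal.ofReal_le_ofReal (mem_closedBall_zero_iff.1 hh)
    _ = cellConst d * ENNReal.ofReal δ ^ 2 * ∫⁻ x, ‖gradient φ x‖ₑ ^ 2 := by
        -- The volume of the ball of radius `δ√d` scales like `δ ^ d` and cancels the volume of the
        -- cube, leaving only the gain `δ ^ 2`.
        rw [setLIntegral_const, hρ, Measure.addHaar_closedBall_mul _ _ hδ.le (Real.sqrt_nonneg _),
          finrank_euclideanSpace_fin, ENNReal.ofReal_pow hδ.le, ENNReal.ofReal_mul hδ.le, mul_pow,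
          cellConst]
        calc _ = ((ENNReal.ofReal δ ^ d)⁻¹ * ENNReal.ofReal δ ^ d) * (volume (closedBall (0 : E) √d)
              * ENNReal.ofReal √d ^ 2 * ENNReal.ofReal δ ^ 2 * ∫⁻ x, ‖gradient φ x‖ₑ ^ 2) := by ring
          _ = _ := by rw [ENNReal.inv_mul_cancel hδ0 hδt, one_mul]

end Sobolev

/-! ### Poincaré inequality and Rellich theorem on a bounded open set -/

lemma Lp_enorm_sq {α V : Type*} [MeasurableSpace α] {μ : Measure α} [NormedAddCommGroup V]
    (f : Lp V 2 μ) : ‖f‖ₑ ^ 2 = ∫⁻ x, ‖f x‖ₑ ^ 2 ∂μ := by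
  have h2 := eLpNorm_nnreal_pow_eq_lintegral (p := 2) (f := f) (μ := μ) (by norm_num)
  norm_num at h2
  rw [← h2, Lp.enorm_def]

lemma norm_le_mul_of_enorm_sq_le {V W : Type*} [NormedAddCommGroup V] [NormedAddCommGroup W]
    {x : V} {y : W} {C : ℝ} (hC : 0 ≤ C) (h : ‖x‖ₑ ^ 2 ≤ ENNReal.ofReal C ^ 2 * ‖y‖ₑ ^ 2) :
    ‖x‖ ≤ C * ‖y‖ := by
  rw [← ofReal_norm, ← ofReal_norm, ← mul_pow, ← ENNReal.ofReal_mul hC,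
    ← ENNReal.ofReal_pow (norm_nonneg _), ← ENNReal.ofReal_pow (by positivity),
    ENNReal.ofReal_le_ofReal_iff (by positivity)] at h
  exact le_of_sq_le_sq h (by positivity)

section Rellich

variable {d : ℕ} {Ω : Opens (EuclideanSpace ℝ (Fin d))}

local notation "E" => EuclideanSpace ℝ (Fin d)

lemma contDiff_test (φ : 𝓓(Ω, ℂ)) : ContDiff ℝ ∞ φ := φ.contDiff

lemma lintegral_gradient_test {U : L2Pair Ω} {φ : 𝓓(Ω, ℂ)} (h : U.snd =ᵐ[vol Ω] gradient φ) :
    ∫⁻ x, ‖gradient φ x‖ₑ ^ 2 = ‖U.snd‖ₑ ^ 2 := by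
  rw [Lp_enorm_sq]
  have : ∫⁻ x, ‖U.snd x‖ₑ ^ 2 ∂(vol Ω) = ∫⁻ x in Ω, ‖gradient φ x‖ₑ ^ 2 :=
    lintegral_congr_ae (by filter_upwards [h] with x hx; rw [hx])
  rw [this]
  refine (setLIntegral_eq_of_support_subset fun x hx => ?_).symm
  by_contra hxΩ
  refine hx ?_
  have : ∀ i, partialDeriv φ i x = 0 := fun i =>
    image_eq_zero_of_notMem_tsupport fun h' =>
      hxΩ (φ.tsupport_subset (tsupport_partialDeriv_subset _ i h'))
  have hg : gradient φ x = 0 := by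
    ext i
    simp [gradient, this]
  simp [hg]

/-- The Poincaré inequality. -/
theorem exists_poincare (hd : 1 ≤ d) (hΩ : Bornology.IsBounded (Ω : Set E)) :
    ∃ C : ℝ, 0 ≤ C ∧ ∀ u : H10 Ω, ‖H10.fn u‖ ≤ C * ‖H10.grad u‖ := by
  obtain ⟨B, hB0, hB⟩ := hΩ.exists_pos_norm_le
  -- A shift by `3 * B` moves `Ω`, contained in the ball of radius `B`, off itself, so `φ (x + h) =
  -- 0` for `x ∈ Ω`.
  let h : E := EuclideanSpace.single ⟨0, hd⟩ (3 * B)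
  have hh : ‖h‖ = 3 * B := by simp [h, abs_of_pos hB0]
  refine ⟨‖h‖, norm_nonneg _, fun u => ?_⟩
  have hcl : IsClosed {U : L2Pair Ω | ‖U.fst‖ ≤ ‖h‖ * ‖U.snd‖} :=
    isClosed_le (WithLp.prod_continuous_ofLp 2 _ _).fst.norm
      (continuous_const.mul (WithLp.prod_continuous_ofLp 2 _ _).snd.norm)
  refine closure_minimal (s := (testPairs Ω : Set (L2Pair Ω))) ?_ hcl u.2
  rintro U ⟨φ, h1, h2⟩
  refine norm_le_mul_of_enorm_sq_le (norm_nonneg h) ?_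
  rw [← lintegral_gradient_test h2, ofReal_norm, Lp_enorm_sq]
  refine le_trans ?_ (lintegral_translate_sub_sq_le (contDiff_test φ) h)
  refine le_trans ?_ (setLIntegral_le_lintegral (Ω : Set E) _)
  refine lintegral_mono_ae ?_
  filter_upwards [h1, ae_restrict_mem Ω.isOpen.measurableSet] with x hx hxΩ
  have hxh : φ (x + h) = 0 := by
    refine image_eq_zero_of_notMem_tsupport fun h' => ?_
    have h3 := hB _ (φ.tsupport_subset h')
    have h4 := hB _ hxΩ
    have h5 : ‖h‖ ≤ ‖x + h‖ + ‖x‖ := by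
      simpa using norm_sub_le (x + h) x
    linarith
  rw [hx, hxh, zero_sub, enorm_neg]

/-- The inclusion of `H¹₀(Ω)` in `L²(Ω)`. -/
def H10.fnL (Ω : Opens E) : H10 Ω →L[ℂ] L2 Ω :=
  (WithLp.fstL 2 ℂ (L2 Ω) (L2Vec Ω)).comp (H10 Ω).subtypeL

/-- The gradient as an operator from `H¹₀(Ω)` to `L²(Ω)^d`. -/
def H10.gradL (Ω : Opens E) : H10 Ω →L[ℂ] L2Vec Ω :=
  (WithLp.sndL 2 ℂ (L2 Ω) (L2Vec Ω)).comp (H10 Ω).subtypeL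

lemma finite_cellIndex_image {δ : ℝ} (hδ : 0 < δ) {s : Set E} (hs : Bornology.IsBounded s) :
    (cellIndex δ '' s).Finite := by
  obtain ⟨B, hB0, hB⟩ := hs.exists_pos_norm_le
  refine (Set.Finite.pi' (t := fun _ : Fin d => Icc ⌊-B / δ⌋ ⌊B / δ⌋)
    fun _ => finite_Icc _ _).subset ?_
  rintro _ ⟨x, hx, rfl⟩ i
  have h1 : |x i| ≤ B := (PiLp.norm_apply_le x i).trans (hB x hx)
  rw [abs_le] at h1
  exact ⟨Int.floor_le_floor (by gcongr; exact h1.1), Int.floor_le_floor (by gcongr; exact h1.2)⟩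

/-- The span of the indicator functions of the cubes that meet `Ω`. -/
def cellSpan (Ω : Opens E) (δ : ℝ) : Submodule ℂ (L2 Ω) :=
  Submodule.span ℂ {w | ∃ k ∈ cellIndex δ '' (Ω : Set E), w =ᵐ[vol Ω] (cell δ k).indicator 1}

lemma finiteDimensional_cellSpan (hΩ : Bornology.IsBounded (Ω : Set E)) {δ : ℝ} (hδ : 0 < δ) :
    FiniteDimensional ℂ (cellSpan Ω δ) := by
  refine FiniteDimensional.span_of_finite ℂ ?_
  have := (finite_cellIndex_image hδ hΩ).biUnion (t := fun k =>
    {w : L2 Ω | w =ᵐ[vol Ω] (cell δ k).indicator 1}) fun k _ =>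
      Set.Subsingleton.finite fun v hv w hw =>
        Lp.ext (EventuallyEq.trans (show _ =ᵐ[vol Ω] _ from hv) (EventuallyEq.symm hw))
  refine this.subset ?_
  rintro w ⟨k, hk, hw⟩
  exact mem_biUnion hk hw

/-- The approximant is the step function of the cube means, and the error is the Poincaré inequality
on cubes. Boundedness of `Ω` makes the sum finite. -/
lemma exists_mem_cellSpan (hΩ : Bornology.IsBounded (Ω : Set E)) {δ : ℝ} (hδ : 0 < δ)
    {U : L2Pair Ω} (hU : U ∈ testPairs Ω) : ∃ w ∈ cellSpan Ω δ,
      ‖U.fst - w‖ ≤ √(cellConst d).toReal * δ * ‖U.snd‖ := by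
  have hfin : IsFiniteMeasure (vol Ω) := ⟨by simpa using hΩ.measure_lt_top⟩
  obtain ⟨φ, h1, h2⟩ := hU
  set S := (finite_cellIndex_image hδ hΩ).toFinset with hS
  let b : (Fin d → ℤ) → L2 Ω := fun k =>
    indicatorConstLp 2 (measurableSet_cell δ k) (measure_ne_top (vol Ω) _) (1 : ℂ)
  have hb : ∀ k, b k =ᵐ[vol Ω] (cell δ k).indicator 1 := fun k => indicatorConstLp_coeFn
  refine ⟨∑ k ∈ S, cellMean δ φ k • b k, Submodule.sum_mem _ fun k hk => Submodule.smul_mem _ _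
    (Submodule.subset_span ⟨k, (finite_cellIndex_image hδ hΩ).mem_toFinset.1 hk, hb k⟩), ?_⟩
  refine norm_le_mul_of_enorm_sq_le (by positivity) ?_
  have hconst : ENNReal.ofReal (√(cellConst d).toReal * δ) ^ 2
      = cellConst d * ENNReal.ofReal δ ^ 2 := by
    rw [ENNReal.ofReal_mul (Real.sqrt_nonneg _), mul_pow, ← ENNReal.ofReal_pow (Real.sqrt_nonneg _),
      Real.sq_sqrt ENNReal.toReal_nonneg, ENNReal.ofReal_toReal (cellConst_ne_top d)]
  rw [hconst, ← lintegral_gradient_test h2, Lp_enorm_sq]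
  refine le_trans ?_ (lintegral_sub_cellMean_sq_le (contDiff_test φ) φ.hasCompactSupport hδ)
  refine le_trans ?_ (setLIntegral_le_lintegral (Ω : Set E) _)
  refine lintegral_mono_ae ?_
  have hsum : ((∑ k ∈ S, cellMean δ φ k • b k : L2 Ω) : E → ℂ)
      =ᵐ[vol Ω] fun x => ∑ k ∈ S, cellMean δ φ k * (cell δ k).indicator 1 x := by
    have h3 : ∀ᵐ x ∂(vol Ω), ∀ k, (cellMean δ φ k • b k : L2 Ω) x
        = cellMean δ φ k * (cell δ k).indicator 1 x := ae_all_iff.2 fun k => by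
      filter_upwards [Lp.coeFn_smul (cellMean δ φ k) (b k), hb k] with x hx hx'
      rw [hx, Pi.smul_apply, hx', smul_eq_mul]
    filter_upwards [Lp.coeFn_finsetSum S fun k => cellMean δ φ k • b k, h3] with x hx hx'
    rw [hx, Finset.sum_apply]
    exact Finset.sum_congr rfl fun k _ => hx' k
  filter_upwards [h1, hsum, Lp.coeFn_sub U.fst (∑ k ∈ S, cellMean δ φ k • b k),
    ae_restrict_mem Ω.isOpen.measurableSet] with x hx hx' hxs hxΩ
  have hxS : cellIndex δ x ∈ S :=
    (finite_cellIndex_image hδ hΩ).mem_toFinset.2 (mem_image_of_mem _ hxΩ)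
  rw [hxs, Pi.sub_apply, hx, hx', Finset.sum_eq_single_of_mem _ hxS fun k _ hk => ?_,
    indicator_of_mem ((mem_cell_iff hδ).2 rfl), Pi.one_apply, mul_one]
  rw [indicator_of_notMem (fun h => hk ((mem_cell_iff hδ).1 h).symm), mul_zero]

/-- The Rellich theorem: the inclusion of `H¹₀(Ω)` in `L²(Ω)` is compact. -/
theorem isCompactOperator_fnL (hΩ : Bornology.IsBounded (Ω : Set E)) :
    IsCompactOperator (H10.fnL Ω) := by
  let δ : ℕ → ℝ := fun n => 1 / (n + 1)
  have hδ : ∀ n, 0 < δ n := fun n => by positivity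
  have hfd : ∀ n, FiniteDimensional ℂ (cellSpan Ω (δ n)) := fun n =>
    finiteDimensional_cellSpan hΩ (hδ n)
  let P : ℕ → L2 Ω →L[ℂ] L2 Ω := fun n => (cellSpan Ω (δ n)).starProjection
  have hlim : Tendsto (fun n => √(cellConst d).toReal * δ n) atTop (𝓝 0) := by
    simpa [δ] using (tendsto_one_div_add_atTop_nhds_zero_nat (𝕜 := ℝ)).const_mul (√(cellConst d).toReal)
  refine isCompactOperator_of_tendsto (l := atTop)
    (F := fun n => (P n).comp (H10.fnL Ω)) ?_ (.of_forall fun n => ?_)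
  · have key : ∀ n, ‖(P n).comp (H10.fnL Ω) - H10.fnL Ω‖ ≤ √(cellConst d).toReal * δ n := ?_
    · have h0 : Tendsto (fun n => ‖(P n).comp (H10.fnL Ω) - H10.fnL Ω‖) atTop (𝓝 0) :=
        squeeze_zero (fun n => norm_nonneg ((P n).comp (H10.fnL Ω) - H10.fnL Ω)) key hlim
      exact (tendsto_iff_norm_sub_tendsto_zero (f := fun n => (P n).comp (H10.fnL Ω))).2 h0
    intro n
    refine ContinuousLinearMap.opNorm_le_bound _ (by have := hδ n; positivity) fun u => ?_
    have hcl : IsClosed {U : L2Pair Ω | ‖P n U.fst - U.fst‖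
        ≤ √(cellConst d).toReal * δ n * ‖U‖} := by
      have hc : Continuous fun U : L2Pair Ω => U.fst := (WithLp.prod_continuous_ofLp 2 _ _).fst
      exact isClosed_le (((P n).continuous.comp hc).sub hc).norm
        (continuous_const.mul continuous_norm)
    refine closure_minimal (s := (testPairs Ω : Set (L2Pair Ω))) ?_ hcl u.2
    intro U hU
    obtain ⟨w, hw, hUw⟩ := exists_mem_cellSpan hΩ (hδ n) hU
    -- The orthogonal projection is at least as good as the step function of means, and it is a
    -- bounded linear map on all of `L²`. The inclusion is thus a norm limit of finite rank
    -- operators.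
    have h1 : ‖P n U.fst - U.fst‖ ≤ ‖U.fst - w‖ := by
      rw [norm_sub_rev, Submodule.starProjection_minimal]
      exact ciInf_le ⟨0, by rintro _ ⟨_, rfl⟩; exact norm_nonneg _⟩
        (⟨w, hw⟩ : cellSpan Ω (δ n))
    refine h1.trans (hUw.trans ?_)
    have : ‖U.snd‖ ≤ ‖U‖ := by
      rw [WithLp.prod_norm_eq_of_L2]
      exact Real.le_sqrt_of_sq_le (by nlinarith [sq_nonneg ‖U.fst‖])
    have := hδ n
    gcongr
  · have h1 : IsCompactOperator (id : cellSpan Ω (δ n) → cellSpan Ω (δ n)) :=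
      isCompactOperator_id_iff_finiteDimensional.2 (hfd n)
    exact ((h1.comp_clm (cellSpan Ω (δ n)).orthogonalProjectionOnto).clm_comp
      (cellSpan Ω (δ n)).subtypeL).comp_clm (H10.fnL Ω)

end Rellich

/-! ### Operators on `H¹₀` representing the weak equation -/

section Operators

variable {d : ℕ} {Ω : Opens (EuclideanSpace ℝ (Fin d))}

local notation "E" => EuclideanSpace ℝ (Fin d)

instance : CompleteSpace (H10 Ω) := Submodule.topologicalClosure.completeSpace _

/-- Multiplication of vector fields by the damping coefficient. -/
def dampingL (a : Lp ℝ ∞ (vol Ω)) : L2Vec Ω →L[ℂ] L2Vec Ω :=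
  LinearMap.mkContinuous
    { toFun := fun G => (a • G : L2Vec Ω)
      map_add' := fun G H => Lp.add_smul a G H
      map_smul' := fun c G => by
        refine Lp.ext ?_
        filter_upwards [Lp.coeFn_lpSMul (r := 2) a (c • G), Lp.coeFn_lpSMul (r := 2) a G,
          Lp.coeFn_smul c G, Lp.coeFn_smul c (a • G : L2Vec Ω)] with x h1 h2 h3 h4
        rw [h1, RingHom.id_apply, h4, Pi.smul_apply, h2, Pi.smul_apply', Pi.smul_apply', h3,
          Pi.smul_apply, smul_comm] }
    ‖a‖ fun G => Lp.norm_smul_le a G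

lemma coeFn_dampingL (a : Lp ℝ ∞ (vol Ω)) (G : L2Vec Ω) :
    dampingL a G =ᵐ[vol Ω] fun x => a x • G x :=
  Lp.coeFn_lpSMul (r := 2) a G

lemma isSelfAdjoint_dampingL (a : Lp ℝ ∞ (vol Ω)) : IsSelfAdjoint (dampingL a) := by
  rw [ContinuousLinearMap.isSelfAdjoint_iff_isSymmetric]
  intro G H
  change ⟪dampingL a G, H⟫_ℂ = ⟪G, dampingL a H⟫_ℂ
  rw [L2.inner_def, L2.inner_def]
  refine integral_congr_ae ?_
  filter_upwards [coeFn_dampingL a G, coeFn_dampingL a H] with x h1 h2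
  rw [h1, h2, inner_smul_left_eq_smul, inner_smul_right_eq_smul]

open ContinuousLinearMap in
/-- The operator on `H¹₀` representing `v ↦ -div (a ∇ v)`. -/
def dampingOp (a : Lp ℝ ∞ (vol Ω)) : H10 Ω →L[ℂ] H10 Ω :=
  adjoint (H10.gradL Ω) ∘L dampingL a ∘L H10.gradL Ω

/-- The operator on `H¹₀` representing the `L²` inner product. -/
def massOp (Ω : Opens E) : H10 Ω →L[ℂ] H10 Ω :=
  ContinuousLinearMap.adjoint (H10.fnL Ω) ∘L H10.fnL Ω

lemma isSelfAdjoint_dampingOp (a : Lp ℝ ∞ (vol Ω)) : IsSelfAdjoint (dampingOp a) :=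
  (isSelfAdjoint_dampingL a).adjoint_conj _

lemma isCompactOperator_massOp (hΩ : Bornology.IsBounded (Ω : Set E)) :
    IsCompactOperator (massOp Ω) :=
  (isCompactOperator_fnL hΩ).clm_comp (ContinuousLinearMap.adjoint (H10.fnL Ω))

lemma H10_inner_eq (u v : H10 Ω) :
    ⟪u, v⟫_ℂ = ⟪H10.fnL Ω u, H10.fnL Ω v⟫_ℂ + ⟪H10.gradL Ω u, H10.gradL Ω v⟫_ℂ :=
  WithLp.prod_inner_apply _ _

/-- The `H¹` inner product is the sum of the mass and gradient forms, so `-Δ` is represented by the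
identity minus `massOp`. -/
lemma adjoint_gradL_gradL (u : H10 Ω) :
    ContinuousLinearMap.adjoint (H10.gradL Ω) (H10.gradL Ω u) = u - massOp Ω u := by
  refine ext_inner_left ℂ fun v => ?_
  rw [ContinuousLinearMap.adjoint_inner_right, inner_sub_right, massOp,
    ContinuousLinearMap.comp_apply, ContinuousLinearMap.adjoint_inner_right, H10_inner_eq]
  ring

/-- Distributional identities are stated with real test functions, while `H¹₀` is generated by
complex ones. Conjugate linearity in the first argument produces the minus sign at the imaginary
part. -/
lemma inner_test {U : L2Pair Ω} {φ : 𝓓(Ω, ℂ)} {φr φi : 𝓓(Ω, ℝ)} (F : L2Vec Ω) (g : L2 Ω)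
    (hU : U.fst =ᵐ[vol Ω] φ) (hU' : U.snd =ᵐ[vol Ω] gradient φ)
    (hφ : ∀ x, φ x = φr x + φi x * Complex.I) :
    ⟪U.fst, g⟫_ℂ = ∫ x, φr x • g x ∂(vol Ω) - Complex.I * ∫ x, φi x • g x ∂(vol Ω) ∧
    ⟪U.snd, F⟫_ℂ = ∫ x, ∑ i, partialDeriv φr i x • F x i ∂(vol Ω)
      - Complex.I * ∫ x, ∑ i, partialDeriv φi i x • F x i ∂(vol Ω) := by
  have hd (ψ : 𝓓(Ω, ℝ)) : Integrable (fun x => ∑ i, partialDeriv ψ i x • F x i) (vol Ω) :=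
    integrable_finsetSum _ fun i _ =>
      integrable_smul (memLp_partialDeriv ψ i) (memLp_apply (Lp.memLp F) i)
  have hp (x : E) (i : Fin d) :
      partialDeriv φ i x = partialDeriv φr i x + partialDeriv φi i x * Complex.I := by
    have hr : DifferentiableAt ℝ φr x := φr.contDiff.differentiable (by simp) x
    have hi : DifferentiableAt ℝ φi x := φi.contDiff.differentiable (by simp) x
    have h : HasFDerivAt φ (Complex.ofRealCLM ∘L fderiv ℝ φr x
        + (fderiv ℝ φi x).smulRight Complex.I) x := by
      refine ((Complex.ofRealCLM.hasFDerivAt.comp x hr.hasFDerivAt).add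
        (hi.hasFDerivAt.smul_const Complex.I)).congr_of_eventuallyEq (.of_forall fun y => ?_)
      simp [hφ]
    rw [partialDeriv, h.fderiv]
    simp [partialDeriv]
  constructor
  · rw [L2.inner_def, ← integral_const_mul, ← integral_sub
      (integrable_smul (memLp_testFunction φr) (Lp.memLp g))
      ((integrable_smul (memLp_testFunction φi) (Lp.memLp g)).const_mul _)]
    refine integral_congr_ae ?_
    filter_upwards [hU] with x hx
    rw [hx, hφ]
    simp
    ring
  · rw [L2.inner_def, ← integral_const_mul, ← integral_sub (hd φr) ((hd φi).const_mul _)]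
    refine integral_congr_ae ?_
    filter_upwards [hU'] with x hx
    rw [hx, PiLp.inner_apply, Finset.mul_sum, ← Finset.sum_sub_distrib]
    refine Finset.sum_congr rfl fun i _ => ?_
    simp [gradient, hp]
    ring

/-- Both sides of the distributional identity are continuous for the `H¹` norm, so testing with
`C_c^∞` is equivalent to testing with all of `H¹₀`. -/
theorem hasWeakDivergence_iff (F : L2Vec Ω) (g : L2 Ω) :
    HasWeakDivergence Ω F g ↔ ContinuousLinearMap.adjoint (H10.gradL Ω) F
      = -ContinuousLinearMap.adjoint (H10.fnL Ω) g := by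
  constructor
  · intro h
    refine ext_inner_left ℂ fun u => ?_
    rw [ContinuousLinearMap.adjoint_inner_right, inner_neg_right,
      ContinuousLinearMap.adjoint_inner_right]
    change ⟪(u : L2Pair Ω).snd, F⟫_ℂ = -⟪(u : L2Pair Ω).fst, g⟫_ℂ
    have hcl : IsClosed {U : L2Pair Ω | ⟪U.snd, F⟫_ℂ = -⟪U.fst, g⟫_ℂ} := by
      have c := WithLp.prod_continuous_ofLp 2 (L2 Ω) (L2Vec Ω)
      exact isClosed_eq (c.snd.inner continuous_const) (c.fst.inner continuous_const).neg
    refine closure_minimal (s := (testPairs Ω : Set (L2Pair Ω))) ?_ hcl u.2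
    rintro U ⟨φ, h1, h2⟩
    let φr : 𝓓(Ω, ℝ) := ⟨fun x => (φ x).re, Complex.reCLM.contDiff.comp φ.contDiff,
      φ.hasCompactSupport.comp_left (g := Complex.re) rfl,
      (closure_mono fun x hx => by
        contrapose! hx; simp_all).trans φ.tsupport_subset⟩
    let φi : 𝓓(Ω, ℝ) := ⟨fun x => (φ x).im, Complex.imCLM.contDiff.comp φ.contDiff,
      φ.hasCompactSupport.comp_left (g := Complex.im) rfl,
      (closure_mono fun x hx => by
        contrapose! hx; simp_all).trans φ.tsupport_subset⟩
    obtain ⟨e1, e2⟩ := inner_test (φr := φr) (φi := φi) F g h1 h2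
      fun x => (Complex.re_add_im (φ x)).symm
    simp only [Set.mem_ofPred_eq]
    rw [e1, e2, h φr, h φi]
    ring
  · intro h φ
    let ψ : 𝓓(Ω, ℂ) := ⟨fun x => (φ x : ℂ), Complex.ofRealCLM.contDiff.comp φ.contDiff,
      φ.hasCompactSupport.comp_left (g := Complex.ofReal) rfl,
      (closure_mono fun x hx => by
        contrapose! hx; simp_all).trans φ.tsupport_subset⟩
    let u : H10 Ω := ⟨_, (testPairs Ω).le_topologicalClosure (mk_mem_testPairs ψ)⟩
    obtain ⟨e1, e2⟩ := inner_test (U := u.1) (φ := ψ) (φr := φ) (φi := 0) F g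
      (memLp_testFunction ψ).coeFn_toLp (memLp_gradient ψ).coeFn_toLp fun x => by
        change (φ x : ℂ) = φ x + (0 : ℝ) * Complex.I
        simp
    have e0 (x : E) (i : Fin d) : partialDeriv (0 : 𝓓(Ω, ℝ)) i x = 0 := by
      change fderiv ℝ (0 : E → ℝ) x _ = 0
      simp
    have e0' (x : E) : (0 : 𝓓(Ω, ℝ)) x = 0 := rfl
    simp only [e0, e0', zero_smul, Finset.sum_const_zero, integral_zero, mul_zero, sub_zero]
      at e1 e2
    rw [← e1, ← e2]
    have := congrArg (fun v => ⟪u, v⟫_ℂ) h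
    simp only [inner_neg_right, ContinuousLinearMap.adjoint_inner_right] at this
    exact this

end Operators

/-! ### Unique continuation for the gradient -/

section Eigenfunctions

variable {d : ℕ} {Ω : Opens (EuclideanSpace ℝ (Fin d))}

local notation "E" => EuclideanSpace ℝ (Fin d)

lemma partialDeriv_comm {f : E → ℝ} (hf : ContDiff ℝ ∞ f) (i j : Fin d) :
    partialDeriv (partialDeriv f i) j = partialDeriv (partialDeriv f j) i := by
  have h (k m : Fin d) (x : E) : partialDeriv (partialDeriv f k) m x
      = fderiv ℝ (fderiv ℝ f) x (EuclideanSpace.single m 1) (EuclideanSpace.single k 1) := by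
    have hd : DifferentiableAt ℝ (fderiv ℝ f) x :=
      (hf.fderiv_right (m := ∞) (by simp)).differentiable (by simp) x
    have := (hd.hasFDerivAt.clm_apply
      (hasFDerivAt_const (EuclideanSpace.single k (1 : ℝ)) x)).fderiv
    unfold partialDeriv
    rw [this]
    simp
  ext x
  rw [h, h]
  exact (hf.contDiffAt.isSymmSndFDerivAt
    (by simpa using WithTop.coe_le_coe.2 (le_top (a := (2 : ℕ∞))))) _ _

lemma partialDeriv_lap {f : E → ℝ} (hf : ContDiff ℝ ∞ f) (i : Fin d) :
    partialDeriv (lap f) i = lap (partialDeriv f i) := by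
  ext x
  have hd (j : Fin d) : DifferentiableAt ℝ (partialDeriv (partialDeriv f j) j) x :=
    (contDiff_partialDeriv (contDiff_partialDeriv hf j) j).differentiable (by simp) x
  have h : lap f = fun x => ∑ j, partialDeriv (partialDeriv f j) j x := rfl
  rw [partialDeriv, h, fderiv_fun_sum fun j _ => hd j, sum_apply]
  refine Finset.sum_congr rfl fun j _ => ?_
  change partialDeriv (partialDeriv (partialDeriv f j) j) i x = _
  rw [partialDeriv_comm (contDiff_partialDeriv hf j), partialDeriv_comm hf]

/-- The weak gradient of `u` is tested against each `∂ᵢφ`, and the weak divergence of `∇u` against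
`φ`. -/
lemma setIntegral_lap_smul_eq_zero {u : H10 Ω} {l : ℝ}
    (h : HasWeakDivergence Ω (H10.grad u) (-(l ^ 2 : ℂ) • H10.fn u : L2 Ω)) {φ : E → ℝ}
    (hφ : ContDiff ℝ ∞ φ) (hc : HasCompactSupport φ) (hs : tsupport φ ⊆ Ω) :
    ∫ x, (lap φ x + l ^ 2 * φ x) • H10.fn u x ∂(vol Ω) = 0 := by
  let ψ : 𝓓(Ω, ℝ) := ⟨φ, hφ, hc, hs⟩
  let ψ' (i : Fin d) : 𝓓(Ω, ℝ) := ⟨partialDeriv φ i, contDiff_partialDeriv hφ i,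
    hc.partialDeriv i, (tsupport_partialDeriv_subset φ i).trans hs⟩
  have h0 : ∀ i, ∫ x, partialDeriv (partialDeriv φ i) i x • H10.fn u x ∂(vol Ω)
      = -∫ x, partialDeriv φ i x • H10.grad u x i ∂(vol Ω) := fun i => H10_le_H1 u.2 (ψ' i) i
  have h1 : ∫ x, ∑ i, partialDeriv φ i x • H10.grad u x i ∂(vol Ω)
      = -∫ x, φ x • (-(l ^ 2 : ℂ) • H10.fn u : L2 Ω) x ∂(vol Ω) := h ψ
  have h2 : ∫ x, φ x • (-(l ^ 2 : ℂ) • H10.fn u : L2 Ω) x ∂(vol Ω)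
      = -∫ x, (l ^ 2 * φ x) • H10.fn u x ∂(vol Ω) := by
    rw [← integral_neg]
    refine integral_congr_ae ?_
    filter_upwards [Lp.coeFn_smul (-(l ^ 2 : ℂ)) (H10.fn u)] with x hx
    rw [hx]
    simp
    ring
  have i1 (i : Fin d) : Integrable
      (fun x => partialDeriv (partialDeriv φ i) i x • H10.fn u x) (vol Ω) :=
    integrable_smul (memLp_partialDeriv (ψ' i) i) (Lp.memLp _)
  have i2 : Integrable (fun x => (l ^ 2 * φ x) • H10.fn u x) (vol Ω) :=
    integrable_smul ((memLp_testFunction ψ).const_mul _) (Lp.memLp _)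
  have i3 (i : Fin d) : Integrable (fun x => partialDeriv φ i x • H10.grad u x i) (vol Ω) :=
    integrable_smul (memLp_partialDeriv ψ i) (memLp_apply (Lp.memLp _) i)
  rw [integral_finsetSum _ fun i _ => i3 i, h2, neg_neg] at h1
  simp only [add_smul, lap, Finset.sum_smul]
  rw [integral_add (integrable_finsetSum _ fun i _ => i1 i) i2,
    integral_finsetSum _ fun i _ => i1 i, ← h1, ← Finset.sum_add_distrib]
  exact Finset.sum_eq_zero fun i _ => by rw [h0, neg_add_cancel]

/-- Testing the weak gradient of `u` with `Δφ + l²φ` and commuting `∂ᵢ` past the operator leaves the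
equation of `u` tested with `∂ᵢφ`. The passage to `∂ᵢu` is needed because the damping forces only
`∇u`, not `u`, to vanish on `{a > 0}`. -/
lemma isWeakEigenfunction_grad {u : H10 Ω} {l : ℝ}
    (h : HasWeakDivergence Ω (H10.grad u) (-(l ^ 2 : ℂ) • H10.fn u : L2 Ω)) (i : Fin d) :
    IsWeakEigenfunction (Ω : Set E) l ((Ω : Set E).indicator fun x => H10.grad u x i) := by
  intro φ hφ hc hs
  let θ : 𝓓(Ω, ℝ) := ⟨fun x => lap φ x + l ^ 2 * φ x,
    (contDiff_lap hφ).add (contDiff_const.mul hφ),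
    HasCompactSupport.add (hc.mono' (subset_tsupport _ |>.trans (tsupport_lap_subset φ)))
      hc.mul_left,
    (closure_minimal (fun x hx => by
      by_contra h'
      exact hx (by simp [image_eq_zero_of_notMem_tsupport h',
        image_eq_zero_of_notMem_tsupport fun h'' => h' (tsupport_lap_subset φ h'')]))
      (isClosed_tsupport φ)).trans hs⟩
  have h1 := H10_le_H1 u.2 θ i
  have h2 (x : E) : partialDeriv θ i x
      = lap (partialDeriv φ i) x + l ^ 2 * partialDeriv φ i x := by
    have hd1 : DifferentiableAt ℝ (lap φ) x := (contDiff_lap hφ).differentiable (by simp) x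
    have hd2 : DifferentiableAt ℝ φ x := hφ.differentiable (by simp) x
    rw [← partialDeriv_lap hφ]
    change fderiv ℝ (fun x => lap φ x + l ^ 2 * φ x) x _ = _
    rw [fderiv_fun_add hd1 (hd2.const_mul _), fderiv_const_mul hd2]
    simp [partialDeriv]
  simp only [h2] at h1
  have h3 := setIntegral_lap_smul_eq_zero h (contDiff_partialDeriv hφ i) (hc.partialDeriv i)
    ((tsupport_partialDeriv_subset φ i).trans hs)
  have h4 := neg_eq_zero.1 (h1.symm.trans h3)
  rw [← h4, ← integral_indicator Ω.isOpen.measurableSet]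
  refine integral_congr_ae (.of_forall fun x => ?_)
  by_cases hx : x ∈ (Ω : Set E)
  · simp only [indicator_of_mem hx]
    rfl
  · simp [indicator_of_notMem hx]

theorem grad_eq_zero_of_ae_eq_zero (hΩ : Bornology.IsBounded (Ω : Set E))
    (hc : IsPreconnected (Ω : Set E)) {u : H10 Ω} {l : ℝ}
    (h : HasWeakDivergence Ω (H10.grad u) (-(l ^ 2 : ℂ) • H10.fn u : L2 Ω)) {A : Set E}
    (hAΩ : A ⊆ Ω) (hA : volume A ≠ 0) (huA : ∀ᵐ x ∂(vol Ω), x ∈ A → H10.grad u x = 0) :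
    H10.grad u = 0 := by
  have hfin : IsFiniteMeasure (vol Ω) := ⟨by
    rw [Measure.restrict_apply_univ]
    exact hΩ.measure_lt_top⟩
  have hi (i : Fin d) : ∀ᵐ x, x ∈ (Ω : Set E) → H10.grad u x i = 0 := by
    have hint : Integrable ((Ω : Set E).indicator fun x => H10.grad u x i) :=
      (integrable_indicator_iff Ω.isOpen.measurableSet).2
        ((memLp_apply (Lp.memLp (H10.grad u)) i).integrable (by norm_num))
    have := ae_eq_zero_of_isWeakEigenfunction hint Ω.isOpen hc (isWeakEigenfunction_grad h i)
      hAΩ hA (by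
        filter_upwards [(ae_restrict_iff' Ω.isOpen.measurableSet).1 huA] with x hx hxA
        rw [indicator_of_mem (hAΩ hxA), hx (hAΩ hxA) hxA, PiLp.zero_apply])
    filter_upwards [this] with x hx hxΩ
    simpa [indicator_of_mem hxΩ] using hx hxΩ
  refine Lp.ext ?_
  refine EventuallyEq.trans ?_ (Lp.coeFn_zero (EuclideanSpace ℂ (Fin d)) 2 (vol Ω)).symm
  refine (ae_restrict_iff' Ω.isOpen.measurableSet).2 ?_
  filter_upwards [ae_all_iff.2 hi] with x hx hxΩ
  ext i
  simpa using hx i hxΩ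

end Eigenfunctions

/-! ### A Fredholm alternative in Hilbert space -/

section Hilbert

variable {H : Type*} [NormedAddCommGroup H] [InnerProductSpace ℂ H]

lemma inner_sub_add_smul (u v w : H) (α β : ℂ) :
    ⟪u, u + α • v - β • w⟫_ℂ = ⟪u, u⟫_ℂ + α * ⟪u, v⟫_ℂ - β * ⟪u, w⟫_ℂ := by
  rw [inner_sub_right, inner_add_right, inner_smul_right, inner_smul_right]

/-- For `l ≠ 0` the operator is `-il (i/l - T)`, and the nonreal number `i/l` is not in the spectrum
of a self-adjoint operator. -/
lemma isUnit_one_add_I_smul [CompleteSpace H] {T : H →L[ℂ] H} (hT : IsSelfAdjoint T) (l : ℝ) :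
    IsUnit (1 + (Complex.I * l) • T) := by
  rcases eq_or_ne l 0 with rfl | hl
  · simp
  have hl' : (l : ℂ) ≠ 0 := by exact_mod_cast hl
  have hz : (Complex.I / l) ∉ spectrum ℂ T := fun h => by
    have := hT.mem_spectrum_eq_re h
    have him := congrArg Complex.im this
    rw [Complex.ofReal_im, Complex.div_ofReal_im, Complex.I_im] at him
    exact hl (by simpa using him)
  rw [spectrum.notMem_iff] at hz
  have hu : IsUnit (-(Complex.I * l)) := by simp [hl]
  have := (hu.map (algebraMap ℂ (H →L[ℂ] H))).mul hz
  convert this using 1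
  rw [← Algebra.smul_def, smul_sub, Algebra.algebraMap_eq_smul_one, smul_smul]
  have : -(Complex.I * l) * (Complex.I / l) = 1 := by
    field_simp
    simp
  rw [this, one_smul, neg_smul, sub_neg_eq_add]

/-- With `S = 1 + ilD` the operator factors as `(1 + l²) S ((1 + l²)⁻¹ - S⁻¹K)`. As `S⁻¹K` is
compact, the nonzero number `(1 + l²)⁻¹` is either an eigenvalue, which injectivity excludes, or in
the resolvent set. -/
theorem isUnit_one_add_I_smul_sub_smul [CompleteSpace H] {D K : H →L[ℂ] H} (hD : IsSelfAdjoint D)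
    (hK : IsCompactOperator K) (l : ℝ)
    (hinj : ∀ u : H, (1 + (Complex.I * l) • D - (1 + (l : ℂ) ^ 2) • K : H →L[ℂ] H) u = 0 → u = 0) :
    IsUnit (1 + (Complex.I * l) • D - (1 + (l : ℂ) ^ 2) • K) := by
  obtain ⟨S, hS⟩ := isUnit_one_add_I_smul hD l
  have hl : (1 + (l : ℂ) ^ 2) ≠ 0 := by
    rw [← Complex.ofReal_pow, ← Complex.ofReal_one, ← Complex.ofReal_add]
    exact Complex.ofReal_ne_zero.2 (by positivity)
  let T : H →L[ℂ] H := (↑S⁻¹ : H →L[ℂ] H) * K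
  have hT : IsCompactOperator T := hK.clm_comp _
  have heq : 1 + (Complex.I * l) • D - (1 + (l : ℂ) ^ 2) • K
      = algebraMap ℂ (H →L[ℂ] H) (1 + (l : ℂ) ^ 2) *
        (S * (algebraMap ℂ (H →L[ℂ] H) (1 + (l : ℂ) ^ 2)⁻¹ - T)) := by
    rw [mul_sub, Units.mul_inv_cancel_left, ← Algebra.smul_def, smul_sub,
      Algebra.algebraMap_eq_smul_one, mul_smul_comm, mul_one, smul_smul, mul_inv_cancel₀ hl,
      one_smul, hS]
  rcases hT.hasEigenvalue_or_mem_resolventSet (inv_ne_zero hl) with h | h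
  · obtain ⟨u, hu⟩ := h.exists_hasEigenvector
    refine absurd (hinj u ?_) hu.2
    have hTu : T u = (1 + (l : ℂ) ^ 2)⁻¹ • u := hu.apply_eq_smul
    have h0 : (algebraMap ℂ (H →L[ℂ] H) (1 + (l : ℂ) ^ 2)⁻¹ - T) u = 0 := by
      rw [sub_apply, hTu, Algebra.algebraMap_eq_smul_one]
      simp
    rw [heq]
    change algebraMap ℂ (H →L[ℂ] H) _
      (S.1 ((algebraMap ℂ (H →L[ℂ] H) (1 + (l : ℂ) ^ 2)⁻¹ - T) u)) = 0
    rw [h0, map_zero, map_zero]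
  · rw [heq]
    exact ((isUnit_iff_ne_zero.2 hl).map (algebraMap ℂ (H →L[ℂ] H))).mul
      (S.isUnit.mul (spectrum.mem_resolventSet_iff.1 h))

end Hilbert

/-! ### Invertibility of the stationary operator -/

section Stationary

variable {d : ℕ} {Ω : Opens (EuclideanSpace ℝ (Fin d))}

local notation "E" => EuclideanSpace ℝ (Fin d)

/-- The operator on `H¹₀` representing `u ↦ -Δ u - i l div (a ∇ u) - l² u`. -/
def stationaryOp (a : Lp ℝ ∞ (vol Ω)) (l : ℝ) : H10 Ω →L[ℂ] H10 Ω :=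
  1 + (Complex.I * l) • dampingOp a - (1 + (l : ℂ) ^ 2) • massOp Ω

lemma inner_dampingL_self (a : Lp ℝ ∞ (vol Ω)) (G : L2Vec Ω) :
    ⟪G, dampingL a G⟫_ℂ = (∫ x, a x * ‖G x‖ ^ 2 ∂(vol Ω) : ℝ) := by
  rw [L2.inner_def, ← integral_complex_ofReal]
  refine integral_congr_ae ?_
  filter_upwards [coeFn_dampingL a G] with x hx
  rw [hx, inner_smul_right_eq_smul, inner_self_eq_norm_sq_to_K]
  simp

lemma integrable_mul_norm_sq (a : Lp ℝ ∞ (vol Ω)) (G : L2Vec Ω) :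
    Integrable (fun x => a x * ‖G x‖ ^ 2) (vol Ω) := by
  refine ((L2.integrable_inner (𝕜 := ℂ) G (dampingL a G)).re).congr ?_
  filter_upwards [coeFn_dampingL a G] with x hx
  rw [hx, inner_smul_right_eq_smul, inner_self_eq_norm_sq_to_K]
  simp [← Complex.ofReal_pow]

lemma ae_smul_eq_zero_of_inner_dampingL_eq_zero {a : Lp ℝ ∞ (vol Ω)}
    (ha : ∀ᵐ x ∂(vol Ω), 0 ≤ a x) {G : L2Vec Ω} (h : ⟪G, dampingL a G⟫_ℂ = 0) :
    ∀ᵐ x ∂(vol Ω), a x • G x = 0 := by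
  rw [inner_dampingL_self, Complex.ofReal_eq_zero, integral_eq_zero_iff_of_nonneg_ae
    (by filter_upwards [ha] with x hx; exact mul_nonneg hx (sq_nonneg _))
    (integrable_mul_norm_sq a G)] at h
  filter_upwards [h] with x hx
  simpa using hx

lemma volume_setOf_pos_ne_zero {a : Lp ℝ ∞ (vol Ω)} (ha : 0 < ∫ x, a x ∂(vol Ω)) :
    volume ((Ω : Set E) ∩ {x | 0 < a x}) ≠ 0 := by
  intro h
  refine ha.not_ge (integral_nonpos_of_ae ?_)
  rw [EventuallyLE, ae_restrict_iff' Ω.isOpen.measurableSet]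
  filter_upwards [measure_eq_zero_iff_ae_notMem.1 h] with x hx hxΩ
  exact not_lt.1 fun h' => hx ⟨hxΩ, h'⟩

lemma stationaryOp_apply (a : Lp ℝ ∞ (vol Ω)) (l : ℝ) (u : H10 Ω) :
    stationaryOp a l u = u + (Complex.I * l) • dampingOp a u - (1 + (l : ℂ) ^ 2) • massOp Ω u :=
  rfl

/-- Self-adjointness of the damping puts its whole contribution in the imaginary part; in the real
part the mass inside the `H¹` norm cancels the `1` of `1 + l²`. -/
lemma inner_stationaryOp_self (a : Lp ℝ ∞ (vol Ω)) (l : ℝ) (u : H10 Ω) :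
    ⟪u, stationaryOp a l u⟫_ℂ = (‖H10.grad u‖ ^ 2 - l ^ 2 * ‖H10.fn u‖ ^ 2 : ℝ)
      + Complex.I * (l * ∫ x, a x * ‖H10.grad u x‖ ^ 2 ∂(vol Ω) : ℝ) := by
  have h1 : ⟪u, dampingOp a u⟫_ℂ = ⟪H10.grad u, dampingL a (H10.grad u)⟫_ℂ :=
    ContinuousLinearMap.adjoint_inner_right (H10.gradL Ω) u (dampingL a (H10.grad u))
  have h2 : ⟪u, massOp Ω u⟫_ℂ = ⟪H10.fn u, H10.fn u⟫_ℂ :=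
    ContinuousLinearMap.adjoint_inner_right (H10.fnL Ω) u (H10.fn u)
  have h3 : ⟪u, u⟫_ℂ = ⟪H10.fn u, H10.fn u⟫_ℂ + ⟪H10.grad u, H10.grad u⟫_ℂ := H10_inner_eq u u
  have h4 := inner_sub_add_smul u (dampingOp a u) (massOp Ω u) (Complex.I * l) (1 + (l : ℂ) ^ 2)
  refine h4.trans ?_
  rw [h1, h2, h3, inner_dampingL_self, inner_self_eq_norm_sq_to_K, inner_self_eq_norm_sq_to_K]
  push_cast
  simp
  ring

theorem eq_zero_of_stationaryOp_eq_zero (hd : 1 ≤ d) (hΩ : Bornology.IsBounded (Ω : Set E))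
    (hc : IsPreconnected (Ω : Set E)) {a : Lp ℝ ∞ (vol Ω)} (ha : ∀ᵐ x ∂(vol Ω), 0 ≤ a x)
    (ha' : 0 < ∫ x, a x ∂(vol Ω)) {l : ℝ} {u : H10 Ω} (hu : stationaryOp a l u = 0) : u = 0 := by
  have hin := inner_stationaryOp_self a l u
  rw [hu, inner_zero_right] at hin
  have hre := congrArg Complex.re hin
  have him := congrArg Complex.im hin
  simp only [Complex.add_re, Complex.ofReal_re, Complex.mul_re, Complex.I_re, Complex.I_im,
    Complex.ofReal_im, Complex.zero_re, Complex.zero_im, Complex.add_im, Complex.mul_im] at hre him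
  suffices hG : H10.grad u = 0 by
    obtain ⟨C, -, hC⟩ := exists_poincare hd hΩ
    have h1 : H10.fn u = 0 := by
      have := hC u
      rw [hG, norm_zero, mul_zero] at this
      exact norm_le_zero_iff.1 this
    exact Subtype.ext ((WithLp.equiv 2 _).injective (Prod.ext h1 hG))
  -- At `l = 0` the imaginary part carries no information, but the real part is `‖∇u‖²`.
  rcases eq_or_ne l 0 with rfl | hl
  · have : ‖H10.grad u‖ ^ 2 = 0 := by linarith
    exact norm_eq_zero.1 (pow_eq_zero_iff two_ne_zero |>.1 this)
  · have h0 : ⟪H10.grad u, dampingL a (H10.grad u)⟫_ℂ = 0 := by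
      rw [inner_dampingL_self, Complex.ofReal_eq_zero]
      exact (mul_eq_zero.1 (by linarith)).resolve_left hl
    have hae := ae_smul_eq_zero_of_inner_dampingL_eq_zero ha h0
    have hdz : dampingL a (H10.grad u) = 0 := by
      refine Lp.ext ?_
      filter_upwards [hae, coeFn_dampingL a (H10.grad u),
        Lp.coeFn_zero (EuclideanSpace ℂ (Fin d)) 2 (vol Ω)] with x h1 h2 h3
      rw [h2, h1, h3, Pi.zero_apply]
    have hDz : dampingOp a u = 0 := by
      change ContinuousLinearMap.adjoint (H10.gradL Ω) (dampingL a (H10.grad u)) = 0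
      rw [hdz, map_zero]
    have hdiv : HasWeakDivergence Ω (H10.grad u) (-(l ^ 2 : ℂ) • H10.fn u : L2 Ω) := by
      rw [hasWeakDivergence_iff]
      have h1 := adjoint_gradL_gradL u
      have h2 : massOp Ω u = ContinuousLinearMap.adjoint (H10.fnL Ω) (H10.fn u) := rfl
      rw [stationaryOp_apply, hDz, smul_zero, add_zero, sub_eq_zero] at hu
      rw [map_smul, ← h2]
      change ContinuousLinearMap.adjoint (H10.gradL Ω) (H10.gradL Ω u) = _
      rw [h1]
      nth_rw 1 [hu]
      module
    refine grad_eq_zero_of_ae_eq_zero hΩ hc hdiv inter_subset_left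
      (volume_setOf_pos_ne_zero ha') ?_
    filter_upwards [hae] with x hx hxA
    exact (smul_eq_zero.1 hx).resolve_left hxA.2.ne'

theorem isUnit_stationaryOp (hd : 1 ≤ d) (hΩ : Bornology.IsBounded (Ω : Set E))
    (hc : IsPreconnected (Ω : Set E)) {a : Lp ℝ ∞ (vol Ω)} (ha : ∀ᵐ x ∂(vol Ω), 0 ≤ a x)
    (ha' : 0 < ∫ x, a x ∂(vol Ω)) (l : ℝ) : IsUnit (stationaryOp a l) :=
  isUnit_one_add_I_smul_sub_smul (isSelfAdjoint_dampingOp a) (isCompactOperator_massOp hΩ) l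
    fun _ hu => eq_zero_of_stationaryOp_eq_zero hd hΩ hc ha ha' hu

lemma continuous_stationaryOp (a : Lp ℝ ∞ (vol Ω)) : Continuous (stationaryOp a) := by
  have h1 : Continuous fun l : ℝ => (Complex.I * l) • dampingOp a :=
    (continuous_const.mul Complex.continuous_ofReal).smul continuous_const
  have h2 : Continuous fun l : ℝ => (1 + (l : ℂ) ^ 2) • massOp Ω :=
    (continuous_const.add (Complex.continuous_ofReal.pow 2)).smul continuous_const
  exact (continuous_const.add h1).sub h2

end Stationary

/-! ### The resolvent of the generator and its continuity -/

section Resolvent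

variable {d : ℕ} {Ω : Opens (EuclideanSpace ℝ (Fin d))}

local notation "E" => EuclideanSpace ℝ (Fin d)

lemma continuous_ringInverse_of_isUnit {X H : Type*} [TopologicalSpace X] [NormedAddCommGroup H]
    [NormedSpace ℂ H] [CompleteSpace H] {f : X → H →L[ℂ] H} (hf : Continuous f)
    (h : ∀ x, IsUnit (f x)) : Continuous fun x => Ring.inverse (f x) := by
  refine continuous_iff_continuousAt.2 fun x => ?_
  obtain ⟨S, hS⟩ := h x
  have h1 := NormedRing.inverse_continuousAt S
  rw [hS] at h1
  exact h1.comp hf.continuousAt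

lemma continuous_sub_smul_sub {V : Type*} [NormedAddCommGroup V] [NormedSpace ℂ V] (x y z : V) :
    Continuous fun l : ℝ => x - (Complex.I * l) • y - z := by
  fun_prop

lemma flux_ae_eq (a : Lp ℝ ∞ (vol Ω)) (u w : H10 Ω) :
    flux a u w =ᵐ[vol Ω] (H10.gradL Ω u + dampingL a (H10.gradL Ω w) : L2Vec Ω) := by
  filter_upwards [Lp.coeFn_add (H10.gradL Ω u) (dampingL a (H10.gradL Ω w)),
    coeFn_dampingL a (H10.gradL Ω w)] with x h1 h2
  rw [h1, Pi.add_apply, h2]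
  rfl

lemma hasWeakDivergence_flux_iff (a : Lp ℝ ∞ (vol Ω)) (u w : H10 Ω) (g : L2 Ω) :
    HasWeakDivergence Ω (flux a u w) g ↔
      u - massOp Ω u + dampingOp a w = -ContinuousLinearMap.adjoint (H10.fnL Ω) g := by
  have h1 : HasWeakDivergence Ω (flux a u w) g ↔
      HasWeakDivergence Ω (H10.gradL Ω u + dampingL a (H10.gradL Ω w) : L2Vec Ω) g := by
    refine forall_congr' fun φ => ?_
    rw [integral_congr_ae]
    filter_upwards [flux_ae_eq a u w] with x hx
    rw [hx]
  rw [h1, hasWeakDivergence_iff, map_add, adjoint_gradL_gradL]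
  rfl

lemma mem_generatorGraph_iff (a : Lp ℝ ∞ (vol Ω)) (U F : EnergySpace Ω) :
    (U, F) ∈ generatorGraph a ↔ H10.fnL Ω F.fst = U.snd ∧
      U.fst - massOp Ω U.fst + dampingOp a F.fst
        = -ContinuousLinearMap.adjoint (H10.fnL Ω) F.snd :=
  and_congr Iff.rfl (hasWeakDivergence_flux_iff a _ _ _)

/-- The right hand side of the stationary equation, as an operator on the energy space. -/
def stationaryRhs (a : Lp ℝ ∞ (vol Ω)) (l : ℝ) : EnergySpace Ω →L[ℂ] H10 Ω :=
  -(ContinuousLinearMap.adjoint (H10.fnL Ω) ∘L WithLp.sndL 2 ℂ (H10 Ω) (L2 Ω))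
    - (Complex.I * l) • (massOp Ω ∘L WithLp.fstL 2 ℂ (H10 Ω) (L2 Ω))
    - dampingOp a ∘L WithLp.fstL 2 ℂ (H10 Ω) (L2 Ω)

/-- The first component of the resolvent at `i l`. -/
def resolventFst (a : Lp ℝ ∞ (vol Ω)) (l : ℝ) : EnergySpace Ω →L[ℂ] H10 Ω :=
  Ring.inverse (stationaryOp a l) ∘L stationaryRhs a l

/-- The velocity field in the resolvent at `i l`. -/
def resolventVel (a : Lp ℝ ∞ (vol Ω)) (l : ℝ) : EnergySpace Ω →L[ℂ] H10 Ω :=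
  WithLp.fstL 2 ℂ (H10 Ω) (L2 Ω) + (Complex.I * l) • resolventFst a l

/-- The resolvent of the generator at `i l`. -/
def resolventOp (a : Lp ℝ ∞ (vol Ω)) (l : ℝ) : EnergySpace Ω →L[ℂ] EnergySpace Ω :=
  (WithLp.prodContinuousLinearEquiv 2 ℂ (H10 Ω) (L2 Ω)).symm.toContinuousLinearMap ∘L
    (ContinuousLinearMap.inl ℂ (H10 Ω) (L2 Ω) ∘L resolventFst a l
      + (ContinuousLinearMap.inr ℂ (H10 Ω) (L2 Ω) ∘L H10.fnL Ω) ∘L resolventVel a l)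

lemma resolventOp_fst (a : Lp ℝ ∞ (vol Ω)) (l : ℝ) (F : EnergySpace Ω) :
    (resolventOp a l F).fst = resolventFst a l F :=
  add_zero (resolventFst a l F)

lemma resolventOp_snd (a : Lp ℝ ∞ (vol Ω)) (l : ℝ) (F : EnergySpace Ω) :
    (resolventOp a l F).snd = H10.fnL Ω (F.fst + (Complex.I * l) • resolventFst a l F) :=
  zero_add (H10.fnL Ω (F.fst + (Complex.I * l) • resolventFst a l F))

lemma stationaryOp_resolventFst {a : Lp ℝ ∞ (vol Ω)} {l : ℝ} (h : IsUnit (stationaryOp a l))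
    (F : EnergySpace Ω) : stationaryOp a l (resolventFst a l F) = stationaryRhs a l F :=
  congrArg (fun T : H10 Ω →L[ℂ] H10 Ω => T (stationaryRhs a l F)) (Ring.mul_inverse_cancel _ h)

lemma resolventFst_eq {a : Lp ℝ ∞ (vol Ω)} {l : ℝ} (h : IsUnit (stationaryOp a l))
    {F : EnergySpace Ω} {u : H10 Ω} (hu : stationaryOp a l u = stationaryRhs a l F) :
    resolventFst a l F = u := by
  change Ring.inverse (stationaryOp a l) (stationaryRhs a l F) = u
  rw [← hu]
  exact congrArg (fun T : H10 Ω →L[ℂ] H10 Ω => T u) (Ring.inverse_mul_cancel _ h)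

/-- The stationary equation is the resolvent equation after elimination of the velocity. -/
lemma stationary_equation_iff {H L : Type*} [AddCommGroup H] [Module ℂ H] [AddCommGroup L]
    [Module ℂ L] (D : H →ₗ[ℂ] H) (J : H →ₗ[ℂ] L) (J' : L →ₗ[ℂ] H) (l : ℝ) (u f : H) (g : L) :
    u - J' (J u) + D (f + (Complex.I * l) • u)
        = -J' (g + (Complex.I * l) • J (f + (Complex.I * l) • u)) ↔
      u + (Complex.I * l) • D u - (1 + (l : ℂ) ^ 2) • J' (J u)
        = -J' g - (Complex.I * l) • J' (J f) - D f := by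
  have hI : (Complex.I * l) * (Complex.I * l) = -(l : ℂ) ^ 2 := by
    linear_combination (l : ℂ) ^ 2 * Complex.I_mul_I
  simp only [map_add, map_smul, smul_add, smul_smul, hI]
  rw [← sub_eq_zero, ← sub_eq_zero (b := -J' g - _ - _)]
  refine Eq.congr ?_ rfl
  module

/-- The resolvent equation at `RF` says that `(RF, F + il RF)` lies in the graph, which by
`stationary_equation_iff` is the stationary equation for the first component. Injectivity of the
stationary operator gives the left inverse. -/
theorem isResolvent_resolventOp {a : Lp ℝ ∞ (vol Ω)} {l : ℝ} (h : IsUnit (stationaryOp a l)) :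
    IsResolvent (generator Ω a) (Complex.I * l) (resolventOp a l) := by
  have hmem (F : EnergySpace Ω) :
      (resolventOp a l F, F + (Complex.I * l) • resolventOp a l F) ∈ (generator Ω a).graph := by
    rw [generator_graph, mem_generatorGraph_iff]
    have e1 : (F + (Complex.I * l) • resolventOp a l F).fst
        = F.fst + (Complex.I * l) • resolventFst a l F :=
      congrArg (fun u => F.fst + (Complex.I * l) • u) (resolventOp_fst a l F)
    have e2 : (F + (Complex.I * l) • resolventOp a l F).snd
        = F.snd + (Complex.I * l) • H10.fnL Ω (F.fst + (Complex.I * l) • resolventFst a l F) :=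
      congrArg (fun u => F.snd + (Complex.I * l) • u) (resolventOp_snd a l F)
    rw [e1, e2, resolventOp_fst, resolventOp_snd]
    exact ⟨rfl, (stationary_equation_iff (dampingOp a : H10 Ω →ₗ[ℂ] H10 Ω)
      (H10.fnL Ω : H10 Ω →ₗ[ℂ] L2 Ω)
      (ContinuousLinearMap.adjoint (H10.fnL Ω) : L2 Ω →ₗ[ℂ] H10 Ω) l _ _ _).2
      (stationaryOp_resolventFst h F)⟩
  have hdom (F : EnergySpace Ω) : resolventOp a l F ∈ (generator Ω a).domain :=
    LinearPMap.mem_domain_of_mem_graph (hmem F)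
  refine ⟨hdom, fun F => ?_, fun U => ?_⟩
  · rw [← (LinearPMap.image_iff (hdom F)).2 (hmem F), add_sub_cancel_right]
  · have hU := LinearPMap.mem_graph _ U
    rw [generator_graph, mem_generatorGraph_iff] at hU
    obtain ⟨h1, h2⟩ := hU
    set V : EnergySpace Ω := generator Ω a U
    set F : EnergySpace Ω := V - (Complex.I * l) • (U : EnergySpace Ω) with hF
    have hV : V = F + (Complex.I * l) • (U : EnergySpace Ω) := by rw [hF, sub_add_cancel]
    have e1 : V.fst = F.fst + (Complex.I * l) • (U : EnergySpace Ω).fst :=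
      congrArg WithLp.fst hV
    have e2 : V.snd = F.snd + (Complex.I * l) • (U : EnergySpace Ω).snd :=
      congrArg WithLp.snd hV
    rw [e2, ← h1, e1] at h2
    have h3 : resolventFst a l F = (U : EnergySpace Ω).fst :=
      resolventFst_eq h ((stationary_equation_iff (dampingOp a : H10 Ω →ₗ[ℂ] H10 Ω)
        (H10.fnL Ω : H10 Ω →ₗ[ℂ] L2 Ω)
        (ContinuousLinearMap.adjoint (H10.fnL Ω) : L2 Ω →ₗ[ℂ] H10 Ω) l _ _ _).1 h2)
    refine (WithLp.equiv 2 _).injective (Prod.ext ?_ ?_)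
    · exact (resolventOp_fst a l F).trans h3
    · refine (resolventOp_snd a l F).trans ?_
      rw [h3, ← e1]
      exact h1

/-- Inversion is continuous at units of the Banach algebra of bounded operators, and everything else
in `resolventOp` is polynomial in `l`. -/
theorem continuous_resolventOp {a : Lp ℝ ∞ (vol Ω)} (h : ∀ l, IsUnit (stationaryOp a l)) :
    Continuous (resolventOp a) := by
  have hI : Continuous fun l : ℝ => Complex.I * (l : ℂ) :=
    continuous_const.mul Complex.continuous_ofReal
  have h1 : Continuous fun l => Ring.inverse (stationaryOp a l) :=
    continuous_ringInverse_of_isUnit (continuous_stationaryOp a) h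
  have h2 : Continuous (stationaryRhs a) :=
    continuous_sub_smul_sub (V := EnergySpace Ω →L[ℂ] H10 Ω) _ _ _
  have h3 : Continuous (resolventFst a) := h1.clm_comp h2
  have h4 : Continuous (resolventVel a) := continuous_const.add (hI.smul h3)
  exact continuous_const.clm_comp
    ((continuous_const.clm_comp h3).add (continuous_const.clm_comp h4))

end Resolvent

end KelvinVoigt

end

theorem mainTheorem4 {d : ℕ} (hd : 1 ≤ d)
    (Ω : TopologicalSpace.Opens (EuclideanSpace ℝ (Fin d)))
    (hΩ_bounded : Bornology.IsBounded (Ω : Set (EuclideanSpace ℝ (Fin d))))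
    (hΩ_connected : IsConnected (Ω : Set (EuclideanSpace ℝ (Fin d))))
    (a : Lp ℝ ∞ (KelvinVoigt.vol Ω))
    (ha_nonneg : ∀ᵐ x ∂(KelvinVoigt.vol Ω), 0 ≤ a x)
    (ha_pos : 0 < ∫ x, a x ∂(KelvinVoigt.vol Ω))
    (M : ℝ) (hM : 0 < M) :
    ∃ C : ℝ, 0 < C ∧ ∀ l : ℝ, |l| ≤ M →
      ∃ R : KelvinVoigt.EnergySpace Ω →L[ℂ] KelvinVoigt.EnergySpace Ω,
        KelvinVoigt.IsResolvent (KelvinVoigt.generator Ω a) (Complex.I * (l : ℂ)) R ∧ ‖R‖ ≤ C := by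
  have hu := KelvinVoigt.isUnit_stationaryOp hd hΩ_bounded hΩ_connected.isPreconnected ha_nonneg
    ha_pos
  obtain ⟨C, hC⟩ := (isCompact_Icc (a := -M) (b := M)).exists_bound_of_continuousOn
    (E := KelvinVoigt.EnergySpace Ω →L[ℂ] KelvinVoigt.EnergySpace Ω)
    (KelvinVoigt.continuous_resolventOp hu).continuousOn
  -- The maximum with `1` only makes the constant strictly positive.
  exact ⟨max C 1, lt_max_of_lt_right one_pos, fun l hl => ⟨KelvinVoigt.resolventOp a l,
    KelvinVoigt.isResolvent_resolventOp (hu l), (hC l (abs_le.1 hl)).trans (le_max_left _ _)⟩⟩
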